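/- Consider a system of two first-order equations $$F(u_1,\dots,u_4,v_1,\dots,v_4)=0,\qquad H(u_1,\dots,u_4,v_1,\dots,v_4)=0,\qquad u_i=\frac{\partial u}{\partial x^i},\ v_i=\frac{\partial v}{\partial x^i},$$ for two real functions $u,v$ of four real variables $x^1,\dots,x^4$, where $F,H$ are real-valued $C^\infty$ functions on an open set $\Omega$ of real $2\times4$ matrices $U=\begin{pmatrix}u_1&\dots&u_4\\ v_1&\dots&v_4\end{pmatrix}$. Let $X=\{U\in\Omega: F(U)=H(U)=0\}$ and assume that $X$ is non-empty and connected. Put $$g^{ij}=\tfrac12\left(F_{u_i}H_{v_j}+F_{u_j}H_{v_i}-F_{v_i}H_{u_j}-F_{v_j}H_{u_i}\right),$$ so that $g^{ij}p_ip_j=0$ is the characteristic variety $\det\Big[\sum_i p_i\begin{pmatrix}F_{u_i}&F_{v_i}\\H_{u_i}&H_{v_i}\end{pmatrix}\Big]=0$, and assume that the system is non-degenerate: $\det(g^{ij})\neq0$ at every point of $X$. Let $\mathbf{SL}(6)=\mathbf{SL}(6,\mathbb R)$ act (where defined) by $$U\mapsto (AU+B)(CU+D)^{-1},\qquad \begin{pmatrix}A&B\\C&D\end{pmatrix}\in\mathbf{SL}(6),$$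 with $A,B,C,D$ of sizes $2\times2,\ 2\times4,\ 4\times2,\ 4\times4$; this is the action induced by linear transformations of the space with coordinates $(u,v,x^1,\dots,x^4)$. Then the following conditions are equivalent: (a) The system is linearisable by a transformation from $\mathbf{SL}(6)$: some element of $\mathbf{SL}(6)$ is defined at every point of $X$ and, near each point of $X$, transforms the system into one and the same system of two linearly independent equations $b^iu_i+c^iv_i+m=0$, $\beta^iu_i+\gamma^iv_i+\mu=0$ with constant coefficients. (b) The system is invariant under a $13$-dimensional subgroup $G$ of $\mathbf{SL}(6)$; that is, the Lie algebra of $G$ (the matrices $Y$ with $\exp(tY)\in G$ for all $t\in\mathbb R$) has dimension $13$ and, for each such $Y$ and each $U\in X$, $\exp(tY)$ maps $U$ to a point of $X$ for all sufficiently small $|t|$. (c) The conformal structure $[g]$, $g=g_{ij}\,dx^idx^j$ with $(g_{ij})=(g^{ij})^{-1}$, is flat on every solution: for every $C^\infty$ solution $(u,v)$ on an open subset of $\mathbb R^4$ the Weyl tensor $W$ of $g$ vanishes. -/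

import Mathlib

open scoped Matrix Topology ContDiff

noncomputable section

namespace FirstOrderSystem

/-- The space of `2 × 4` matrices `U`: row `0` holds `u₁, …, u₄`, row `1` holds `v₁, …, v₄`.
It is the affine chart of the Grassmannian of `4`-planes in the `6`-space with coordinates
`(u, v; x¹, …, x⁴)`; `U` stands for the `4`-plane `du = uᵢ dxⁱ`, `dv = vᵢ dxⁱ`. -/
abbrev JetSpace : Type := Fin 2 → Fin 4 → ℝ

/-- The space of the independent variables. -/
abbrev Base : Type := Fin 4 → ℝ

end FirstOrderSystem

open FirstOrderSystem

/-- A system `F(uᵢ, vᵢ) = 0`, `H(uᵢ, vᵢ) = 0` of two first-order equations for two functions of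
four variables, with `F`, `H` smooth on an open set `dom` of values of the derivatives. -/
structure FirstOrderSystem where
  dom : Set JetSpace
  isOpen_dom : IsOpen dom
  F : JetSpace → ℝ
  H : JetSpace → ℝ
  smooth_F : ContDiffOn ℝ ∞ F dom
  smooth_H : ContDiffOn ℝ ∞ H dom

namespace FirstOrderSystem

/-- `∂Φ/∂uᵢ` (for `a = 0`) and `∂Φ/∂vᵢ` (for `a = 1`). -/
def jetDeriv (Φ : JetSpace → ℝ) (a : Fin 2) (i : Fin 4) (U : JetSpace) : ℝ :=
  fderiv ℝ Φ U (Pi.single a (Pi.single i 1))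

/-- `∂φ/∂xⁱ`. -/
def partialDeriv (i : Fin 4) (φ : Base → ℝ) (x : Base) : ℝ :=
  fderiv ℝ φ x (Pi.single i 1)

/-- The `2 × 4` matrix of the first derivatives of `(u, v)` at `x`. -/
def jet (u v : Base → ℝ) (x : Base) : JetSpace :=
  ![fun i => partialDeriv i u x, fun i => partialDeriv i v x]

variable (S : FirstOrderSystem)

/-- The subset `X` of the Grassmannian (in the affine chart) defined by the system. -/
def locus : Set JetSpace := {U | U ∈ S.dom ∧ S.F U = 0 ∧ S.H U = 0}

/-- The matrix `∑ pᵢ (F_{uᵢ} F_{vᵢ}; H_{uᵢ} H_{vᵢ})`, whose determinant defines the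
characteristic variety. -/
def symbol (U : JetSpace) (p : Fin 4 → ℝ) : Matrix (Fin 2) (Fin 2) ℝ :=
  ∑ i, p i • !![jetDeriv S.F 0 i U, jetDeriv S.F 1 i U; jetDeriv S.H 0 i U, jetDeriv S.H 1 i U]

/-- The symmetric matrix `gⁱʲ` of the characteristic quadric. -/
def cometric (U : JetSpace) : Matrix (Fin 4) (Fin 4) ℝ :=
  Matrix.of fun i j =>
    (jetDeriv S.F 0 i U * jetDeriv S.H 1 j U + jetDeriv S.F 0 j U * jetDeriv S.H 1 i U
      - jetDeriv S.F 1 i U * jetDeriv S.H 0 j U - jetDeriv S.F 1 j U * jetDeriv S.H 0 i U) / 2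

/-- The characteristic variety `det (symbol) = 0` is the quadric `gⁱʲ pᵢ pⱼ = 0`. -/
theorem det_symbol (U : JetSpace) (p : Fin 4 → ℝ) :
    (S.symbol U p).det = ∑ i, ∑ j, S.cometric U i j * p i * p j := by
  simp [symbol, cometric, Matrix.det_fin_two, Fin.sum_univ_four]
  ring

/-- The characteristic variety is a quadric of rank `4` at every point of the locus. -/
def Nondegenerate : Prop := ∀ U ∈ S.locus, (S.cometric U).det ≠ 0

/-- `(u, v)` is a smooth solution of the system on the open set `D`. -/
structure IsSolutionOn (u v : Base → ℝ) (D : Set Base) : Prop where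
  isOpen : IsOpen D
  smooth_u : ContDiffOn ℝ ∞ u D
  smooth_v : ContDiffOn ℝ ∞ v D
  mem_locus : ∀ x ∈ D, jet u v x ∈ S.locus

/-- The representative `gᵢⱼ(x)` of the conformal structure on a solution `(u, v)`: the inverse
matrix of `gⁱʲ`. -/
def metric (u v : Base → ℝ) (x : Base) : Matrix (Fin 4) (Fin 4) ℝ := (S.cometric (jet u v x))⁻¹

end FirstOrderSystem

/-! ### Curvature of a metric on a domain of `ℝ⁴`, in coordinates -/

namespace Curvature

open FirstOrderSystem

variable (g : Base → Matrix (Fin 4) (Fin 4) ℝ)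

/-- Christoffel symbols `Γⁱⱼₖ`. -/
def christoffel (i j k : Fin 4) (x : Base) : ℝ :=
  ∑ s, (g x)⁻¹ i s * (partialDeriv j (fun y => g y s k) x + partialDeriv k (fun y => g y s j) x
    - partialDeriv s (fun y => g y j k) x) / 2

/-- The curvature tensor `Rⁱⱼₖₗ = ∂ₖ Γⁱₗⱼ - ∂ₗ Γⁱₖⱼ + Γⁱₖₛ Γˢₗⱼ - Γⁱₗₛ Γˢₖⱼ`. -/
def riemannUp (i j k l : Fin 4) (x : Base) : ℝ :=
  partialDeriv k (christoffel g i l j) x - partialDeriv l (christoffel g i k j) x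
    + ∑ s, (christoffel g i k s x * christoffel g s l j x
      - christoffel g i l s x * christoffel g s k j x)

/-- `Rᵢⱼₖₗ = gᵢₛ Rˢⱼₖₗ`. -/
def riemann (i j k l : Fin 4) (x : Base) : ℝ := ∑ s, g x i s * riemannUp g s j k l x

/-- The Ricci tensor `Rⱼₗ = Rⁱⱼᵢₗ`. -/
def ricci (j l : Fin 4) (x : Base) : ℝ := ∑ i, riemannUp g i j i l x

/-- The scalar curvature. -/
def scalar (x : Base) : ℝ := ∑ j, ∑ l, (g x)⁻¹ j l * ricci g j l x

/-- The Schouten tensor in dimension `4`. -/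
def schouten (i j : Fin 4) (x : Base) : ℝ := ricci g i j x / 2 - scalar g x / 12 * g x i j

/-- The Weyl tensor `Wᵢⱼₖₗ` in dimension `4`. -/
def weyl (i j k l : Fin 4) (x : Base) : ℝ :=
  riemann g i j k l x - schouten g i k x * g x j l - schouten g j l x * g x i k
    + schouten g j k x * g x i l + schouten g i l x * g x j k

end Curvature

namespace FirstOrderSystem

/-! ### The equivalence group -/

/-- The group `SL(6)` of the `6`-space with coordinates `(u, v; x¹, …, x⁴)`. -/
abbrev SL6 : Type := Matrix.SpecialLinearGroup (Fin 2 ⊕ Fin 4) ℝ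

/-- The matrix `C U + D` for `g = (A B; C D)`. -/
def denom (g : SL6) (U : JetSpace) : Matrix (Fin 4) (Fin 4) ℝ :=
  g.1.toBlocks₂₁ * Matrix.of U + g.1.toBlocks₂₂

/-- The action `U ↦ (A U + B) (C U + D)⁻¹` of `g = (A B; C D)`, meaningful where `C U + D` is
invertible (that is, where `g` maps the `4`-plane of `U` to a `4`-plane in the chart). -/
def act (g : SL6) (U : JetSpace) : JetSpace :=
  Matrix.of.symm ((g.1.toBlocks₁₁ * Matrix.of U + g.1.toBlocks₁₂) * (denom g U)⁻¹)

/-- The set of the solutions `U` of two scalar linear equations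
`bⁱ uᵢ + cⁱ vᵢ + m = 0`, `βⁱ uᵢ + γⁱ vᵢ + μ = 0`, with coefficients `L k` and constants `m k`. -/
def linearLocus (L : Fin 2 → JetSpace) (m : Fin 2 → ℝ) : Set JetSpace :=
  {U | ∀ k, (∑ a, ∑ i, L k a i * U a i) + m k = 0}

variable (S : FirstOrderSystem)

/-- Some `g ∈ SL(6)` is defined on all of the locus and transforms the system into a system of two
independent constant-coefficient linear equations. As `S` is given on an open set of derivatives
only, the two systems are compared near each point of the locus. -/
def Linearisable : Prop :=
  ∃ (g : SL6) (L : Fin 2 → JetSpace) (m : Fin 2 → ℝ), LinearIndependent ℝ L ∧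
    ∀ U ∈ S.locus, IsUnit (denom g U).det ∧
      ∀ᶠ U' in 𝓝 U, U' ∈ S.locus ↔ act g U' ∈ linearLocus L m

/-- The matrices `A` that generate a one-parameter subgroup `exp (t A)` inside `G`; these form the
Lie algebra of `G`. -/
def lieAlgebraSet (G : Subgroup SL6) : Set (Matrix (Fin 2 ⊕ Fin 4) (Fin 2 ⊕ Fin 4) ℝ) :=
  {A | ∀ t : ℝ, ∃ g ∈ G, g.1 = NormedSpace.exp (t • A)}

/-- The dimension of `G` as a Lie group: the dimension of its Lie algebra. -/
def lieDim (G : Subgroup SL6) : ℕ := Module.finrank ℝ (Submodule.span ℝ (lieAlgebraSet G))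

/-- Invariance of the system under `G`. As `S` is given on an open set of derivatives only,
this is local invariance: each one-parameter subgroup of `G` moves a point of the locus
within the locus for small values of the parameter. -/
def InvariantUnder (G : Subgroup SL6) : Prop :=
  ∀ A ∈ lieAlgebraSet G, ∀ U ∈ S.locus, ∀ᶠ t : ℝ in 𝓝 0,
    ∀ g : SL6, g.1 = NormedSpace.exp (t • A) → IsUnit (denom g U).det ∧ act g U ∈ S.locus

/-- The conformal structure of the characteristic variety is flat (`W = 0`) on every solution. -/
def FlatOnSolutions : Prop :=
  ∀ (D : Set Base) (u v : Base → ℝ), S.IsSolutionOn u v D →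
    ∀ x ∈ D, ∀ i j k l, Curvature.weyl (S.metric u v) i j k l x = 0

end FirstOrderSystem

end

/-! All three conditions are compared with one pointwise condition, `Osculating`. Write the
derivative of `(F, H)` at a point `U` of the locus as `t ↦ contr (t E)`, where `E = frame U`. The
cometric is `E Q Eᵀ` for a fixed quadric `Q`, so non-degeneracy makes `E` invertible. To first order
all systems are therefore alike: the tangent space is a copy of the kernel of `contr`, two traceless
`2 × 2` blocks. A linear system seen through a projective transformation has a second fundamental
form `t ↦ t C t` with some `4 × 2` matrix `C`. `Osculating` asks this at each point, with `C`
depending on the point: second-order contact with some linear system.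

`Osculating` implies (a). Third-order compatibility forces the Riccati equation `dC(t) = C t C`
along the locus (`oscDeriv_eq`; the algebra is `eq_zero_of_contr_symm`). It says exactly that the
osculating linear system does not change along curves in the locus (`modelCompat_of_curve`,
`mem_modelSet_of_curve`). So the locus coincides locally with its osculating system
(`eventually_mem_locus_iff`), and by connectedness a single projective map flattens it everywhere
(`Osculating.linearisable`).

(b) implies `Osculating`. An infinitesimal symmetry is determined at a point by its value (6
parameters) and its linear part (4 + 3), which gives the bound 13 (`symmetryCoords_injective`). If
13 is attained, some symmetry vanishes at the point and has the identity as linear part. Its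
quadratic part then exhibits `C` (`osculating_of_finrank_symmetryAlgebra`).

(c) implies `Osculating`. The Weyl tensor is tested on simple waves, solutions whose jets run along
a curve with tangent vectors `ξ ⊗ p`. With the curve parameter equal to the square of a function
vanishing at the origin, the metric is flat to first order there, and the Weyl tensor on a null
plane becomes linear in the derivative of the cometric (`weyl_null_plane`,
`FlatOnSolutions.cometricDeriv_eq_zero`). The resulting conditions on the second fundamental form
leave only the forms `t C t` (`exists_contr_of_simpleJet`).

Conversely, a linearisable system has as its group the normaliser of its translations and dilation,
of dimension 13 (`Linearisable.exists_invariantUnder`). Its cometric is constant up to a factor in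
the new independent variables, so the metric is conformally flat on every solution
(`Linearisable.flatOnSolutions`). -/

open scoped Matrix Topology ContDiff

noncomputable section

namespace FirstOrderSystem

/-! ### Linear algebra of the model `u₁ + v₂ = 0`, `u₃ + v₄ = 0` -/

/-- The left-hand sides of the model system `u₁ + v₂ = 0`, `u₃ + v₄ = 0`. -/
def contr : Matrix (Fin 2) (Fin 4) ℝ →ₗ[ℝ] (Fin 2 → ℝ) where
  toFun t := ![t 0 0 + t 1 1, t 0 2 + t 1 3]
  map_add' s t := by ext k; fin_cases k <;> simp <;> ring
  map_smul' c t := by ext k; fin_cases k <;> simp <;> ring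

@[simp] theorem contr_apply_zero (t : Matrix (Fin 2) (Fin 4) ℝ) : contr t 0 = t 0 0 + t 1 1 := rfl

@[simp] theorem contr_apply_one (t : Matrix (Fin 2) (Fin 4) ℝ) : contr t 1 = t 0 2 + t 1 3 := rfl

/-- The general solution of the model system: two traceless `2 × 2` blocks. -/
def modelJet (a b c a' b' c' : ℝ) : Matrix (Fin 2) (Fin 4) ℝ := !![a, b, a', b'; c, -a, c', -a']

@[simp] theorem contr_modelJet (a b c a' b' c' : ℝ) : contr (modelJet a b c a' b' c') = 0 := by
  ext k; fin_cases k <;> simp [modelJet]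

theorem eq_modelJet {t : Matrix (Fin 2) (Fin 4) ℝ} (ht : contr t = 0) :
    t = modelJet (t 0 0) (t 0 1) (t 1 0) (t 0 2) (t 0 3) (t 1 2) := by
  have h0 := congrFun ht 0
  have h1 := congrFun ht 1
  simp only [contr_apply_zero, contr_apply_one, Pi.zero_apply] at h0 h1
  ext i j
  fin_cases i <;> fin_cases j <;> simp [modelJet] <;> linarith

/-- A right inverse of `contr`. -/
def contrSection : (Fin 2 → ℝ) →ₗ[ℝ] Matrix (Fin 2) (Fin 4) ℝ where
  toFun c := !![c 0, 0, c 1, 0; 0, 0, 0, 0]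
  map_add' c d := by ext i j; fin_cases i <;> fin_cases j <;> simp
  map_smul' r c := by ext i j; fin_cases i <;> fin_cases j <;> simp

@[simp] theorem contr_contrSection (c : Fin 2 → ℝ) : contr (contrSection c) = c := by
  ext k; fin_cases k <;> simp [contrSection]

section entries

variable (a b c a' b' c' : ℝ)

theorem modelJet_00 : modelJet a b c a' b' c' 0 0 = a := rfl
theorem modelJet_01 : modelJet a b c a' b' c' 0 1 = b := rfl
theorem modelJet_02 : modelJet a b c a' b' c' 0 2 = a' := rfl
theorem modelJet_03 : modelJet a b c a' b' c' 0 3 = b' := rfl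
theorem modelJet_10 : modelJet a b c a' b' c' 1 0 = c := rfl
theorem modelJet_11 : modelJet a b c a' b' c' 1 1 = -a := rfl
theorem modelJet_12 : modelJet a b c a' b' c' 1 2 = c' := rfl
theorem modelJet_13 : modelJet a b c a' b' c' 1 3 = -a' := rfl

end entries

theorem contr_mul_mul_modelJet (C : Matrix (Fin 4) (Fin 2) ℝ) (a b c a' b' c' d e f d' e' f' : ℝ) :
    contr (modelJet a b c a' b' c' * C * modelJet d e f d' e' f') =
      ![(a * C 0 0 + b * C 1 0 + a' * C 2 0 + b' * C 3 0) * d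
          + (a * C 0 1 + b * C 1 1 + a' * C 2 1 + b' * C 3 1) * f
          + (c * C 0 0 - a * C 1 0 + c' * C 2 0 - a' * C 3 0) * e
          - (c * C 0 1 - a * C 1 1 + c' * C 2 1 - a' * C 3 1) * d,
        (a * C 0 0 + b * C 1 0 + a' * C 2 0 + b' * C 3 0) * d'
          + (a * C 0 1 + b * C 1 1 + a' * C 2 1 + b' * C 3 1) * f'
          + (c * C 0 0 - a * C 1 0 + c' * C 2 0 - a' * C 3 0) * e'
          - (c * C 0 1 - a * C 1 1 + c' * C 2 1 - a' * C 3 1) * d'] := by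
  ext k
  fin_cases k <;>
  simp only [Fin.zero_eta, Fin.mk_one, contr_apply_zero, contr_apply_one, Matrix.mul_apply,
    Fin.sum_univ_four, Fin.sum_univ_two, modelJet_00, modelJet_01, modelJet_02, modelJet_03,
    modelJet_10, modelJet_11, modelJet_12, modelJet_13, Matrix.cons_val_zero,
    Matrix.cons_val_one] <;> ring

/-- For a jet with one nonzero parameter in each block, a component of `contr (t C t)` is a single
entry of `C` up to sign; eight such jets exhaust `C`. Hence a symmetry with vanishing value and
linear part has no quadratic part either. -/
theorem eq_zero_of_contr_mul_mul_self {C : Matrix (Fin 4) (Fin 2) ℝ}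
    (h : ∀ t, contr t = 0 → contr (t * C * t) = 0) : C = 0 := by
  have key : ∀ a b c a' b' c', _ := fun a b c a' b' c' =>
    (contr_mul_mul_modelJet C a b c a' b' c' a b c a' b' c').symm.trans
      (h _ (contr_modelJet a b c a' b' c'))
  have k0 := fun a b c a' b' c' => congrFun (key a b c a' b' c') 0
  have k1 := fun a b c a' b' c' => congrFun (key a b c a' b' c') 1
  simp only [Matrix.cons_val_zero, Matrix.cons_val_one, Pi.zero_apply] at k0 k1
  have e1 := k1 1 0 0 0 1 0
  have e2 := k1 1 0 0 0 0 1
  have e3 := k1 0 1 0 0 0 1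
  have e4 := k1 0 0 1 0 1 0
  have e5 := k0 0 1 0 1 0 0
  have e6 := k0 0 0 1 1 0 0
  have e7 := k0 0 0 1 0 1 0
  have e8 := k0 0 1 0 0 0 1
  have f1 := k1 (-1) 0 0 0 1 0
  have f2 := k1 (-1) 0 0 0 0 1
  have f3 := k1 0 (-1) 0 0 0 1
  have f4 := k1 0 0 (-1) 0 1 0
  have f5 := k0 0 1 0 (-1) 0 0
  have f6 := k0 0 0 1 (-1) 0 0
  have f7 := k0 0 0 1 0 (-1) 0
  have f8 := k0 0 1 0 0 0 (-1)
  ext i j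
  fin_cases i <;> fin_cases j <;> simp <;> linarith

theorem map_modelJet_eq (K : Matrix (Fin 2) (Fin 4) ℝ →ₗ[ℝ] Matrix (Fin 4) (Fin 2) ℝ)
    (a b c a' b' c' : ℝ) :
    K (modelJet a b c a' b' c') =
      a • K (modelJet 1 0 0 0 0 0) + b • K (modelJet 0 1 0 0 0 0) + c • K (modelJet 0 0 1 0 0 0)
      + a' • K (modelJet 0 0 0 1 0 0) + b' • K (modelJet 0 0 0 0 1 0)
      + c' • K (modelJet 0 0 0 0 0 1) := by
  simp only [← map_smul, ← map_add]
  congr 1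
  ext i j
  fin_cases i <;> fin_cases j <;> simp [modelJet]

/-- The algebra behind the Riccati equation: the hypothesis is what remains of the third-order
identity after antisymmetrising in two arguments. It is tested on jets supported in one block. -/
theorem eq_zero_of_contr_symm (K : Matrix (Fin 2) (Fin 4) ℝ →ₗ[ℝ] Matrix (Fin 4) (Fin 2) ℝ)
    (h : ∀ i j k, contr i = 0 → contr j = 0 → contr k = 0 →
      contr (i * K k * j + j * K k * i - i * K j * k - k * K j * i) = 0)
    {t : Matrix (Fin 2) (Fin 4) ℝ} (ht : contr t = 0) : K t = 0 := by
  have key : ∀ (a b c a' b' c' d e f d' e' f' l m n l' m' n' : ℝ), _ :=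
    fun a b c a' b' c' d e f d' e' f' l m n l' m' n' => h (modelJet a b c a' b' c')
      (modelJet d e f d' e' f') (modelJet l m n l' m' n') (by simp) (by simp) (by simp)
  simp only [map_add, map_sub, contr_mul_mul_modelJet] at key
  have k0 := fun a b c a' b' c' d e f d' e' f' l m n l' m' n' =>
    congrFun (key a b c a' b' c' d e f d' e' f' l m n l' m' n') 0
  have k1 := fun a b c a' b' c' d e f d' e' f' l m n l' m' n' =>
    congrFun (key a b c a' b' c' d e f d' e' f' l m n l' m' n') 1
  simp only [Matrix.cons_val_zero, Matrix.cons_val_one, Pi.zero_apply, Pi.add_apply,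
    Pi.sub_apply] at k0 k1
  -- A component of `contr` only sees the corresponding block of the last factor. With `i`, `k` in
  -- one block and `j` in the other, the component of the block of `j` retains only `i K(k) j`.
  have z00 : ∀ l m n, K (modelJet l m n 0 0 0) 0 0 = 0 := fun l m n => by
    linarith [k1 0 0 1 0 0 0 0 0 0 0 1 0 l m n 0 0 0]
  have z11 : ∀ l m n, K (modelJet l m n 0 0 0) 1 1 = 0 := fun l m n => by
    linarith [k1 0 1 0 0 0 0 0 0 0 0 0 1 l m n 0 0 0]
  have z01 : ∀ l m n, K (modelJet l m n 0 0 0) 0 1 = 0 := fun l m n => by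
    linarith [k1 1 0 0 0 0 0 0 0 0 0 0 1 l m n 0 0 0]
  have z10 : ∀ l m n, K (modelJet l m n 0 0 0) 1 0 = 0 := fun l m n => by
    linarith [k1 1 0 0 0 0 0 0 0 0 0 1 0 l m n 0 0 0]
  have z20 : ∀ l m n, K (modelJet 0 0 0 l m n) 2 0 = 0 := fun l m n => by
    linarith [k0 0 0 0 0 0 1 0 1 0 0 0 0 0 0 0 l m n]
  have z31 : ∀ l m n, K (modelJet 0 0 0 l m n) 3 1 = 0 := fun l m n => by
    linarith [k0 0 0 0 0 1 0 0 0 1 0 0 0 0 0 0 l m n]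
  have z21 : ∀ l m n, K (modelJet 0 0 0 l m n) 2 1 = 0 := fun l m n => by
    linarith [k0 0 0 0 1 0 0 0 0 1 0 0 0 0 0 0 l m n]
  have z30 : ∀ l m n, K (modelJet 0 0 0 l m n) 3 0 = 0 := fun l m n => by
    linarith [k0 0 0 0 1 0 0 0 1 0 0 0 0 0 0 0 l m n]
  -- Now `i`, `k` lie in the block of the component and `j` in the other. For traceless `2 × 2`
  -- matrices `xy + yx` is scalar, so the two terms with `K(j)` only see the trace of a block of
  -- `K(j)`. Once these traces vanish, `j K(k) i` isolates the remaining entries.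
  have t0h : K (modelJet 1 0 0 0 0 0) 2 0 + K (modelJet 1 0 0 0 0 0) 3 1 = 0 := by
    linarith [k1 0 0 0 0 1 0 0 0 1 0 0 0 0 0 0 1 0 0, k1 0 0 0 0 0 1 0 1 0 0 0 0 0 0 0 1 0 0, k1 0 0 0 1 0 0 1 0 0 0 0 0 0 0 0 1 0 0]
  have t0e : K (modelJet 0 1 0 0 0 0) 2 0 + K (modelJet 0 1 0 0 0 0) 3 1 = 0 := by
    linarith [k1 0 0 0 0 1 0 0 0 1 0 0 0 0 0 0 0 1 0, k1 0 0 0 0 0 1 0 1 0 0 0 0 0 0 0 0 1 0, k1 0 0 0 1 0 0 1 0 0 0 0 0 0 0 0 0 1 0]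
  have t0f : K (modelJet 0 0 1 0 0 0) 2 0 + K (modelJet 0 0 1 0 0 0) 3 1 = 0 := by
    linarith [k1 0 0 0 0 1 0 0 0 1 0 0 0 0 0 0 0 0 1, k1 0 0 0 0 0 1 0 1 0 0 0 0 0 0 0 0 0 1, k1 0 0 0 1 0 0 1 0 0 0 0 0 0 0 0 0 0 1]
  have t1h : K (modelJet 0 0 0 1 0 0) 0 0 + K (modelJet 0 0 0 1 0 0) 1 1 = 0 := by
    linarith [k0 0 1 0 0 0 0 0 0 0 0 0 1 1 0 0 0 0 0, k0 0 0 1 0 0 0 0 0 0 0 1 0 1 0 0 0 0 0, k0 1 0 0 0 0 0 0 0 0 1 0 0 1 0 0 0 0 0]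
  have t1e : K (modelJet 0 0 0 0 1 0) 0 0 + K (modelJet 0 0 0 0 1 0) 1 1 = 0 := by
    linarith [k0 0 1 0 0 0 0 0 0 0 0 0 1 0 1 0 0 0 0, k0 0 0 1 0 0 0 0 0 0 0 1 0 0 1 0 0 0 0, k0 1 0 0 0 0 0 0 0 0 1 0 0 0 1 0 0 0 0]
  have t1f : K (modelJet 0 0 0 0 0 1) 0 0 + K (modelJet 0 0 0 0 0 1) 1 1 = 0 := by
    linarith [k0 0 1 0 0 0 0 0 0 0 0 0 1 0 0 1 0 0 0, k0 0 0 1 0 0 0 0 0 0 0 1 0 0 0 1 0 0 0, k0 1 0 0 0 0 0 0 0 0 1 0 0 0 0 1 0 0 0]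
  have w0h00 : K (modelJet 0 0 0 1 0 0) 0 0 = 0 := by
    linarith [k1 0 0 0 0 1 0 0 0 1 0 0 0 0 0 0 1 0 0, t0f]
  have w0h11 : K (modelJet 0 0 0 1 0 0) 1 1 = 0 := by
    linarith [k1 0 0 0 0 0 1 0 1 0 0 0 0 0 0 0 1 0 0, t0e]
  have w0h01 : K (modelJet 0 0 0 1 0 0) 0 1 = 0 := by
    linarith [k1 0 0 0 0 0 1 1 0 0 0 0 0 0 0 0 1 0 0, t0h]
  have w0h10 : K (modelJet 0 0 0 1 0 0) 1 0 = 0 := by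
    linarith [k1 0 0 0 0 1 0 1 0 0 0 0 0 0 0 0 1 0 0, t0h]
  have w0e00 : K (modelJet 0 0 0 0 1 0) 0 0 = 0 := by
    linarith [k1 0 0 0 0 1 0 0 0 1 0 0 0 0 0 0 0 1 0, t0f]
  have w0e11 : K (modelJet 0 0 0 0 1 0) 1 1 = 0 := by
    linarith [k1 0 0 0 0 0 1 0 1 0 0 0 0 0 0 0 0 1 0, t0e]
  have w0e01 : K (modelJet 0 0 0 0 1 0) 0 1 = 0 := by
    linarith [k1 0 0 0 0 0 1 1 0 0 0 0 0 0 0 0 0 1 0, t0h]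
  have w0e10 : K (modelJet 0 0 0 0 1 0) 1 0 = 0 := by
    linarith [k1 0 0 0 0 1 0 1 0 0 0 0 0 0 0 0 0 1 0, t0h]
  have w0f00 : K (modelJet 0 0 0 0 0 1) 0 0 = 0 := by
    linarith [k1 0 0 0 0 1 0 0 0 1 0 0 0 0 0 0 0 0 1, t0f]
  have w0f11 : K (modelJet 0 0 0 0 0 1) 1 1 = 0 := by
    linarith [k1 0 0 0 0 0 1 0 1 0 0 0 0 0 0 0 0 0 1, t0e]
  have w0f01 : K (modelJet 0 0 0 0 0 1) 0 1 = 0 := by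
    linarith [k1 0 0 0 0 0 1 1 0 0 0 0 0 0 0 0 0 0 1, t0h]
  have w0f10 : K (modelJet 0 0 0 0 0 1) 1 0 = 0 := by
    linarith [k1 0 0 0 0 1 0 1 0 0 0 0 0 0 0 0 0 0 1, t0h]
  have w1h00 : K (modelJet 1 0 0 0 0 0) 2 0 = 0 := by
    linarith [k0 0 1 0 0 0 0 0 0 0 0 0 1 1 0 0 0 0 0, t1f]
  have w1h11 : K (modelJet 1 0 0 0 0 0) 3 1 = 0 := by
    linarith [k0 0 0 1 0 0 0 0 0 0 0 1 0 1 0 0 0 0 0, t1e]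
  have w1h01 : K (modelJet 1 0 0 0 0 0) 2 1 = 0 := by
    linarith [k0 0 0 1 0 0 0 0 0 0 1 0 0 1 0 0 0 0 0, t1h]
  have w1h10 : K (modelJet 1 0 0 0 0 0) 3 0 = 0 := by
    linarith [k0 0 1 0 0 0 0 0 0 0 1 0 0 1 0 0 0 0 0, t1h]
  have w1e00 : K (modelJet 0 1 0 0 0 0) 2 0 = 0 := by
    linarith [k0 0 1 0 0 0 0 0 0 0 0 0 1 0 1 0 0 0 0, t1f]
  have w1e11 : K (modelJet 0 1 0 0 0 0) 3 1 = 0 := by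
    linarith [k0 0 0 1 0 0 0 0 0 0 0 1 0 0 1 0 0 0 0, t1e]
  have w1e01 : K (modelJet 0 1 0 0 0 0) 2 1 = 0 := by
    linarith [k0 0 0 1 0 0 0 0 0 0 1 0 0 0 1 0 0 0 0, t1h]
  have w1e10 : K (modelJet 0 1 0 0 0 0) 3 0 = 0 := by
    linarith [k0 0 1 0 0 0 0 0 0 0 1 0 0 0 1 0 0 0 0, t1h]
  have w1f00 : K (modelJet 0 0 1 0 0 0) 2 0 = 0 := by
    linarith [k0 0 1 0 0 0 0 0 0 0 0 0 1 0 0 1 0 0 0, t1f]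
  have w1f11 : K (modelJet 0 0 1 0 0 0) 3 1 = 0 := by
    linarith [k0 0 0 1 0 0 0 0 0 0 0 1 0 0 0 1 0 0 0, t1e]
  have w1f01 : K (modelJet 0 0 1 0 0 0) 2 1 = 0 := by
    linarith [k0 0 0 1 0 0 0 0 0 0 1 0 0 0 0 1 0 0 0, t1h]
  have w1f10 : K (modelJet 0 0 1 0 0 0) 3 0 = 0 := by
    linarith [k0 0 1 0 0 0 0 0 0 0 1 0 0 0 0 1 0 0 0, t1h]
  rw [eq_modelJet ht, map_modelJet_eq]
  ext i j
  fin_cases i <;> fin_cases j <;> simp [*]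

/-- If the pair `(A, D)` preserves the model, then `D` has the form `A ⊗ 1 + 1 ⊗ P`. -/
theorem eq_of_contr_mul_sub_mul {A : Matrix (Fin 2) (Fin 2) ℝ} {D : Matrix (Fin 4) (Fin 4) ℝ}
    (h : ∀ t, contr t = 0 → contr (A * t - t * D) = 0) :
    D = !![D 0 0, A 0 1, D 0 2, 0; A 1 0, D 0 0 - A 0 0 + A 1 1, 0, D 0 2;
      D 2 0, 0, D 2 2, A 0 1; 0, D 2 0, A 1 0, D 2 2 - A 0 0 + A 1 1] := by
  have key : ∀ a b c a' b' c', _ := fun a b c a' b' c' =>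
    h (modelJet a b c a' b' c') (contr_modelJet a b c a' b' c')
  have k0 := fun a b c a' b' c' => congrFun (key a b c a' b' c') 0
  have k1 := fun a b c a' b' c' => congrFun (key a b c a' b' c') 1
  simp only [contr_apply_zero, contr_apply_one, Matrix.mul_apply, Matrix.sub_apply,
    Fin.sum_univ_four, Fin.sum_univ_two, modelJet_00, modelJet_01, modelJet_02, modelJet_03,
    modelJet_10, modelJet_11, modelJet_12, modelJet_13, Pi.zero_apply] at k0 k1
  have a1 := k0 1 0 0 0 0 0
  have a2 := k0 0 1 0 0 0 0
  have a3 := k0 0 0 1 0 0 0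
  have a4 := k0 0 0 0 1 0 0
  have a5 := k0 0 0 0 0 1 0
  have a6 := k0 0 0 0 0 0 1
  have b1 := k1 1 0 0 0 0 0
  have b2 := k1 0 1 0 0 0 0
  have b3 := k1 0 0 1 0 0 0
  have b4 := k1 0 0 0 1 0 0
  have b5 := k1 0 0 0 0 1 0
  have b6 := k1 0 0 0 0 0 1
  ext i j
  fin_cases i <;> fin_cases j <;> simp <;> linarith

end FirstOrderSystem

/-! ### Second fundamental forms constrained on rank-one directions -/

namespace FirstOrderSystem

/-- The solution of the model system of rank one with blocks `n₀ S`, `n₁ S`, where `S` is the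
nilpotent matrix with image spanned by `(x, y)`. -/
def simpleJet (x y n₀ n₁ : ℝ) : Matrix (Fin 2) (Fin 4) ℝ :=
  modelJet (-n₀ * x * y) (n₀ * x ^ 2) (-n₀ * y ^ 2) (-n₁ * x * y) (n₁ * x ^ 2) (-n₁ * y ^ 2)

/-- A basis of the space of solutions of the model system. -/
def modelBasis : Fin 6 → Matrix (Fin 2) (Fin 4) ℝ :=
  ![modelJet 1 0 0 0 0 0, modelJet 0 1 0 0 0 0, modelJet 0 0 1 0 0 0,
    modelJet 0 0 0 1 0 0, modelJet 0 0 0 0 1 0, modelJet 0 0 0 0 0 1]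

theorem modelJet_eq_sum (a b c a' b' c' : ℝ) :
    modelJet a b c a' b' c' = a • modelBasis 0 + b • modelBasis 1 + c • modelBasis 2
      + a' • modelBasis 3 + b' • modelBasis 4 + c' • modelBasis 5 := by
  ext i j
  fin_cases i <;> fin_cases j <;> simp [modelJet, modelBasis]

theorem simpleJet_eq (x y n₀ n₁ : ℝ) :
    simpleJet x y n₀ n₁ = n₀ • simpleJet x y 1 0 + n₁ • simpleJet x y 0 1 := by
  ext i j
  fin_cases i <;> fin_cases j <;> simp [modelJet, simpleJet] <;> ring

-- A parameter count under `SL(2) × SL(2)`: symmetric forms on `sl₂ ⊗ ℝ²` split as `S⁴⊗S² + S⁰⊗S² +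
-- S²⊗Λ²`. The condition with equal `ξ` kills the first summand, the one with equal `n` kills the
-- `S³` inside `S² ⊗ ℝ²` of the second. Eight parameters survive, as many as `C` has entries.
set_option maxHeartbeats 1000000 in
theorem exists_contr_of_simpleJet
    (β : Matrix (Fin 2) (Fin 4) ℝ →ₗ[ℝ] Matrix (Fin 2) (Fin 4) ℝ →ₗ[ℝ] (Fin 2 → ℝ))
    (hsymm : ∀ s t, β s t = β t s)
    (hα : ∀ x y n₀ n₁ m₀ m₁ : ℝ, (x ≠ 0 ∨ y ≠ 0) → n₀ * m₁ - n₁ * m₀ ≠ 0 →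
      m₁ * β (simpleJet x y n₀ n₁) (simpleJet x y m₀ m₁) 0
        - m₀ * β (simpleJet x y n₀ n₁) (simpleJet x y m₀ m₁) 1 = 0)
    (hβ : ∀ x y z w n₀ n₁ : ℝ, x * w - y * z ≠ 0 → (n₀ ≠ 0 ∨ n₁ ≠ 0) →
      n₁ * β (simpleJet x y n₀ n₁) (simpleJet z w n₀ n₁) 0
        - n₀ * β (simpleJet x y n₀ n₁) (simpleJet z w n₀ n₁) 1 = 0) :
    ∃ C : Matrix (Fin 4) (Fin 2) ℝ, ∀ t, contr t = 0 → β t t = (2 : ℝ) • contr (t * C * t) := by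
  obtain ⟨B, hB⟩ : ∃ B : Fin 6 → Fin 6 → Fin 2 → ℝ, ∀ p q k,
      β (modelBasis p) (modelBasis q) k = B p q k := ⟨_, fun _ _ _ => rfl⟩
  have hBs : ∀ p q k, B p q k = B q p k := fun p q k => by rw [← hB, ← hB, hsymm]
  have hexp : ∀ (a b c a' b' c' d e f d' e' f' : ℝ) (k : Fin 2),
      β (modelJet a b c a' b' c') (modelJet d e f d' e' f') k =
      a * d * B 0 0 k + (a * e + b * d) * B 0 1 k + (a * f + c * d) * B 0 2 k
      + (a * d' + a' * d) * B 0 3 k + (a * e' + b' * d) * B 0 4 k + (a * f' + c' * d) * B 0 5 k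
      + b * e * B 1 1 k + (b * f + c * e) * B 1 2 k + (b * d' + a' * e) * B 1 3 k
      + (b * e' + b' * e) * B 1 4 k + (b * f' + c' * e) * B 1 5 k + c * f * B 2 2 k
      + (c * d' + a' * f) * B 2 3 k + (c * e' + b' * f) * B 2 4 k + (c * f' + c' * f) * B 2 5 k
      + a' * d' * B 3 3 k + (a' * e' + b' * d') * B 3 4 k + (a' * f' + c' * d') * B 3 5 k
      + b' * e' * B 4 4 k + (b' * f' + c' * e') * B 4 5 k + c' * f' * B 5 5 k := by
    intro a b c a' b' c' d e f d' e' f' k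
    rw [modelJet_eq_sum, modelJet_eq_sum]
    simp only [map_add, map_smul, LinearMap.add_apply, LinearMap.smul_apply, Pi.add_apply,
      Pi.smul_apply, smul_eq_mul, hB, hBs 1 0 k, hBs 2 0 k, hBs 3 0 k, hBs 4 0 k, hBs 5 0 k,
      hBs 2 1 k, hBs 3 1 k, hBs 4 1 k, hBs 5 1 k, hBs 3 2 k, hBs 4 2 k, hBs 5 2 k, hBs 4 3 k,
      hBs 5 3 k, hBs 5 4 k]
    ring
  -- the quartic forms `ξ ↦ β (n S_ξ, m S_ξ)` vanish
  have hquart : ∀ x y : ℝ, (x ≠ 0 ∨ y ≠ 0) → ∀ k : Fin 2,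
      β (simpleJet x y 1 0) (simpleJet x y 1 0) k = 0 ∧
      β (simpleJet x y 1 0) (simpleJet x y 0 1) k = 0 ∧
      β (simpleJet x y 0 1) (simpleJet x y 0 1) k = 0 := by
    intro x y hxy
    have e1 := hα x y 1 0 0 1 hxy (by norm_num)
    have e2 := hα x y 0 1 1 0 hxy (by norm_num)
    have e3 := hα x y 1 0 1 1 hxy (by norm_num)
    have e4 := hα x y 1 0 (-1) 1 hxy (by norm_num)
    have e5 := hα x y 0 1 1 1 hxy (by norm_num)
    have e6 := hα x y 0 1 (-1) 1 hxy (by norm_num)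
    have hQ := hsymm (simpleJet x y 0 1) (simpleJet x y 1 0)
    rw [simpleJet_eq x y 1 1] at e3 e5
    rw [simpleJet_eq x y (-1) 1] at e4 e6
    simp only [map_add, map_smul, Pi.add_apply, Pi.smul_apply, smul_eq_mul, hQ]
      at e1 e2 e3 e4 e5 e6
    intro k
    refine ⟨?_, ?_, ?_⟩ <;> fin_cases k <;>
      simp only [Fin.zero_eta, Fin.mk_one] <;> linarith
  -- A binary quartic is determined by its values at five directions.
  have q1 := hquart 1 0 (by simp)
  have q2 := hquart 0 1 (by simp)
  have q3 := hquart 1 1 (by simp)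
  have q4 := hquart 1 (-1) (by simp)
  have q5 := hquart 1 2 (by simp)
  simp only [simpleJet, hexp] at q1 q2 q3 q4 q5
  have s11 : ∀ k, B 1 1 k = 0 := fun k => by linarith [(q1 k).1]
  have s14 : ∀ k, B 1 4 k = 0 := fun k => by linarith [(q1 k).2.1]
  have s44 : ∀ k, B 4 4 k = 0 := fun k => by linarith [(q1 k).2.2]
  have s22 : ∀ k, B 2 2 k = 0 := fun k => by linarith [(q2 k).1]
  have s25 : ∀ k, B 2 5 k = 0 := fun k => by linarith [(q2 k).2.1]
  have s55 : ∀ k, B 5 5 k = 0 := fun k => by linarith [(q2 k).2.2]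
  have s01 : ∀ k, B 0 1 k = 0 := fun k => by
    linarith [(q3 k).1, (q4 k).1, (q5 k).1, s11 k, s22 k]
  have s02 : ∀ k, B 0 2 k = 0 := fun k => by
    linarith [(q3 k).1, (q4 k).1, (q5 k).1, s11 k, s22 k]
  have s12 : ∀ k, B 1 2 k = B 0 0 k / 2 := fun k => by
    linarith [(q3 k).1, (q4 k).1, (q5 k).1, s11 k, s22 k]
  have s34 : ∀ k, B 3 4 k = 0 := fun k => by
    linarith [(q3 k).2.2, (q4 k).2.2, (q5 k).2.2, s44 k, s55 k]
  have s35 : ∀ k, B 3 5 k = 0 := fun k => by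
    linarith [(q3 k).2.2, (q4 k).2.2, (q5 k).2.2, s44 k, s55 k]
  have s45 : ∀ k, B 4 5 k = B 3 3 k / 2 := fun k => by
    linarith [(q3 k).2.2, (q4 k).2.2, (q5 k).2.2, s44 k, s55 k]
  have s13 : ∀ k, B 1 3 k = -B 0 4 k := fun k => by
    linarith [(q3 k).2.1, (q4 k).2.1, (q5 k).2.1, s14 k, s25 k]
  have s23 : ∀ k, B 2 3 k = -B 0 5 k := fun k => by
    linarith [(q3 k).2.1, (q4 k).2.1, (q5 k).2.1, s14 k, s25 k]
  have s03 : ∀ k, B 0 3 k = B 1 5 k + B 2 4 k := fun k => by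
    linarith [(q3 k).2.1, (q4 k).2.1, (q5 k).2.1, s14 k, s25 k]
  -- For this fixed pair of directions the condition is a binary cubic in `n`, so four values of `n`
  -- suffice.
  have b1 := hβ 1 0 0 1 1 0 (by norm_num) (by simp)
  have b2 := hβ 1 0 0 1 0 1 (by norm_num) (by simp)
  have b3 := hβ 1 0 0 1 1 1 (by norm_num) (by simp)
  have b4 := hβ 1 0 0 1 1 (-1) (by norm_num) (by simp)
  simp only [simpleJet, hexp, s12, s45] at b1 b2 b3 b4
  have r1 : B 0 0 1 = 0 := by linarith
  have r2 : B 3 3 0 = 0 := by linarith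
  have r3 : B 0 0 0 = 2 * (B 1 5 1 + B 2 4 1) := by linarith
  have r4 : B 3 3 1 = 2 * (B 1 5 0 + B 2 4 0) := by linarith
  -- The eight surviving coefficients of the form are the entries of `C` up to sign, as comparison
  -- with `contr_mul_mul_modelJet` shows.
  refine ⟨!![B 2 4 1, B 0 5 1; -B 0 4 1, B 1 5 1; B 1 5 0, -B 0 5 0; B 0 4 0, B 2 4 0],
    fun t ht => ?_⟩
  rw [eq_modelJet ht, contr_mul_mul_modelJet]
  ext k
  rw [hexp]
  simp only [s11, s14, s44, s22, s25, s55, s01, s02, s12, s34, s35, s45, s13, s23, s03]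
  fin_cases k <;> simp [r1, r2, r3, r4] <;> ring

end FirstOrderSystem

/-! ### Implicit functions and uniqueness for linear differential equations -/

/-- A straightening of the level sets of a submersion `f`, built from a right inverse `ρ` of its
derivative. -/
theorem exists_straightening {V W : Type*} [NormedAddCommGroup V] [NormedSpace ℝ V]
    [CompleteSpace V] [NormedAddCommGroup W] [NormedSpace ℝ W] {f : V → W} {s : Set V}
    (hs : IsOpen s) (hf : ContDiffOn ℝ ∞ f s) {v₀ : V} (hv : v₀ ∈ s) (hf0 : f v₀ = 0)
    (ρ : W →L[ℝ] V) (hρ : ∀ c, fderiv ℝ f v₀ (ρ c) = c) :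
    ∃ (ψ : V → V) (O : Set V), IsOpen O ∧ (0 : V) ∈ O ∧ ContDiffOn ℝ ∞ ψ O ∧ ψ 0 = v₀ ∧
      HasStrictFDerivAt ψ (ContinuousLinearMap.id ℝ V) 0 ∧
      ∀ z ∈ O, ψ z ∈ s ∧ ψ z - v₀ = z + ρ (fderiv ℝ f v₀ (ψ z - v₀) - f (ψ z)) ∧
        f (ψ z) = fderiv ℝ f v₀ z := by
  set f' := fderiv ℝ f v₀ with hf'
  -- `G` replaces the component of `v - v₀` in the range of `ρ` by `ρ (f v)`. Its derivative at `v₀`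
  -- is the identity and `f' (G v) = f v`, so its local inverse straightens `f` and moves points
  -- only along the range of `ρ`.
  set G : V → V := fun v => v - v₀ - ρ (f' (v - v₀)) + ρ (f v) with hG
  have hGs : ContDiffOn ℝ ∞ G s := by
    refine ContDiffOn.add ?_ (ρ.contDiff.comp_contDiffOn hf)
    exact (ContDiff.sub (contDiff_id.sub contDiff_const)
      (ρ.contDiff.comp (f'.contDiff.comp (contDiff_id.sub contDiff_const)))).contDiffOn
  have hfd : HasFDerivAt f f' v₀ :=
    ((hf.contDiffAt (hs.mem_nhds hv)).differentiableAt (by simp)).hasFDerivAt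
  have hGd : HasFDerivAt G ((ContinuousLinearEquiv.refl ℝ V : V ≃L[ℝ] V) : V →L[ℝ] V) v₀ := by
    have h1 : HasFDerivAt (fun v : V => v - v₀) (ContinuousLinearMap.id ℝ V) v₀ :=
      (hasFDerivAt_id v₀).sub_const v₀
    have h2 := ((h1.sub (ρ.hasFDerivAt.comp v₀ (f'.hasFDerivAt.comp v₀ h1))).add
      (ρ.hasFDerivAt.comp v₀ hfd))
    refine h2.congr_fderiv ?_
    ext v
    simp
  have hGv : G v₀ = 0 := by simp [hG, hf0]
  have hGc : ContDiffAt ℝ ∞ G v₀ := hGs.contDiffAt (hs.mem_nhds hv)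
  set e := hGc.toOpenPartialHomeomorph G hGd (by simp) with he
  have hecoe : (e : V → V) = G := rfl
  have hsrc : v₀ ∈ e.source := hGc.mem_toOpenPartialHomeomorph_source hGd (by simp)
  -- Restricting to points where the derivative of `G` stays invertible makes the inverse smooth on
  -- a whole neighbourhood and not only at one point.
  set s' : Set V := {v | v ∈ s ∧ fderiv ℝ G v ∈ Set.range ((↑) : (V ≃L[ℝ] V) → V →L[ℝ] V)}
    with hs'
  have hs'o : IsOpen s' := by
    have hc : ContinuousOn (fderiv ℝ G) s := hGs.continuousOn_fderiv_of_isOpen hs (by simp)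
    exact hc.isOpen_inter_preimage hs (ContinuousLinearEquiv.isOpen)
  have hv's : v₀ ∈ s' := ⟨hv, ContinuousLinearEquiv.refl ℝ V, hGd.fderiv.symm⟩
  have hsymm0 : e.symm 0 = v₀ := by
    have := e.left_inv hsrc
    rwa [hecoe, hGv] at this
  have h0t : (0 : V) ∈ e.target := by
    have := e.map_source hsrc
    rwa [hecoe, hGv] at this
  have hcd : ∀ z ∈ e.target ∩ e.symm ⁻¹' s', ContDiffAt ℝ ∞ e.symm z := by
    rintro z ⟨hz, hzs, L, hL⟩
    have hd : ContDiffAt ℝ ∞ G (e.symm z) := hGs.contDiffAt (hs.mem_nhds hzs)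
    refine e.contDiffAt_symm (f₀' := L) hz ?_ hd
    rw [hL]
    exact (hd.differentiableAt (by simp)).hasFDerivAt
  refine ⟨e.symm, e.target ∩ e.symm ⁻¹' s', e.symm.isOpen_inter_preimage hs'o,
    ⟨h0t, by simpa [hsymm0] using hv's⟩, fun z hz => (hcd z hz).contDiffWithinAt, hsymm0, ?_,
    ?_⟩
  · have hc0 := hcd 0 ⟨h0t, by simpa [hsymm0] using hv's⟩
    have h1 := e.hasFDerivAt_symm h0t (f' := ContinuousLinearEquiv.refl ℝ V)
      (by rw [hsymm0]; exact hGd)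
    have h2 := hc0.hasStrictFDerivAt' h1 (by simp)
    exact h2
  · rintro z ⟨hz, hzs⟩
    have h1 : G (e.symm z) = z := e.right_inv hz
    have h2 : e.symm z - v₀ = z + ρ (f' (e.symm z - v₀) - f (e.symm z)) := by
      nth_rewrite 2 [← h1]
      simp only [hG, map_sub]
      abel
    refine ⟨hzs.1, h2, ?_⟩
    have h3 := congrArg f' h2
    rw [map_add, hρ] at h3
    have h4 : f' z = f (e.symm z) := by
      have := sub_eq_zero.2 h3
      rw [← sub_eq_zero, ← neg_eq_zero, ← this]
      abel
    exact h4.symm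

/-- Uniqueness for homogeneous linear ordinary differential equations on `[0, 1]`. -/
theorem eq_zero_of_hasDerivAt_mulVec {n : ℕ} {f : ℝ → Fin n → ℝ}
    {A : ℝ → Matrix (Fin n) (Fin n) ℝ} (hA : ∀ i j, ContinuousOn (fun t => A t i j) (Set.Icc 0 1))
    (hf : ∀ t ∈ Set.Icc (0 : ℝ) 1, HasDerivAt f (A t *ᵥ f t) t) (h0 : f 0 = 0) :
    ∀ t ∈ Set.Icc (0 : ℝ) 1, f t = 0 := by
  have hb : ∀ i j, ∃ K : ℝ, ∀ t ∈ Set.Icc (0 : ℝ) 1, |A t i j| ≤ K := fun i j => by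
    obtain ⟨K, hK⟩ := isCompact_Icc.exists_bound_of_continuousOn (hA i j)
    exact ⟨K, fun t ht => hK t ht⟩
  choose K hK using hb
  refine eq_zero_of_abs_deriv_le_mul_abs_self_of_eq_zero_right (K := ∑ i, ∑ j, |K i j|)
    (f' := fun t => A t *ᵥ f t) (fun t ht => (hf t ht).continuousAt.continuousWithinAt)
    (fun t ht => (hf t ⟨ht.1, ht.2.le⟩).hasDerivWithinAt) h0 ?_
  intro t ht
  have hs : 0 ≤ ∑ i, ∑ j, |K i j| := Finset.sum_nonneg fun i _ => Finset.sum_nonneg fun j _ =>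
    abs_nonneg _
  refine (pi_norm_le_iff_of_nonneg (mul_nonneg hs (norm_nonneg _))).2 fun i => ?_
  rw [Real.norm_eq_abs]
  calc |(A t *ᵥ f t) i| = |∑ j, A t i j * f t j| := rfl
    _ ≤ ∑ j, |A t i j * f t j| := Finset.abs_sum_le_sum_abs _ _
    _ ≤ ∑ j, |K i j| * ‖f t‖ := Finset.sum_le_sum fun j _ => by
        rw [abs_mul]
        exact mul_le_mul ((hK i j t ⟨ht.1, ht.2.le⟩).trans (le_abs_self _)) (norm_le_pi_norm (f t) j)
          (abs_nonneg _) (abs_nonneg _)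
    _ = (∑ j, |K i j|) * ‖f t‖ := (Finset.sum_mul ..).symm
    _ ≤ (∑ i, ∑ j, |K i j|) * ‖f t‖ := by
        refine mul_le_mul_of_nonneg_right ?_ (norm_nonneg _)
        exact Finset.single_le_sum (f := fun i => ∑ j, |K i j|)
          (fun i _ => Finset.sum_nonneg fun j _ => abs_nonneg _) (Finset.mem_univ i)

/-! ### The frame of a system and second-order contact -/

namespace FirstOrderSystem

variable (S : FirstOrderSystem)

/-- The pair `(F, H)`. -/
def eqs (U : JetSpace) : Fin 2 → ℝ := ![S.F U, S.H U]

/-- The matrix whose columns are `F_u`, `F_v`, `H_u`, `H_v`. -/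
def frame (U : JetSpace) : Matrix (Fin 4) (Fin 4) ℝ :=
  Matrix.of fun i => ![jetDeriv S.F 0 i U, jetDeriv S.F 1 i U, jetDeriv S.H 0 i U,
    jetDeriv S.H 1 i U]

theorem mem_locus_iff {U : JetSpace} : U ∈ S.locus ↔ U ∈ S.dom ∧ S.eqs U = 0 := by
  simp only [locus, Set.mem_ofPred_eq, eqs]
  refine and_congr_right fun _ => ⟨fun h => ?_, fun h => ⟨congrFun h 0, congrFun h 1⟩⟩
  ext k; fin_cases k
  · exact h.1
  · exact h.2

theorem contDiffOn_eqs : ContDiffOn ℝ ∞ S.eqs S.dom := by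
  refine contDiffOn_pi.2 fun k => ?_
  fin_cases k
  · exact S.smooth_F
  · exact S.smooth_H

variable {S}

theorem contDiffAt_eqs {U : JetSpace} (hU : U ∈ S.dom) : ContDiffAt ℝ ∞ S.eqs U :=
  S.contDiffOn_eqs.contDiffAt (S.isOpen_dom.mem_nhds hU)

theorem hasFDerivAt_eqs {U : JetSpace} (hU : U ∈ S.dom) :
    HasFDerivAt S.eqs (fderiv ℝ S.eqs U) U :=
  ((contDiffAt_eqs hU).differentiableAt (by simp)).hasFDerivAt

theorem contDiffAt_fderiv_eqs {U : JetSpace} (hU : U ∈ S.dom) :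
    ContDiffAt ℝ ∞ (fderiv ℝ S.eqs) U := (contDiffAt_eqs hU).fderiv_right (by simp)

theorem hasFDerivAt_fderiv_eqs {U : JetSpace} (hU : U ∈ S.dom) :
    HasFDerivAt (fderiv ℝ S.eqs) (fderiv ℝ (fderiv ℝ S.eqs) U) U :=
  ((contDiffAt_fderiv_eqs hU).differentiableAt (by simp)).hasFDerivAt

theorem fderiv_fderiv_eqs_comm {U : JetSpace} (hU : U ∈ S.dom) (s t : JetSpace) :
    fderiv ℝ (fderiv ℝ S.eqs) U s t = fderiv ℝ (fderiv ℝ S.eqs) U t s :=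
  (contDiffAt_eqs hU).isSymmSndFDerivAt
    (by rw [minSmoothness_of_isRCLikeNormedField]; exact ENat.LEInfty.out) s t

theorem apply_eq_sum_jet (f : JetSpace →L[ℝ] ℝ) (t : JetSpace) :
    f t = ∑ a, ∑ i, t a i * f (Pi.single a (Pi.single i 1)) := by
  have : t = ∑ a, ∑ i, t a i • (Pi.single a (Pi.single i 1) : JetSpace) := by
    ext b j
    simp [Finset.sum_apply, Pi.single_apply, Finset.sum_ite_eq, ite_apply]
  conv_lhs => rw [this]
  simp [map_sum]

theorem fderiv_eqs_apply {U : JetSpace} (hU : U ∈ S.dom) (t : JetSpace) :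
    fderiv ℝ S.eqs U t = contr (Matrix.of t * S.frame U) := by
  have h := hasFDerivAt_pi'.1 (hasFDerivAt_eqs hU)
  have h0 : fderiv ℝ S.F U = (ContinuousLinearMap.proj 0).comp (fderiv ℝ S.eqs U) := (h 0).fderiv
  have h1 : fderiv ℝ S.H U = (ContinuousLinearMap.proj 1).comp (fderiv ℝ S.eqs U) := (h 1).fderiv
  ext k
  fin_cases k
  · have : fderiv ℝ S.eqs U t 0 = fderiv ℝ S.F U t := by rw [h0]; rfl
    simp only [Fin.zero_eta, this, contr_apply_zero, Matrix.mul_apply]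
    rw [apply_eq_sum_jet, Fin.sum_univ_two]
    rfl
  · have : fderiv ℝ S.eqs U t 1 = fderiv ℝ S.H U t := by rw [h1]; rfl
    simp only [Fin.mk_one, this, contr_apply_one, Matrix.mul_apply]
    rw [apply_eq_sum_jet, Fin.sum_univ_two]
    rfl

/-- The matrix of the quadratic form `q₀ q₃ - q₁ q₂`. -/
def modelCometric : Matrix (Fin 4) (Fin 4) ℝ :=
  !![0, 0, 0, 1 / 2; 0, 0, -1 / 2, 0; 0, -1 / 2, 0, 0; 1 / 2, 0, 0, 0]

theorem cometric_eq (U : JetSpace) :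
    S.cometric U = S.frame U * modelCometric * (S.frame U)ᵀ := by
  ext i j
  simp only [cometric, Matrix.of_apply, Matrix.mul_apply, Fin.sum_univ_four, modelCometric, frame,
    Matrix.transpose_apply, Matrix.cons_val]
  ring

/-- The characteristic quadric is the fixed quadric `modelCometric` transported by the frame, so a
singular frame would make it degenerate. -/
theorem isUnit_frame (hnd : S.Nondegenerate) {U : JetSpace} (hU : U ∈ S.locus) :
    IsUnit (S.frame U).det := by
  rw [isUnit_iff_ne_zero]
  intro h
  apply hnd U hU
  rw [cometric_eq, Matrix.det_mul, Matrix.det_mul, h]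
  simp

/-- Second-order contact with a linear system in a projectively equivalent chart: the second
fundamental form of the locus is `t ↦ t C t`. -/
def Osculating (S : FirstOrderSystem) : Prop :=
  ∀ U ∈ S.locus, ∃ C : Matrix (Fin 4) (Fin 2) ℝ, ∀ t : JetSpace, fderiv ℝ S.eqs U t = 0 →
    fderiv ℝ (fderiv ℝ S.eqs) U t t
      = (2 : ℝ) • fderiv ℝ S.eqs U (Matrix.of.symm (Matrix.of t * C * Matrix.of t))

/-- The right inverse of the derivative of `(F, H)` given by the frame. -/
def frameSection (S : FirstOrderSystem) (U : JetSpace) : (Fin 2 → ℝ) →L[ℝ] JetSpace :=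
  LinearMap.toContinuousLinearMap
    { toFun := fun c => Matrix.of.symm (contrSection c * (S.frame U)⁻¹)
      map_add' := fun c d => by rw [map_add, Matrix.add_mul]; rfl
      map_smul' := fun r c => by rw [map_smul, Matrix.smul_mul]; rfl }

theorem frameSection_apply (U : JetSpace) (c : Fin 2 → ℝ) :
    S.frameSection U c = Matrix.of.symm (contrSection c * (S.frame U)⁻¹) := rfl

theorem fderiv_frameSection (hnd : S.Nondegenerate) {U : JetSpace} (hU : U ∈ S.locus)
    (c : Fin 2 → ℝ) : fderiv ℝ S.eqs U (S.frameSection U c) = c := by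
  rw [fderiv_eqs_apply hU.1, frameSection_apply, Equiv.apply_symm_apply,
    Matrix.nonsing_inv_mul_cancel_right _ _ (isUnit_frame hnd hU), contr_contrSection]

/-- Local parametrization of the locus. -/
theorem exists_chart (hnd : S.Nondegenerate) {U : JetSpace} (hU : U ∈ S.locus) :
    ∃ (ψ : JetSpace → JetSpace) (r : ℝ), 0 < r ∧ ContDiffOn ℝ ∞ ψ (Metric.ball 0 r) ∧ ψ 0 = U ∧
      HasStrictFDerivAt ψ (ContinuousLinearMap.id ℝ JetSpace) 0 ∧
      ∀ z ∈ Metric.ball 0 r, ψ z ∈ S.dom ∧ S.eqs (ψ z) = fderiv ℝ S.eqs U z := by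
  obtain ⟨ψ, O, hO, h0, hψ, hψ0, hd, h⟩ := exists_straightening S.isOpen_dom S.contDiffOn_eqs hU.1
    (S.mem_locus_iff.1 hU).2 (S.frameSection U) (fderiv_frameSection hnd hU)
  obtain ⟨r, hr, hb⟩ := Metric.isOpen_iff.1 hO 0 h0
  exact ⟨ψ, r, hr, hψ.mono hb, hψ0, hd, fun z hz => ⟨(h z (hb hz)).1, (h z (hb hz)).2.2⟩⟩

end FirstOrderSystem

/-! ### Calculus of matrix-valued functions -/

section MatrixCalculus

attribute [local instance] Matrix.normedAddCommGroup Matrix.normedSpace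

theorem HasDerivAt.matrix_mul {l m n : Type*} [Fintype l] [Fintype m] [Fintype n]
    {A : ℝ → Matrix l m ℝ} {B : ℝ → Matrix m n ℝ} {A' : Matrix l m ℝ} {B' : Matrix m n ℝ} {t : ℝ}
    (hA : HasDerivAt A A' t) (hB : HasDerivAt B B' t) :
    HasDerivAt (fun s => A s * B s) (A' * B t + A t * B') t := by
  refine hasDerivAt_pi.2 fun i => hasDerivAt_pi.2 fun j => ?_
  have h : HasDerivAt (fun s => ∑ k, A s i k * B s k j)
      (∑ k, (A' i k * B t k j + A t i k * B' k j)) t :=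
    HasDerivAt.fun_sum fun k _ =>
      (hasDerivAt_pi.1 (hasDerivAt_pi.1 hA i) k).mul (hasDerivAt_pi.1 (hasDerivAt_pi.1 hB k) j)
  rw [Finset.sum_add_distrib] at h
  exact h

variable {V : Type*} [NormedAddCommGroup V] [NormedSpace ℝ V] {N : ℕ∞ω} {x : V}

theorem ContDiffAt.matrix_det {n : Type*} [Fintype n] [DecidableEq n] {M : V → Matrix n n ℝ}
    (hM : ∀ i j, ContDiffAt ℝ N (fun y => M y i j) x) : ContDiffAt ℝ N (fun y => (M y).det) x := by
  simp only [Matrix.det_apply]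
  refine ContDiffAt.sum fun σ _ => ContDiffAt.const_smul _ ?_
  exact contDiffAt_prod fun i _ => hM _ _

theorem ContDiffAt.matrix_inv {n : Type*} [Fintype n] [DecidableEq n] {M : V → Matrix n n ℝ}
    (hM : ∀ i j, ContDiffAt ℝ N (fun y => M y i j) x) (hx : (M x).det ≠ 0) (i j : n) :
    ContDiffAt ℝ N (fun y => (M y)⁻¹ i j) x := by
  simp only [Matrix.inv_def, Ring.inverse_eq_inv', Matrix.smul_apply, smul_eq_mul,
    Matrix.adjugate_apply]
  refine ((ContDiffAt.matrix_det hM).inv hx).mul (ContDiffAt.matrix_det fun k l => ?_)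
  by_cases h : k = j
  · subst h
    simp only [Matrix.updateRow_self]
    exact contDiffAt_const
  · simp only [Matrix.updateRow_ne h]
    exact hM _ _

theorem ContDiffAt.matrix_mul {l m n : Type*} [Fintype m]
    {A : V → Matrix l m ℝ} {B : V → Matrix m n ℝ}
    (hA : ∀ i j, ContDiffAt ℝ N (fun y => A y i j) x)
    (hB : ∀ i j, ContDiffAt ℝ N (fun y => B y i j) x) (i : l) (j : n) :
    ContDiffAt ℝ N (fun y => (A y * B y) i j) x := by
  simp only [Matrix.mul_apply]
  exact ContDiffAt.sum fun k _ => (hA _ _).mul (hB _ _)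

end MatrixCalculus

/-! ### The matrix of the osculating system and its smoothness -/

namespace FirstOrderSystem

variable {S : FirstOrderSystem}

theorem contDiffAt_jetDeriv {Φ : JetSpace → ℝ} {U : JetSpace} (h : ContDiffAt ℝ ∞ Φ U)
    (a : Fin 2) (i : Fin 4) : ContDiffAt ℝ ∞ (jetDeriv Φ a i) U :=
  ContDiffAt.clm_apply (h.fderiv_right (by simp)) contDiffAt_const

theorem contDiffAt_frame {U : JetSpace} (hU : U ∈ S.dom) (i j : Fin 4) :
    ContDiffAt ℝ ∞ (fun U => S.frame U i j) U := by
  have hF := S.smooth_F.contDiffAt (S.isOpen_dom.mem_nhds hU)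
  have hH := S.smooth_H.contDiffAt (S.isOpen_dom.mem_nhds hU)
  fin_cases j
  · exact contDiffAt_jetDeriv hF 0 i
  · exact contDiffAt_jetDeriv hF 1 i
  · exact contDiffAt_jetDeriv hH 0 i
  · exact contDiffAt_jetDeriv hH 1 i

/-- A tangent vector of the model, read in the frame at `U`. -/
def ofFrame (S : FirstOrderSystem) (U : JetSpace) (t : Matrix (Fin 2) (Fin 4) ℝ) : JetSpace :=
  Matrix.of.symm (t * (S.frame U)⁻¹)

theorem contDiffAt_ofFrame (hnd : S.Nondegenerate) {U : JetSpace} (hU : U ∈ S.locus)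
    (t : Matrix (Fin 2) (Fin 4) ℝ) : ContDiffAt ℝ ∞ (fun U => S.ofFrame U t) U := by
  refine contDiffAt_pi.2 fun a => contDiffAt_pi.2 fun i => ?_
  exact ContDiffAt.matrix_mul (A := fun _ => t) (fun _ _ => contDiffAt_const)
    (ContDiffAt.matrix_inv (contDiffAt_frame hU.1) (isUnit_frame hnd hU).ne_zero) a i

theorem of_ofFrame_mul_frame (hnd : S.Nondegenerate) {U : JetSpace} (hU : U ∈ S.locus)
    (t : Matrix (Fin 2) (Fin 4) ℝ) : Matrix.of (S.ofFrame U t) * S.frame U = t := by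
  rw [ofFrame, Equiv.apply_symm_apply,
    Matrix.nonsing_inv_mul_cancel_right _ _ (isUnit_frame hnd hU)]

theorem fderiv_ofFrame (hnd : S.Nondegenerate) {U : JetSpace} (hU : U ∈ S.locus)
    (t : Matrix (Fin 2) (Fin 4) ℝ) : fderiv ℝ S.eqs U (S.ofFrame U t) = contr t := by
  rw [fderiv_eqs_apply hU.1, of_ofFrame_mul_frame hnd hU]

theorem ofFrame_of_mul_frame (hnd : S.Nondegenerate) {U : JetSpace} (hU : U ∈ S.locus)
    (t : JetSpace) : S.ofFrame U (Matrix.of t * S.frame U) = t := by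
  rw [ofFrame, Matrix.mul_nonsing_inv_cancel_right _ _ (isUnit_frame hnd hU),
    Equiv.symm_apply_apply]

/-- The second derivative of `(F, H)` in the frame at `U`. -/
def secondForm (S : FirstOrderSystem) (U : JetSpace) (s t : Matrix (Fin 2) (Fin 4) ℝ) :
    Fin 2 → ℝ :=
  fderiv ℝ (fderiv ℝ S.eqs) U (S.ofFrame U s) (S.ofFrame U t)

theorem contDiffAt_secondForm (hnd : S.Nondegenerate) {U : JetSpace} (hU : U ∈ S.locus)
    (s t : Matrix (Fin 2) (Fin 4) ℝ) (k : Fin 2) :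
    ContDiffAt ℝ ∞ (fun U => S.secondForm U s t k) U := by
  have h : ContDiffAt ℝ ∞ (fun U => S.secondForm U s t) U :=
    (((contDiffAt_fderiv_eqs hU.1).fderiv_right (by simp)).clm_apply
      (contDiffAt_ofFrame hnd hU s)).clm_apply (contDiffAt_ofFrame hnd hU t)
  exact contDiffAt_pi.1 h k

/-- The matrix `C` of the osculating system, computed from the second derivatives. -/
def osc (S : FirstOrderSystem) (U : JetSpace) : Matrix (Fin 4) (Fin 2) ℝ :=
  -- The same eight coefficients as in the witness of `exists_contr_of_simpleJet`. An explicit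
  -- formula, unlike a pointwise choice of `C`, is smooth in `U`.
  S.frame U * Matrix.of
    ![![S.secondForm U (modelBasis 2) (modelBasis 4) 1, S.secondForm U (modelBasis 0) (modelBasis 5) 1],
      ![-S.secondForm U (modelBasis 0) (modelBasis 4) 1, S.secondForm U (modelBasis 1) (modelBasis 5) 1],
      ![S.secondForm U (modelBasis 1) (modelBasis 5) 0, -S.secondForm U (modelBasis 0) (modelBasis 5) 0],
      ![S.secondForm U (modelBasis 0) (modelBasis 4) 0, S.secondForm U (modelBasis 2) (modelBasis 4) 0]]

theorem contDiffAt_osc (hnd : S.Nondegenerate) {U : JetSpace} (hU : U ∈ S.locus)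
    (i : Fin 4) (j : Fin 2) : ContDiffAt ℝ ∞ (fun U => S.osc U i j) U := by
  refine ContDiffAt.matrix_mul (contDiffAt_frame hU.1) (fun i j => ?_) i j
  have h := contDiffAt_secondForm hnd hU
  fin_cases i <;> fin_cases j
  · exact h _ _ _
  · exact h _ _ _
  · exact (h _ _ _).neg
  · exact h _ _ _
  · exact h _ _ _
  · exact (h _ _ _).neg
  · exact h _ _ _
  · exact h _ _ _

/-- The osculating condition is quadratic; this is its polarisation. The unspecified `C` can be
replaced by `osc U` because its entries are read off from the polarised form on the model basis. -/
theorem fderiv_fderiv_eq_of_osculating (hnd : S.Nondegenerate) (ho : S.Osculating) {U : JetSpace}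
    (hU : U ∈ S.locus) {s t : JetSpace} (hs : fderiv ℝ S.eqs U s = 0)
    (ht : fderiv ℝ S.eqs U t = 0) :
    fderiv ℝ (fderiv ℝ S.eqs) U s t = fderiv ℝ S.eqs U (Matrix.of.symm
      (Matrix.of s * S.osc U * Matrix.of t + Matrix.of t * S.osc U * Matrix.of s)) := by
  obtain ⟨C, hC⟩ := ho U hU
  have hpol : ∀ s t : JetSpace, fderiv ℝ S.eqs U s = 0 → fderiv ℝ S.eqs U t = 0 →
      fderiv ℝ (fderiv ℝ S.eqs) U s t = fderiv ℝ S.eqs U (Matrix.of.symm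
        (Matrix.of s * C * Matrix.of t + Matrix.of t * C * Matrix.of s)) := by
    intro s t hs ht
    have h1 := hC (s + t) (by simp [hs, ht])
    have h2 := hC s hs
    have h3 := hC t ht
    have hst := fderiv_fderiv_eqs_comm hU.1 s t
    have e1 : Matrix.of.symm (Matrix.of (s + t) * C * Matrix.of (s + t)) =
        Matrix.of.symm (Matrix.of s * C * Matrix.of s) + Matrix.of.symm (Matrix.of t * C * Matrix.of t)
        + Matrix.of.symm (Matrix.of s * C * Matrix.of t + Matrix.of t * C * Matrix.of s) := by
      have : (Matrix.of (s + t) : Matrix (Fin 2) (Fin 4) ℝ) = Matrix.of s + Matrix.of t := rfl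
      rw [this]
      change (_ : Matrix (Fin 2) (Fin 4) ℝ) = (Matrix.of s * C * Matrix.of s)
        + (Matrix.of t * C * Matrix.of t) + (Matrix.of s * C * Matrix.of t + Matrix.of t * C * Matrix.of s)
      change (Matrix.of s + Matrix.of t) * C * (Matrix.of s + Matrix.of t) = _
      simp only [Matrix.add_mul, Matrix.mul_add]
      abel
    rw [e1] at h1
    simp only [map_add, add_apply, smul_add, h2, h3, ← hst] at h1
    have h4 : (2 : ℝ) • fderiv ℝ (fderiv ℝ S.eqs) U s t = (2 : ℝ) • fderiv ℝ S.eqs U (Matrix.of.symm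
        (Matrix.of s * C * Matrix.of t + Matrix.of t * C * Matrix.of s)) := by
      rw [two_smul]
      linear_combination (exp := 1) h1
    exact smul_right_injective _ two_ne_zero h4
  have hsec : ∀ s t, contr s = 0 → contr t = 0 → S.secondForm U s t =
      contr (s * ((S.frame U)⁻¹ * C) * t + t * ((S.frame U)⁻¹ * C) * s) := by
    intro s t hs ht
    rw [secondForm, hpol _ _ (by rw [fderiv_ofFrame hnd hU, hs]) (by rw [fderiv_ofFrame hnd hU, ht]),
      fderiv_eqs_apply hU.1, Equiv.apply_symm_apply, Matrix.add_mul, Matrix.mul_assoc _ _ (S.frame U),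
      Matrix.mul_assoc _ _ (S.frame U), of_ofFrame_mul_frame hnd hU, of_ofFrame_mul_frame hnd hU]
    simp only [ofFrame, Equiv.apply_symm_apply, Matrix.mul_assoc]
  have hosc : S.osc U = C := by
    have hb := fun a b c a' b' c' d e f d' e' f' => hsec (modelJet a b c a' b' c')
      (modelJet d e f d' e' f') (by simp) (by simp)
    have h0 : S.osc U = S.frame U * ((S.frame U)⁻¹ * C) := by
      rw [osc]
      congr 1
      ext i j
      have hb0 : modelBasis 0 = modelJet 1 0 0 0 0 0 := rfl
      have hb1 : modelBasis 1 = modelJet 0 1 0 0 0 0 := rfl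
      have hb2 : modelBasis 2 = modelJet 0 0 1 0 0 0 := rfl
      have hb4 : modelBasis 4 = modelJet 0 0 0 0 1 0 := rfl
      have hb5 : modelBasis 5 = modelJet 0 0 0 0 0 1 := rfl
      simp only [hb0, hb1, hb2, hb4, hb5, hb, map_add, contr_mul_mul_modelJet]
      fin_cases i <;> fin_cases j <;> simp
    rw [h0, Matrix.mul_nonsing_inv_cancel_left _ _ (isUnit_frame hnd hU)]
  rw [hosc]
  exact hpol s t hs ht

end FirstOrderSystem

/-! ### Third-order compatibility: the Riccati equation for the osculating matrix -/

theorem HasFDerivAt.hasDerivAt_ray {V W : Type*} [NormedAddCommGroup V] [NormedSpace ℝ V]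
    [NormedAddCommGroup W] [NormedSpace ℝ W] {f : V → W} {f' : V →L[ℝ] W}
    (hf : HasFDerivAt f f' 0) (k : V) : HasDerivAt (fun s : ℝ => f (s • k)) (f' k) 0 := by
  have hray : HasDerivAt (fun s : ℝ => s • k) k 0 := by
    simpa using (hasDerivAt_id (0 : ℝ)).smul_const k
  exact hf.comp_hasDerivAt_of_eq (0 : ℝ) hray (zero_smul _ _).symm

namespace FirstOrderSystem

variable {S : FirstOrderSystem}

section Riccati

attribute [local instance] Matrix.normedAddCommGroup Matrix.normedSpace

/-- The derivative of the matrix of the osculating system. -/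
def oscDeriv (S : FirstOrderSystem) (U : JetSpace) : JetSpace →ₗ[ℝ] Matrix (Fin 4) (Fin 2) ℝ where
  toFun t := Matrix.of fun i j => fderiv ℝ (fun U => S.osc U i j) U t
  map_add' s t := by ext i j; simp
  map_smul' c t := by ext i j; simp

theorem hasDerivAt_osc (hnd : S.Nondegenerate) {c : ℝ → JetSpace} {c' : JetSpace} {τ : ℝ}
    (hc : HasDerivAt c c' τ) (hτ : c τ ∈ S.locus) :
    HasDerivAt (fun τ => S.osc (c τ)) (S.oscDeriv (c τ) c') τ := by
  refine hasDerivAt_pi.2 fun i => hasDerivAt_pi.2 fun j => ?_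
  exact (((contDiffAt_osc hnd hτ i j).differentiableAt (by simp)).hasFDerivAt).comp_hasDerivAt τ hc

-- In a chart `ψ` of the locus the osculating condition says that `D²ψ(j, i)` plus the two products
-- through `osc` is tangent. The identity is the derivative of this along the ray of `k`; `P` and
-- `R` are the second and third derivatives of `ψ`, and only their symmetry matters later.
set_option maxHeartbeats 1000000 in
theorem exists_third_order_identity (hnd : S.Nondegenerate) (ho : S.Osculating) {U : JetSpace}
    (hU : U ∈ S.locus) : ∃ (P : JetSpace → JetSpace → Matrix (Fin 2) (Fin 4) ℝ)
    (R : JetSpace → JetSpace → JetSpace → Matrix (Fin 2) (Fin 4) ℝ),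
    (∀ i j, P i j = P j i) ∧ (∀ i j k, R i j k = R j i k) ∧
    ∀ i j k : JetSpace, fderiv ℝ S.eqs U i = 0 → fderiv ℝ S.eqs U j = 0 →
      fderiv ℝ S.eqs U k = 0 → contr ((
        R k j i + P k i * S.osc U * Matrix.of j + Matrix.of i * S.oscDeriv U k * Matrix.of j
        + Matrix.of i * S.osc U * P k j + P k j * S.osc U * Matrix.of i
        + Matrix.of j * S.oscDeriv U k * Matrix.of i + Matrix.of j * S.osc U * P k i
        + Matrix.of k * S.osc U * (P j i + Matrix.of i * S.osc U * Matrix.of j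
            + Matrix.of j * S.osc U * Matrix.of i)
        + (P j i + Matrix.of i * S.osc U * Matrix.of j
            + Matrix.of j * S.osc U * Matrix.of i) * S.osc U * Matrix.of k) * S.frame U) = 0 := by
  obtain ⟨ψ, r, hr, hψ, hψ0, hψd, h⟩ := exists_chart hnd hU
  have hb : ∀ z ∈ Metric.ball (0 : JetSpace) r, Metric.ball (0 : JetSpace) r ∈ 𝓝 z :=
    fun z hz => Metric.isOpen_ball.mem_nhds hz
  have h0b : (0 : JetSpace) ∈ Metric.ball (0 : JetSpace) r := Metric.mem_ball_self hr
  have hψc : ∀ z ∈ Metric.ball 0 r, ContDiffAt ℝ ∞ ψ z := fun z hz => hψ.contDiffAt (hb z hz)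
  have hψ1 : ∀ z ∈ Metric.ball 0 r, HasFDerivAt ψ (fderiv ℝ ψ z) z :=
    fun z hz => ((hψc z hz).differentiableAt (by simp)).hasFDerivAt
  have hψc1 : ∀ z ∈ Metric.ball 0 r, ContDiffAt ℝ ∞ (fderiv ℝ ψ) z :=
    fun z hz => (hψc z hz).fderiv_right (by simp)
  have hψ2 : ∀ z ∈ Metric.ball 0 r, HasFDerivAt (fderiv ℝ ψ) (fderiv ℝ (fderiv ℝ ψ) z) z :=
    fun z hz => ((hψc1 z hz).differentiableAt (by simp)).hasFDerivAt
  have hψc2 : ContDiffAt ℝ ∞ (fderiv ℝ (fderiv ℝ ψ)) 0 := (hψc1 0 h0b).fderiv_right (by simp)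
  have hψ3 : HasFDerivAt (fderiv ℝ (fderiv ℝ ψ)) (fderiv ℝ (fderiv ℝ (fderiv ℝ ψ)) 0) 0 :=
    (hψc2.differentiableAt (by simp)).hasFDerivAt
  have hid : fderiv ℝ ψ 0 = ContinuousLinearMap.id ℝ JetSpace := hψd.hasFDerivAt.fderiv
  have e1 : ∀ z ∈ Metric.ball 0 r, ∀ i, fderiv ℝ S.eqs (ψ z) (fderiv ℝ ψ z i)
      = fderiv ℝ S.eqs U i := by
    intro z hz i
    have h1 : HasFDerivAt (fun z => S.eqs (ψ z)) ((fderiv ℝ S.eqs (ψ z)).comp (fderiv ℝ ψ z)) z :=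
      (hasFDerivAt_eqs (h z hz).1).comp z (hψ1 z hz)
    have h2 : HasFDerivAt (fun z => S.eqs (ψ z)) (fderiv ℝ S.eqs U) z :=
      (fderiv ℝ S.eqs U).hasFDerivAt.congr_of_eventuallyEq
        (Filter.eventually_of_mem (hb z hz) fun y hy => (h y hy).2)
    exact DFunLike.congr_fun (h1.unique h2) i
  have e2 : ∀ z ∈ Metric.ball 0 r, ∀ i j, fderiv ℝ S.eqs (ψ z) (fderiv ℝ (fderiv ℝ ψ) z j i) =
      - fderiv ℝ (fderiv ℝ S.eqs) (ψ z) (fderiv ℝ ψ z j) (fderiv ℝ ψ z i) := by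
    intro z hz i j
    have h1 := (((hasFDerivAt_fderiv_eqs (h z hz).1).comp z (hψ1 z hz)).clm_apply
      ((hψ2 z hz).clm_apply (hasFDerivAt_const i z)))
    have h2 : HasFDerivAt (fun y => fderiv ℝ S.eqs (ψ y) (fderiv ℝ ψ y i))
        (0 : JetSpace →L[ℝ] (Fin 2 → ℝ)) z :=
      (hasFDerivAt_const (fderiv ℝ S.eqs U i) z).congr_of_eventuallyEq
        (Filter.eventually_of_mem (hb z hz) fun y hy => e1 y hy i)
    have h3 := DFunLike.congr_fun (h1.unique h2) j
    simp at h3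
    exact eq_neg_of_add_eq_zero_left h3
  have hloc : ∀ z ∈ Metric.ball 0 r, fderiv ℝ S.eqs U z = 0 → ψ z ∈ S.locus := fun z hz hz' =>
    S.mem_locus_iff.2 ⟨(h z hz).1, by rw [(h z hz).2, hz']⟩
  refine ⟨fun i j => Matrix.of (fderiv ℝ (fderiv ℝ ψ) 0 i j),
    fun i j k => Matrix.of (fderiv ℝ (fderiv ℝ (fderiv ℝ ψ)) 0 i j k), fun i j => ?_,
    fun i j k => ?_, fun i j k hi hj hk => ?_⟩
  · have := (hψc 0 h0b).isSymmSndFDerivAt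
      (by rw [minSmoothness_of_isRCLikeNormedField]; exact ENat.LEInfty.out) i j
    simp only [this]
  · have := (hψc1 0 h0b).isSymmSndFDerivAt
      (by rw [minSmoothness_of_isRCLikeNormedField]; exact ENat.LEInfty.out) i j
    simp only [this]
  -- The vector that the osculating condition makes tangent to the locus along the ray.
  set N : ℝ → JetSpace := fun s => Matrix.of.symm (
    Matrix.of (fderiv ℝ (fderiv ℝ ψ) (s • k) j i)
    + Matrix.of (fderiv ℝ ψ (s • k) i) * S.osc (ψ (s • k)) * Matrix.of (fderiv ℝ ψ (s • k) j)
    + Matrix.of (fderiv ℝ ψ (s • k) j) * S.osc (ψ (s • k)) * Matrix.of (fderiv ℝ ψ (s • k) i))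
    with hN
  have hray : HasDerivAt (fun s : ℝ => s • k) k 0 := by
    simpa using (hasDerivAt_id (0 : ℝ)).smul_const k
  have hsmall : ∀ᶠ s : ℝ in 𝓝 0, s • k ∈ Metric.ball (0 : JetSpace) r := by
    have : Filter.Tendsto (fun s : ℝ => s • k) (𝓝 0) (𝓝 ((0 : ℝ) • k)) :=
      hray.continuousAt
    rw [zero_smul] at this
    exact this (hb 0 h0b)
  have hN0 : ∀ᶠ s : ℝ in 𝓝 0, fderiv ℝ S.eqs (ψ (s • k)) (N s) = 0 := by
    filter_upwards [hsmall] with s hs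
    have hs' : ψ (s • k) ∈ S.locus := hloc _ hs (by rw [map_smul, hk, smul_zero])
    have hsum : N s = fderiv ℝ (fderiv ℝ ψ) (s • k) j i + Matrix.of.symm (
        Matrix.of (fderiv ℝ ψ (s • k) j) * S.osc (ψ (s • k)) * Matrix.of (fderiv ℝ ψ (s • k) i)
        + Matrix.of (fderiv ℝ ψ (s • k) i) * S.osc (ψ (s • k))
          * Matrix.of (fderiv ℝ ψ (s • k) j)) := by
      ext a b
      simp only [hN, Matrix.of_symm_apply, Matrix.add_apply, Matrix.of_apply, Pi.add_apply]
      ring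
    rw [hsum, map_add, e2 _ hs, ← fderiv_fderiv_eq_of_osculating hnd ho hs'
      (by rw [e1 _ hs, hj]) (by rw [e1 _ hs, hi]), neg_add_cancel]
  have z0 : (0 : ℝ) • k = 0 := zero_smul _ _
  have d1' : HasDerivAt (fun s : ℝ => fderiv ℝ ψ (s • k)) (fderiv ℝ (fderiv ℝ ψ) 0 k) 0 := by
    exact (hψ2 0 h0b).hasDerivAt_ray k
  have d1 : ∀ i, HasDerivAt (fun s : ℝ => Matrix.of (fderiv ℝ ψ (s • k) i))
      (Matrix.of (fderiv ℝ (fderiv ℝ ψ) 0 k i)) 0 := by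
    intro i
    have := d1'.clm_apply (hasDerivAt_const (0 : ℝ) i)
    rw [map_zero, add_zero] at this
    exact this
  have d2' : HasDerivAt (fun s : ℝ => fderiv ℝ (fderiv ℝ ψ) (s • k))
      (fderiv ℝ (fderiv ℝ (fderiv ℝ ψ)) 0 k) 0 := by
    exact HasFDerivAt.hasDerivAt_ray (W := JetSpace →L[ℝ] JetSpace →L[ℝ] JetSpace) hψ3 k
  have d2 : HasDerivAt (fun s : ℝ => Matrix.of (fderiv ℝ (fderiv ℝ ψ) (s • k) j i))
      (Matrix.of (fderiv ℝ (fderiv ℝ (fderiv ℝ ψ)) 0 k j i)) 0 := by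
    have hj : HasDerivAt (fun s : ℝ => fderiv ℝ (fderiv ℝ ψ) (s • k) j)
        (fderiv ℝ (fderiv ℝ (fderiv ℝ ψ)) 0 k j) 0 := by
      have := d2'.clm_apply (hasDerivAt_const (0 : ℝ) j)
      rwa [map_zero, add_zero] at this
    have := hj.clm_apply (hasDerivAt_const (0 : ℝ) i)
    rw [map_zero, add_zero] at this
    exact this
  have d0 : HasDerivAt (fun s : ℝ => ψ (s • k)) k 0 := hψd.hasFDerivAt.hasDerivAt_ray k
  have dC : HasDerivAt (fun s : ℝ => S.osc (ψ (s • k))) (S.oscDeriv U k) 0 := by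
    have := hasDerivAt_osc hnd d0 (by rw [z0, hψ0]; exact hU)
    simpa only [z0, hψ0] using this
  have dN : HasDerivAt N (Matrix.of.symm (Matrix.of (fderiv ℝ (fderiv ℝ (fderiv ℝ ψ)) 0 k j i)
      + ((Matrix.of (fderiv ℝ (fderiv ℝ ψ) 0 k i) * S.osc U + Matrix.of i * S.oscDeriv U k)
        * Matrix.of j + Matrix.of i * S.osc U * Matrix.of (fderiv ℝ (fderiv ℝ ψ) 0 k j))
      + ((Matrix.of (fderiv ℝ (fderiv ℝ ψ) 0 k j) * S.osc U + Matrix.of j * S.oscDeriv U k)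
        * Matrix.of i + Matrix.of j * S.osc U * Matrix.of (fderiv ℝ (fderiv ℝ ψ) 0 k i)))) 0 := by
    have := (d2.add (((d1 i).matrix_mul dC).matrix_mul (d1 j))).add
      (((d1 j).matrix_mul dC).matrix_mul (d1 i))
    simp only [z0, hψ0, hid, ContinuousLinearMap.id_apply] at this
    exact this
  have dθ : HasDerivAt (fun s : ℝ => fderiv ℝ S.eqs (ψ (s • k)))
      (fderiv ℝ (fderiv ℝ S.eqs) U k) 0 :=
    HasFDerivAt.comp_hasDerivAt (0 : ℝ) (f := fun s : ℝ => ψ (s • k))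
      (by rw [z0, hψ0]; exact hasFDerivAt_fderiv_eqs hU.1) d0
  have dtot := (dθ.clm_apply dN).unique
    ((hasDerivAt_const (0 : ℝ) (0 : Fin 2 → ℝ)).congr_of_eventuallyEq hN0)
  have hN00 : fderiv ℝ S.eqs U (N 0) = 0 := by
    have := hN0.self_of_nhds
    rwa [z0, hψ0] at this
  -- Both `k` and `N 0` are tangent, so the second derivative of `(F, H)` on them is again expressed
  -- through `osc`; this is the source of the terms quadratic in `osc`.
  rw [z0, hψ0, fderiv_fderiv_eq_of_osculating hnd ho hU hk hN00] at dtot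
  rw [fderiv_eqs_apply hU.1, fderiv_eqs_apply hU.1, ← map_add, ← Matrix.add_mul] at dtot
  refine Eq.trans ?_ dtot
  simp only [hN, z0, hψ0, hid, ContinuousLinearMap.id_apply, Equiv.apply_symm_apply,
    Matrix.add_mul, Matrix.mul_add, Matrix.mul_assoc]
  congr 1
  abel

/-- Exchanging `j` and `k` in the third-order identity and subtracting removes all derivatives of
the chart. What is left is linear in the Riccati defect `dC(t) - C t C`, and `eq_zero_of_contr_symm`
makes that defect vanish. -/
theorem oscDeriv_eq (hnd : S.Nondegenerate) (ho : S.Osculating) {U : JetSpace}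
    (hU : U ∈ S.locus) {t : JetSpace} (ht : fderiv ℝ S.eqs U t = 0) :
    S.oscDeriv U t = S.osc U * Matrix.of t * S.osc U := by
  obtain ⟨P, R, hP, hR, h⟩ := exists_third_order_identity hnd ho hU
  have hE := isUnit_frame hnd hU
  let K : Matrix (Fin 2) (Fin 4) ℝ →ₗ[ℝ] Matrix (Fin 4) (Fin 2) ℝ :=
    { toFun := fun t => (S.frame U)⁻¹ * (S.oscDeriv U (S.ofFrame U t)
        - S.osc U * Matrix.of (S.ofFrame U t) * S.osc U)
      map_add' := fun s t => by
        have : S.ofFrame U (s + t) = S.ofFrame U s + S.ofFrame U t := by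
          rw [ofFrame, Matrix.add_mul]; rfl
        rw [this, map_add, ← Matrix.of_add_of]
        simp only [Matrix.mul_add, Matrix.add_mul, Matrix.mul_sub]
        abel
      map_smul' := fun c t => by
        have : S.ofFrame U (c • t) = c • S.ofFrame U t := by
          rw [ofFrame, Matrix.smul_mul]; rfl
        rw [this, map_smul, ← Matrix.smul_of]
        simp only [Matrix.mul_smul, Matrix.smul_mul, Matrix.mul_sub, smul_sub, RingHom.id_apply] }
  have hK : ∀ i j k, contr i = 0 → contr j = 0 → contr k = 0 →
      contr (i * K k * j + j * K k * i - i * K j * k - k * K j * i) = 0 := by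
    intro i j k hi hj hk
    have hi' : fderiv ℝ S.eqs U (S.ofFrame U i) = 0 := by rw [fderiv_ofFrame hnd hU, hi]
    have hj' : fderiv ℝ S.eqs U (S.ofFrame U j) = 0 := by rw [fderiv_ofFrame hnd hU, hj]
    have hk' : fderiv ℝ S.eqs U (S.ofFrame U k) = 0 := by rw [fderiv_ofFrame hnd hU, hk]
    have h1 := h _ _ _ hi' hj' hk'
    have h2 := h _ _ _ hi' hk' hj'
    have h3 := congrArg₂ (· - ·) h1 h2
    simp only [← map_sub, sub_zero, ← Matrix.sub_mul] at h3
    rw [← h3]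
    congr 1
    have hr : ∀ s t (M : Matrix (Fin 4) (Fin 2) ℝ), s * ((S.frame U)⁻¹ * M) * t =
        Matrix.of (S.ofFrame U s) * M * Matrix.of (S.ofFrame U t) * S.frame U := by
      intro s t M
      rw [Matrix.mul_assoc _ _ (S.frame U), of_ofFrame_mul_frame hnd hU, ofFrame,
        Equiv.apply_symm_apply]
      simp only [Matrix.mul_assoc]
    have hKd : ∀ t, K t = (S.frame U)⁻¹ * (S.oscDeriv U (S.ofFrame U t)
        - S.osc U * Matrix.of (S.ofFrame U t) * S.osc U) := fun _ => rfl
    rw [hKd, hKd, hr, hr, hr, hr, ← Matrix.add_mul, ← Matrix.sub_mul, ← Matrix.sub_mul]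
    congr 1
    -- Symmetry of the second and third derivatives of the chart makes their contributions cancel in
    -- the difference.
    rw [hP (S.ofFrame U k) (S.ofFrame U j), hP (S.ofFrame U k) (S.ofFrame U i),
      hP (S.ofFrame U j) (S.ofFrame U i), hR (S.ofFrame U k) (S.ofFrame U j)]
    simp only [Matrix.mul_sub, Matrix.mul_add, Matrix.add_mul, Matrix.sub_mul, Matrix.mul_assoc]
    abel
  have hz := eq_zero_of_contr_symm K hK (t := Matrix.of t * S.frame U)
    (by rw [← fderiv_eqs_apply hU.1, ht])
  replace hz : (S.frame U)⁻¹ * (S.oscDeriv U (S.ofFrame U (Matrix.of t * S.frame U)) - S.osc U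
      * Matrix.of (S.ofFrame U (Matrix.of t * S.frame U)) * S.osc U) = 0 := hz
  rw [ofFrame_of_mul_frame hnd hU] at hz
  have := congrArg (S.frame U * ·) hz
  simp only [Matrix.mul_nonsing_inv_cancel_left _ _ hE, Matrix.mul_zero] at this
  exact sub_eq_zero.1 this

end Riccati

end FirstOrderSystem

/-! ### Constancy of the osculating system along curves in the locus -/

namespace FirstOrderSystem

variable {S : FirstOrderSystem}

/-- Both kernels have dimension 6 and `s ↦ a s d` is invertible, so an inclusion of one kernel into
the other is an equality. This provides the converse of `ModelCompat.tangent`. -/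
theorem contr_eq_zero_of_mul_mul {a : Matrix (Fin 2) (Fin 2) ℝ} {d e f : Matrix (Fin 4) (Fin 4) ℝ}
    (ha : IsUnit a.det) (hd : IsUnit d.det) (he : IsUnit e.det) (hf : IsUnit f.det)
    (h : ∀ s : Matrix (Fin 2) (Fin 4) ℝ, contr (s * e) = 0 → contr (a * s * d * f) = 0) {s : Matrix (Fin 2) (Fin 4) ℝ}
    (hs : contr (a * s * d * f) = 0) : contr (s * e) = 0 := by
  let φ : Matrix (Fin 2) (Fin 4) ℝ ≃ₗ[ℝ] Matrix (Fin 2) (Fin 4) ℝ :=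
    { toFun := fun s => a * s * d
      map_add' := fun s t => by rw [Matrix.mul_add, Matrix.add_mul]
      map_smul' := fun c s => by simp
      invFun := fun s => a⁻¹ * s * d⁻¹
      left_inv := fun s => by
        simp only [Matrix.mul_assoc, Matrix.mul_nonsing_inv _ hd, Matrix.mul_one]
        rw [Matrix.nonsing_inv_mul_cancel_left _ _ ha]
      right_inv := fun s => by
        simp only [Matrix.mul_assoc, Matrix.nonsing_inv_mul _ hd, Matrix.mul_one]
        rw [Matrix.mul_nonsing_inv_cancel_left _ _ ha] }
  let μ : ∀ e : Matrix (Fin 4) (Fin 4) ℝ, Matrix (Fin 2) (Fin 4) ℝ →ₗ[ℝ] (Fin 2 → ℝ) := fun e =>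
    { toFun := fun s => contr (s * e)
      map_add' := fun s t => by rw [Matrix.add_mul, map_add]
      map_smul' := fun c s => by rw [Matrix.smul_mul, map_smul]; rfl }
  have hrank : ∀ e : Matrix (Fin 4) (Fin 4) ℝ, IsUnit e.det →
      Module.finrank ℝ (LinearMap.ker (μ e)) = 6 := by
    intro e he
    have h1 := LinearMap.finrank_range_add_finrank_ker (μ e)
    have h2 : LinearMap.range (μ e) = ⊤ := LinearMap.range_eq_top.2 fun c =>
      ⟨contrSection c * e⁻¹, by
        change contr (contrSection c * e⁻¹ * e) = c
        rw [Matrix.nonsing_inv_mul_cancel_right _ _ he, contr_contrSection]⟩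
    rw [h2, finrank_top] at h1
    simp only [Module.finrank_fintype_fun_eq_card, Fintype.card_fin, Module.finrank_matrix,
      Module.finrank_self] at h1
    omega
  have hle : (LinearMap.ker (μ e)).map (φ : _ →ₗ[ℝ] _) ≤ LinearMap.ker (μ f) := by
    rintro _ ⟨s, hs, rfl⟩
    exact h s hs
  have heq := Submodule.eq_of_le_of_finrank_eq hle
    (by rw [LinearEquiv.finrank_map_eq, hrank e he, hrank f hf])
  have hmem : φ s ∈ (LinearMap.ker (μ e)).map (φ : _ →ₗ[ℝ] _) := by
    rw [heq]
    exact hs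
  obtain ⟨s', hs', hss'⟩ := hmem
  rw [← φ.injective hss']
  exact hs'

section Model

/-- The denominator of the projective transformation that flattens the osculating system at `U₁`. -/
def modelDen (S : FirstOrderSystem) (U₁ U : JetSpace) : Matrix (Fin 4) (Fin 4) ℝ :=
  1 - S.osc U₁ * Matrix.of (U - U₁)

/-- The projective transformation that flattens the osculating system at `U₁`. -/
def modelMap (S : FirstOrderSystem) (U₁ U : JetSpace) : Matrix (Fin 2) (Fin 4) ℝ :=
  Matrix.of (U - U₁) * (S.modelDen U₁ U)⁻¹

/-- The osculating system at `U₁`. -/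
def modelSet (S : FirstOrderSystem) (U₁ : JetSpace) : Set JetSpace :=
  {U | IsUnit (S.modelDen U₁ U).det ∧ contr (S.modelMap U₁ U * S.frame U₁) = 0}

/-- The osculating systems at `U₁` and `U₂` agree. -/
structure ModelCompat (S : FirstOrderSystem) (U₁ U₂ : JetSpace) : Prop where
  den_mul : S.modelDen U₁ U₂ * S.osc U₂ = S.osc U₁
  tangent : ∀ s : Matrix (Fin 2) (Fin 4) ℝ, contr (s * S.frame U₁) = 0 →
    contr ((1 - Matrix.of (U₂ - U₁) * S.osc U₁) * s * S.modelDen U₁ U₂ * S.frame U₂) = 0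

section algebra

variable {C₁ C : Matrix (Fin 4) (Fin 2) ℝ} {W : Matrix (Fin 2) (Fin 4) ℝ}

/-- The hypothesis is the integrated Riccati equation. It inverts the denominator explicitly, so
that invertibility along a curve in the locus comes for free. -/
theorem den_mul_one_add (h : (1 - C₁ * W) * C = C₁) : (1 - C₁ * W) * (1 + C * W) = 1 := by
  rw [Matrix.mul_add, Matrix.mul_one, ← Matrix.mul_assoc, h]
  abel

theorem mul_one_sub (h : (1 - C₁ * W) * C = C₁) : C * (1 - W * C₁) = C₁ := by
  have h1 : (1 + C * W) * (1 - C₁ * W) = 1 := mul_eq_one_comm.1 (den_mul_one_add h)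
  have h2 : (1 + C * W) * C₁ = C := by
    nth_rewrite 1 [← h]
    rw [← Matrix.mul_assoc, h1, Matrix.one_mul]
  rw [Matrix.add_mul, Matrix.one_mul, Matrix.mul_assoc] at h2
  rw [Matrix.mul_sub, Matrix.mul_one]
  exact sub_eq_of_eq_add h2.symm

theorem one_add_mul_one_sub (h : (1 - C₁ * W) * C = C₁) : (1 + W * C) * (1 - W * C₁) = 1 := by
  have : W * (C * (1 - W * C₁)) = W * C₁ := by rw [mul_one_sub h]
  rw [Matrix.add_mul, Matrix.one_mul, Matrix.mul_assoc, this]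
  abel

end algebra

section Curve

attribute [local instance] Matrix.normedAddCommGroup Matrix.normedSpace

variable {c c' : ℝ → JetSpace}

/-- By the Riccati equation the defect `K = (1 - C₁ W) C - C₁` satisfies the linear equation `K' = K
c' C` and starts at zero. Each row is an ordinary linear system, whence the transposed coefficient
matrix. -/
theorem den_mul_osc_of_curve (hnd : S.Nondegenerate) (ho : S.Osculating)
    (hc : ∀ τ ∈ Set.Icc (0 : ℝ) 1, HasDerivAt c (c' τ) τ)
    (hcc : ContinuousOn c' (Set.Icc 0 1)) (hmem : ∀ τ ∈ Set.Icc (0 : ℝ) 1, c τ ∈ S.locus)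
    (htan : ∀ τ ∈ Set.Icc (0 : ℝ) 1, fderiv ℝ S.eqs (c τ) (c' τ) = 0) :
    ∀ τ ∈ Set.Icc (0 : ℝ) 1, S.modelDen (c 0) (c τ) * S.osc (c τ) = S.osc (c 0) := by
  have hco : ContinuousOn c (Set.Icc 0 1) := fun τ hτ => (hc τ hτ).continuousAt.continuousWithinAt
  intro τ hτ
  set K : ℝ → Matrix (Fin 4) (Fin 2) ℝ := fun τ => S.modelDen (c 0) (c τ) * S.osc (c τ) - S.osc (c 0)
    with hK
  suffices h : ∀ i, K τ i = 0 by
    rw [← sub_eq_zero]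
    ext i j
    exact congrFun (h i) j
  intro i
  have hKd : ∀ τ ∈ Set.Icc (0 : ℝ) 1,
      HasDerivAt K (K τ * (Matrix.of (c' τ) * S.osc (c τ))) τ := by
    intro τ hτ
    have dW : HasDerivAt (fun τ => Matrix.of (c τ - c 0)) (Matrix.of (c' τ)) τ :=
      (hc τ hτ).sub_const (c 0)
    have dC := hasDerivAt_osc hnd (hc τ hτ) (hmem τ hτ)
    rw [oscDeriv_eq hnd ho (hmem τ hτ) (htan τ hτ)] at dC
    have dden : HasDerivAt (fun τ => S.modelDen (c 0) (c τ))
        (-((0 : Matrix (Fin 4) (Fin 2) ℝ) * Matrix.of (c τ - c 0) + S.osc (c 0) * Matrix.of (c' τ))) τ :=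
      ((hasDerivAt_const τ (S.osc (c 0))).matrix_mul dW).const_sub 1
    have := (dden.matrix_mul dC).sub_const (S.osc (c 0))
    refine this.congr_deriv ?_
    simp only [hK, Matrix.zero_mul, zero_add, Matrix.sub_mul, Matrix.neg_mul, Matrix.mul_assoc]
    abel
  refine eq_zero_of_hasDerivAt_mulVec (f := fun τ => K τ i)
    (A := fun τ => (Matrix.of (c' τ) * S.osc (c τ))ᵀ) ?_ ?_ ?_ τ hτ
  · intro k l
    simp only [Matrix.transpose_apply, Matrix.mul_apply]
    refine continuousOn_finsetSum _ fun m _ => ContinuousOn.mul ?_ ?_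
    · exact continuousOn_pi.1 (continuousOn_pi.1 hcc l) m
    · intro τ hτ
      exact ((contDiffAt_osc hnd (hmem τ hτ) m k).continuousAt.comp_continuousWithinAt (hco τ hτ))
  · intro τ hτ
    have := hasDerivAt_pi.1 (hKd τ hτ) i
    refine this.congr_deriv ?_
    rw [Matrix.mulVec_transpose]
    rfl
  · have : K 0 = 0 := by simp [hK, modelDen]
    rw [this]
    rfl

/-- A tangent vector `s` at the start is transported along the curve by the projective model. Its
defect of tangency solves a homogeneous linear equation with zero initial value, so the transported
vector stays tangent to the locus. -/
theorem modelCompat_of_curve (hnd : S.Nondegenerate) (ho : S.Osculating)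
    (hc : ∀ τ ∈ Set.Icc (0 : ℝ) 1, HasDerivAt c (c' τ) τ)
    (hcc : ContinuousOn c' (Set.Icc 0 1)) (hmem : ∀ τ ∈ Set.Icc (0 : ℝ) 1, c τ ∈ S.locus)
    (htan : ∀ τ ∈ Set.Icc (0 : ℝ) 1, fderiv ℝ S.eqs (c τ) (c' τ) = 0) :
    ∀ τ ∈ Set.Icc (0 : ℝ) 1, S.ModelCompat (c 0) (c τ) := by
  have hK := den_mul_osc_of_curve hnd ho hc hcc hmem htan
  have hco : ContinuousOn c (Set.Icc 0 1) := fun τ hτ => (hc τ hτ).continuousAt.continuousWithinAt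
  intro τ hτ
  refine ⟨hK τ hτ, fun s hs => ?_⟩
  set C₁ := S.osc (c 0) with hC₁
  set σ : ℝ → Matrix (Fin 2) (Fin 4) ℝ := fun τ =>
    (1 - Matrix.of (c τ - c 0) * C₁) * s * S.modelDen (c 0) (c τ) with hσ
  -- the defect of the second fundamental form on arbitrary vectors
  set B : JetSpace → JetSpace → JetSpace → Fin 2 → ℝ := fun U w t =>
    fderiv ℝ (fderiv ℝ S.eqs) U w t - fderiv ℝ S.eqs U (Matrix.of.symm
      (Matrix.of w * S.osc U * Matrix.of t + Matrix.of t * S.osc U * Matrix.of w)) with hB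
  have hBadd : ∀ U w t t', B U w (t + t') = B U w t + B U w t' := by
    intro U w t t'
    have e : Matrix.of.symm (Matrix.of w * S.osc U * Matrix.of (t + t')
        + Matrix.of (t + t') * S.osc U * Matrix.of w) = Matrix.of.symm
        (Matrix.of w * S.osc U * Matrix.of t + Matrix.of t * S.osc U * Matrix.of w)
        + Matrix.of.symm (Matrix.of w * S.osc U * Matrix.of t'
          + Matrix.of t' * S.osc U * Matrix.of w) := by
      ext a b
      simp only [← Matrix.of_add_of, Matrix.mul_add, Matrix.add_mul, Matrix.of_symm_apply,
        Matrix.add_apply, Pi.add_apply]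
      ring
    simp only [hB, e, map_add]
    abel
  have hBsmul : ∀ U w (r : ℝ) t, B U w (r • t) = r • B U w t := by
    intro U w r t
    have e : Matrix.of.symm (Matrix.of w * S.osc U * Matrix.of (r • t)
        + Matrix.of (r • t) * S.osc U * Matrix.of w) = r • Matrix.of.symm
        (Matrix.of w * S.osc U * Matrix.of t + Matrix.of t * S.osc U * Matrix.of w) := by
      ext a b
      simp only [← Matrix.smul_of, Matrix.mul_smul, Matrix.smul_mul, Matrix.of_symm_apply,
        Matrix.add_apply, Matrix.smul_apply, Pi.smul_apply, smul_eq_mul]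
      ring
    simp only [hB, e, map_smul, smul_sub]
  set f : ℝ → Fin 2 → ℝ := fun τ => fderiv ℝ S.eqs (c τ) (Matrix.of.symm (σ τ)) with hf
  set A : ℝ → Matrix (Fin 2) (Fin 2) ℝ := fun τ => Matrix.of fun k m =>
    B (c τ) (c' τ) (S.ofFrame (c τ) (contrSection (Pi.single m 1))) k with hA
  have hfd : ∀ τ ∈ Set.Icc (0 : ℝ) 1, HasDerivAt f (B (c τ) (c' τ) (Matrix.of.symm (σ τ))) τ := by
    intro τ hτ
    have dW : HasDerivAt (fun τ => Matrix.of (c τ - c 0)) (Matrix.of (c' τ)) τ :=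
      (hc τ hτ).sub_const (c 0)
    have dden : HasDerivAt (fun τ => S.modelDen (c 0) (c τ))
        (-((0 : Matrix (Fin 4) (Fin 2) ℝ) * Matrix.of (c τ - c 0) + C₁ * Matrix.of (c' τ))) τ :=
      ((hasDerivAt_const τ C₁).matrix_mul dW).const_sub 1
    have da : HasDerivAt (fun τ => 1 - Matrix.of (c τ - c 0) * C₁)
        (-(Matrix.of (c' τ) * C₁ + Matrix.of (c τ - c 0) * (0 : Matrix (Fin 4) (Fin 2) ℝ))) τ :=
      (dW.matrix_mul (hasDerivAt_const τ C₁)).const_sub 1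
    have hC : S.osc (c τ) * (1 - Matrix.of (c τ - c 0) * C₁) = C₁ := mul_one_sub (hK τ hτ)
    -- The relation between `osc (c τ)` and `osc (c 0)` turns the derivative of the projective
    -- transport into the correction term occurring in `B`.
    have dσ : HasDerivAt σ (-(Matrix.of (c' τ) * S.osc (c τ) * σ τ
        + σ τ * S.osc (c τ) * Matrix.of (c' τ))) τ := by
      have := (da.matrix_mul (hasDerivAt_const τ s)).matrix_mul dden
      refine this.congr_deriv ?_
      have e1 : Matrix.of (c' τ) * S.osc (c τ) * σ τ
          = Matrix.of (c' τ) * C₁ * s * S.modelDen (c 0) (c τ) := by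
        have h1 : Matrix.of (c' τ) * S.osc (c τ) * σ τ = Matrix.of (c' τ)
            * (S.osc (c τ) * (1 - Matrix.of (c τ - c 0) * C₁)) * s * S.modelDen (c 0) (c τ) := by
          simp only [hσ, Matrix.mul_assoc]
        rw [h1, hC]
      have e2 : σ τ * S.osc (c τ) * Matrix.of (c' τ)
          = (1 - Matrix.of (c τ - c 0) * C₁) * s * (C₁ * Matrix.of (c' τ)) := by
        simp only [hσ]
        rw [Matrix.mul_assoc _ _ (S.osc (c τ)), hK τ hτ]
        simp only [Matrix.mul_assoc]
      rw [e1, e2]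
      simp only [Matrix.mul_zero, Matrix.zero_mul, add_zero, zero_add, Matrix.neg_mul,
        Matrix.mul_neg, neg_add]
    have dσ' : HasDerivAt (fun τ => (Matrix.of.symm (σ τ) : JetSpace)) (Matrix.of.symm
        (-(Matrix.of (c' τ) * S.osc (c τ) * σ τ + σ τ * S.osc (c τ) * Matrix.of (c' τ)))) τ := dσ
    have dθ : HasDerivAt (fun τ => fderiv ℝ S.eqs (c τ))
        (fderiv ℝ (fderiv ℝ S.eqs) (c τ) (c' τ)) τ :=
      (hasFDerivAt_fderiv_eqs (hmem τ hτ).1).comp_hasDerivAt τ (hc τ hτ)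
    have := dθ.clm_apply dσ'
    refine this.congr_deriv ?_
    simp only [hB, sub_eq_add_neg, ← map_neg, Equiv.apply_symm_apply]
    rfl
  have hz : f τ = 0 := by
    refine eq_zero_of_hasDerivAt_mulVec (A := A) ?_ ?_ ?_ τ hτ
    · intro k m
      have hcont : ContinuousOn (fun τ => B (c τ) (c' τ)
          (S.ofFrame (c τ) (contrSection (Pi.single m 1)))) (Set.Icc 0 1) := by
        have hof : ContinuousOn (fun τ => S.ofFrame (c τ) (contrSection (Pi.single m 1)))
            (Set.Icc 0 1) := fun τ hτ =>
          (contDiffAt_ofFrame hnd (hmem τ hτ) _).continuousAt.comp_continuousWithinAt (hco τ hτ)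
        have h1 : ContinuousOn (fun τ => fderiv ℝ S.eqs (c τ)) (Set.Icc 0 1) := fun τ hτ =>
          (contDiffAt_fderiv_eqs (hmem τ hτ).1).continuousAt.comp_continuousWithinAt (hco τ hτ)
        have h2 : ContinuousOn (fun τ => fderiv ℝ (fderiv ℝ S.eqs) (c τ)) (Set.Icc 0 1) :=
          fun τ hτ => ((contDiffAt_fderiv_eqs (hmem τ hτ).1).fderiv_right
            (m := ∞) (by simp)).continuousAt.comp_continuousWithinAt (hco τ hτ)
        have h3 : ContinuousOn (fun τ => S.osc (c τ)) (Set.Icc 0 1) := by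
          refine continuousOn_pi.2 fun i => continuousOn_pi.2 fun j τ hτ => ?_
          exact (contDiffAt_osc hnd (hmem τ hτ) i j).continuousAt.comp_continuousWithinAt
            (hco τ hτ)
        refine ((h2.clm_apply hcc).clm_apply hof).sub (h1.clm_apply ?_)
        have hc'm : ContinuousOn (fun τ => Matrix.of (c' τ)) (Set.Icc 0 1) := hcc
        have hofm : ContinuousOn (fun τ => Matrix.of (S.ofFrame (c τ)
          (contrSection (Pi.single m 1)))) (Set.Icc 0 1) := hof
        have hmul : ∀ {p q r : ℕ} {X : ℝ → Matrix (Fin p) (Fin q) ℝ}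
            {Y : ℝ → Matrix (Fin q) (Fin r) ℝ}, ContinuousOn X (Set.Icc 0 1) →
            ContinuousOn Y (Set.Icc 0 1) → ContinuousOn (fun τ => X τ * Y τ) (Set.Icc 0 1) := by
          intro p q r X Y hX hY
          refine continuousOn_pi.2 fun i => continuousOn_pi.2 fun j => ?_
          simp only [Matrix.mul_apply]
          exact continuousOn_finsetSum _ fun k _ =>
            (continuousOn_pi.1 (continuousOn_pi.1 hX i) k).mul
              (continuousOn_pi.1 (continuousOn_pi.1 hY k) j)
        exact (hmul (hmul hc'm h3) hofm).add (hmul (hmul hofm h3) hc'm)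
      exact continuousOn_pi.1 hcont k
    · intro τ hτ
      have hd := hfd τ hτ
      refine hd.congr_deriv ?_
      have hU := hmem τ hτ
      set p : JetSpace := S.ofFrame (c τ) (contrSection (f τ)) with hp
      have hfp : fderiv ℝ S.eqs (c τ) p = f τ := by
        rw [hp, fderiv_ofFrame hnd hU, contr_contrSection]
      -- `B` vanishes on tangent vectors, so it only sees the tangency defect `f τ`, represented by
      -- `p`; this makes the differential equation for `f` linear and closed.
      have h0 : B (c τ) (c' τ) (Matrix.of.symm (σ τ) - p) = 0 := by
        simp only [hB]
        rw [fderiv_fderiv_eq_of_osculating hnd ho hU (htan τ hτ) (by rw [map_sub, hfp]; simp [hf]),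
          sub_self]
      have h1 := hBadd (c τ) (c' τ) (Matrix.of.symm (σ τ) - p) p
      rw [sub_add_cancel, h0, zero_add] at h1
      have hpe : p = f τ 0 • S.ofFrame (c τ) (contrSection (Pi.single 0 1))
          + f τ 1 • S.ofFrame (c τ) (contrSection (Pi.single 1 1)) := by
        have : f τ = f τ 0 • Pi.single 0 1 + f τ 1 • Pi.single 1 1 := by
          ext k; fin_cases k <;> simp
        rw [hp]
        nth_rewrite 1 [this]
        rw [map_add, map_smul, map_smul]
        simp only [ofFrame, Matrix.add_mul, Matrix.smul_mul]
        rfl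
      rw [h1, hpe, hBadd, hBsmul, hBsmul]
      ext k
      simp only [hA, Matrix.mulVec, dotProduct, Fin.sum_univ_two, Matrix.of_apply, Pi.add_apply,
        Pi.smul_apply, smul_eq_mul]
      ring
    · simp only [hf, hσ, modelDen, sub_self, Matrix.of_zero, Matrix.zero_mul, Matrix.mul_zero,
        sub_zero, Matrix.one_mul, Matrix.mul_one]
      rw [fderiv_eqs_apply (hmem 0 (by simp)).1, Equiv.apply_symm_apply, hs]
  rw [hf] at hz
  simp only at hz
  rwa [fderiv_eqs_apply (hmem τ hτ).1, Equiv.apply_symm_apply] at hz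

theorem ModelCompat.isUnit_den {U₁ U₂ : JetSpace} (h : S.ModelCompat U₁ U₂) :
    IsUnit (S.modelDen U₁ U₂).det :=
  Matrix.isUnit_det_of_right_inverse (den_mul_one_add h.den_mul)

theorem ModelCompat.modelMap_eq {U₁ U₂ : JetSpace} (h : S.ModelCompat U₁ U₂) :
    S.modelMap U₁ U₂ = Matrix.of (U₂ - U₁) * (1 + S.osc U₂ * Matrix.of (U₂ - U₁)) := by
  have h1 : (S.modelDen U₁ U₂)⁻¹ = 1 + S.osc U₂ * Matrix.of (U₂ - U₁) :=
    Matrix.inv_eq_right_inv (den_mul_one_add h.den_mul)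
  rw [modelMap, h1]

theorem ModelCompat.contr_of_mul (hnd : S.Nondegenerate) {U₁ U₂ : JetSpace} (h₁ : U₁ ∈ S.locus)
    (h₂ : U₂ ∈ S.locus) (h : S.ModelCompat U₁ U₂) {s : Matrix (Fin 2) (Fin 4) ℝ}
    (hs : contr ((1 - Matrix.of (U₂ - U₁) * S.osc U₁) * s * S.modelDen U₁ U₂ * S.frame U₂) = 0) :
    contr (s * S.frame U₁) = 0 :=
  contr_eq_zero_of_mul_mul (Matrix.isUnit_det_of_left_inverse (one_add_mul_one_sub h.den_mul))
    h.isUnit_den (isUnit_frame hnd h₁) (isUnit_frame hnd h₂) h.tangent hs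

/-- In the flattening coordinates the curve is `W (1 + C W)` and has velocity `(1 + W C) c' (1 + C
W)`. By compatibility this velocity satisfies the linear equations of the starting point, so the
curve never leaves them. -/
theorem mem_modelSet_of_curve (hnd : S.Nondegenerate) (ho : S.Osculating)
    (hc : ∀ τ ∈ Set.Icc (0 : ℝ) 1, HasDerivAt c (c' τ) τ)
    (hcc : ContinuousOn c' (Set.Icc 0 1)) (hmem : ∀ τ ∈ Set.Icc (0 : ℝ) 1, c τ ∈ S.locus)
    (htan : ∀ τ ∈ Set.Icc (0 : ℝ) 1, fderiv ℝ S.eqs (c τ) (c' τ) = 0) :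
    ∀ τ ∈ Set.Icc (0 : ℝ) 1, c τ ∈ S.modelSet (c 0) := by
  have hcomp := modelCompat_of_curve hnd ho hc hcc hmem htan
  intro τ hτ
  refine ⟨(hcomp τ hτ).isUnit_den, ?_⟩
  rw [(hcomp τ hτ).modelMap_eq]
  refine eq_zero_of_hasDerivAt_mulVec (f := fun τ => contr (Matrix.of (c τ - c 0)
    * (1 + S.osc (c τ) * Matrix.of (c τ - c 0)) * S.frame (c 0))) (A := fun _ => 0)
    (fun _ _ => continuousOn_const) ?_ (by simp) τ hτ
  intro τ hτ
  have dW : HasDerivAt (fun τ => Matrix.of (c τ - c 0)) (Matrix.of (c' τ)) τ :=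
    (hc τ hτ).sub_const (c 0)
  have dC := hasDerivAt_osc hnd (hc τ hτ) (hmem τ hτ)
  rw [oscDeriv_eq hnd ho (hmem τ hτ) (htan τ hτ)] at dC
  have d1 := (dW.matrix_mul ((dC.matrix_mul dW).const_add 1)).matrix_mul
    (hasDerivAt_const τ (S.frame (c 0)))
  have d2 := (LinearMap.toContinuousLinearMap contr).hasFDerivAt.comp_hasDerivAt τ d1
  refine d2.congr_deriv ?_
  rw [Matrix.zero_mulVec, Matrix.mul_zero, add_zero]
  refine (hcomp τ hτ).contr_of_mul hnd (hmem 0 (by simp)) (hmem τ hτ) ?_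
  rw [← htan τ hτ, fderiv_eqs_apply (hmem τ hτ).1]
  congr 2
  have h := (hcomp τ hτ).den_mul
  have e1 := mul_eq_one_comm.1 (one_add_mul_one_sub h)
  have e2 := mul_eq_one_comm.1 (den_mul_one_add h)
  set W := Matrix.of (c τ - c 0)
  set C := S.osc (c τ)
  have e3 : Matrix.of (c' τ) * (1 + C * W) + W * (C * Matrix.of (c' τ) * C * W
      + C * Matrix.of (c' τ)) = (1 + W * C) * Matrix.of (c' τ) * (1 + C * W) := by
    simp only [Matrix.mul_add, Matrix.add_mul, Matrix.one_mul, Matrix.mul_one, Matrix.mul_assoc]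
    abel
  have e4 : (1 - W * S.osc (c 0)) * ((1 + W * C) * Matrix.of (c' τ) * (1 + C * W))
      * (1 - S.osc (c 0) * W) = ((1 - W * S.osc (c 0)) * (1 + W * C)) * Matrix.of (c' τ)
      * ((1 + C * W) * (1 - S.osc (c 0) * W)) := by simp only [Matrix.mul_assoc]
  rw [e3]
  refine e4.trans ?_
  rw [e1, Matrix.one_mul]
  exact (congrArg (Matrix.of (c' τ) * ·) e2).trans (Matrix.mul_one _)

end Curve

end Model

end FirstOrderSystem

/-! ### From second-order contact to a linearising projective map -/

namespace FirstOrderSystem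

variable {S : FirstOrderSystem}

theorem map_nhds_eq_of_hasStrictFDerivAt_id {ψ : JetSpace → JetSpace}
    (h : HasStrictFDerivAt ψ (ContinuousLinearMap.id ℝ JetSpace) 0) :
    Filter.map ψ (𝓝 0) = 𝓝 (ψ 0) :=
  h.map_nhds_eq_of_equiv (f' := ContinuousLinearEquiv.refl ℝ JetSpace)

/-- In a straightening chart the locus is a linear subspace, so the image of the segment from `0` to
`z` is a curve in the locus to which the transport lemmas apply. -/
theorem compat_and_mem_modelSet_of_chart (hnd : S.Nondegenerate) (ho : S.Osculating)
    {U : JetSpace} {ψ : JetSpace → JetSpace} {r : ℝ}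
    (hψ : ContDiffOn ℝ ∞ ψ (Metric.ball 0 r)) (h0 : ψ 0 = U)
    (h : ∀ z ∈ Metric.ball 0 r, ψ z ∈ S.dom ∧ S.eqs (ψ z) = fderiv ℝ S.eqs U z)
    {z : JetSpace} (hz : z ∈ Metric.ball 0 r) (hUz : fderiv ℝ S.eqs U z = 0) :
    S.ModelCompat U (ψ z) ∧ ψ z ∈ S.modelSet U := by
  have hball : ∀ τ ∈ Set.Icc (0 : ℝ) 1, τ • z ∈ Metric.ball (0 : JetSpace) r := by
    intro τ hτ
    rw [mem_ball_zero_iff] at hz ⊢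
    rw [norm_smul, Real.norm_of_nonneg hτ.1]
    exact (mul_le_of_le_one_left (norm_nonneg _) hτ.2).trans_lt hz
  have hray : ∀ τ : ℝ, HasDerivAt (fun s : ℝ => s • z) z τ := fun τ => by
    simpa using (hasDerivAt_id τ).smul_const z
  have hc : ∀ τ ∈ Set.Icc (0 : ℝ) 1, HasDerivAt (fun s : ℝ => ψ (s • z))
      (fderiv ℝ ψ (τ • z) z) τ := fun τ hτ =>
    (((hψ.contDiffAt (Metric.isOpen_ball.mem_nhds (hball τ hτ))).differentiableAt
      (by simp)).hasFDerivAt).comp_hasDerivAt τ (hray τ)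
  have hcc : ContinuousOn (fun τ : ℝ => fderiv ℝ ψ (τ • z) z) (Set.Icc 0 1) := by
    have h1 := hψ.continuousOn_fderiv_of_isOpen Metric.isOpen_ball (by simp)
    exact (h1.comp (t := Metric.ball 0 r) (by fun_prop) hball).clm_apply continuousOn_const
  have hmem : ∀ τ ∈ Set.Icc (0 : ℝ) 1, ψ (τ • z) ∈ S.locus := fun τ hτ =>
    S.mem_locus_iff.2 ⟨(h _ (hball τ hτ)).1, by rw [(h _ (hball τ hτ)).2, map_smul, hUz, smul_zero]⟩
  have htan : ∀ τ ∈ Set.Icc (0 : ℝ) 1,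
      fderiv ℝ S.eqs (ψ (τ • z)) (fderiv ℝ ψ (τ • z) z) = 0 := by
    intro τ hτ
    have h1 := (hasFDerivAt_eqs (hmem τ hτ).1).comp_hasDerivAt τ (hc τ hτ)
    have h2 : HasDerivAt (S.eqs ∘ fun s : ℝ => ψ (s • z)) 0 τ := by
      refine (hasDerivAt_const τ (0 : Fin 2 → ℝ)).congr_of_eventuallyEq ?_
      have : ∀ᶠ s : ℝ in 𝓝 τ, s • z ∈ Metric.ball (0 : JetSpace) r :=
        (hray τ).continuousAt.eventually (Metric.isOpen_ball.mem_nhds (hball τ hτ))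
      filter_upwards [this] with s hs
      simp only [Function.comp]
      rw [(h _ hs).2, map_smul, hUz, smul_zero]
    exact h1.unique h2
  have e0 : ψ ((0 : ℝ) • z) = U := by rw [zero_smul, h0]
  have e1 : ψ ((1 : ℝ) • z) = ψ z := by rw [one_smul]
  have k1 := modelCompat_of_curve hnd ho hc hcc hmem htan 1 (by simp)
  have k2 := mem_modelSet_of_curve hnd ho hc hcc hmem htan 1 (by simp)
  simp only [e0, e1] at k1 k2
  exact ⟨k1, k2⟩

section

attribute [local instance] Matrix.normedAddCommGroup Matrix.normedSpace

theorem hasStrictFDerivAt_modelMap {U : JetSpace} (hU : U ∈ S.dom) :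
    HasStrictFDerivAt (fun U' => contr (S.modelMap U U' * S.frame U)) (fderiv ℝ S.eqs U) U := by
  have hW : ∀ a i, ContDiffAt ℝ ∞ (fun U' : JetSpace => Matrix.of (U' - U) a i) U := by
    intro a i
    exact ContDiff.contDiffAt (by simp only [Matrix.of_apply, Pi.sub_apply]; fun_prop)
  have hden : ∀ i j, ContDiffAt ℝ ∞ (fun U' : JetSpace => (S.modelDen U U')⁻¹ i j) U := by
    refine ContDiffAt.matrix_inv (fun i j => ?_) (by simp [modelDen])
    exact contDiffAt_const.sub (ContDiffAt.matrix_mul (A := fun _ => S.osc U)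
      (fun _ _ => contDiffAt_const) hW i j)
  have hent := ContDiffAt.matrix_mul (ContDiffAt.matrix_mul hW hden) (B := fun _ => S.frame U)
      (fun _ _ => contDiffAt_const)
  have hcd : ContDiffAt ℝ ∞ (fun U' => contr (S.modelMap U U' * S.frame U)) U := by
    refine contDiffAt_pi.2 fun k => ?_
    fin_cases k
    · exact (hent 0 0).add (hent 1 1)
    · exact (hent 0 2).add (hent 1 3)
  have hfd := (hcd.differentiableAt (by simp)).hasFDerivAt
  refine hcd.hasStrictFDerivAt' (hfd.congr_fderiv ?_) (by simp)
  ext1 t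
  have hline : HasDerivAt (fun s : ℝ => U + s • t) t 0 := by
    simpa using ((hasDerivAt_id (0 : ℝ)).smul_const t).const_add U
  have e0 : U = U + (0 : ℝ) • t := by simp
  have h1 := hfd.comp_hasDerivAt_of_eq (0 : ℝ) hline e0
  have hW' : HasDerivAt (fun s : ℝ => Matrix.of (U + s • t - U)) (Matrix.of t) 0 :=
    hline.sub_const U
  have hN : HasDerivAt (fun s : ℝ => (S.modelDen U (U + s • t))⁻¹)
      (Matrix.of fun i j => fderiv ℝ (fun U' => (S.modelDen U U')⁻¹ i j) U t) 0 := by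
    refine hasDerivAt_pi.2 fun i => hasDerivAt_pi.2 fun j => ?_
    exact (((hden i j).differentiableAt (by simp)).hasFDerivAt).comp_hasDerivAt_of_eq (0 : ℝ)
      hline e0
  have h2 := (LinearMap.toContinuousLinearMap contr).hasFDerivAt.comp_hasDerivAt (0 : ℝ)
    ((hW'.matrix_mul hN).matrix_mul (hasDerivAt_const (0 : ℝ) (S.frame U)))
  rw [h1.unique h2, fderiv_eqs_apply hU]
  simp only [zero_smul, add_zero, sub_self, Matrix.of_zero, Matrix.zero_mul, Matrix.mul_zero,
    modelDen, sub_zero, inv_one, Matrix.mul_one]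
  rfl

end

/-- Near a point of the locus, the locus is the osculating system. -/
theorem eventually_mem_locus_iff (hnd : S.Nondegenerate) (ho : S.Osculating) {U : JetSpace}
    (hU : U ∈ S.locus) : ∀ᶠ U' in 𝓝 U, (U' ∈ S.locus ↔ U' ∈ S.modelSet U) ∧
      (U' ∈ S.locus → S.ModelCompat U U') := by
  obtain ⟨ψ, r, hr, hψ, h0, hd, h⟩ := exists_chart hnd hU
  have hmap := map_nhds_eq_of_hasStrictFDerivAt_id hd
  rw [h0] at hmap
  rw [← hmap, Filter.eventually_map]
  set θ := fderiv ℝ S.eqs U with hθ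
  set ρ := S.frameSection U with hρ
  have hθρ : ∀ c, θ (ρ c) = c := fderiv_frameSection hnd hU
  have hΘ : HasStrictFDerivAt (fun z => contr (S.modelMap U (ψ z) * S.frame U)) θ 0 := by
    have h1 : HasStrictFDerivAt (fun U' => contr (S.modelMap U U' * S.frame U)) θ (ψ 0) := by
      rw [h0]; exact hasStrictFDerivAt_modelMap hU.1
    exact h1.comp 0 hd
  -- The constant is chosen so that, after composition with `ρ`, the error is at most half of `‖θ
  -- z‖`.
  have hlip := hΘ.isLittleO.def (c := (1 / 2) / (‖ρ‖ + 1)) (by positivity)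
  have hball : Metric.ball (0 : JetSpace) r ∈ 𝓝 (0 : JetSpace) := Metric.ball_mem_nhds 0 hr
  have hpt : Filter.Tendsto (fun z : JetSpace => (z, z - ρ (θ z))) (𝓝 0) (𝓝 (0, 0)) := by
    have : Continuous fun z : JetSpace => (z, z - ρ (θ z)) := by fun_prop
    have h2 := this.tendsto 0
    simpa using h2
  have hP : Filter.Tendsto (fun z : JetSpace => z - ρ (θ z)) (𝓝 0) (𝓝 0) := by
    have : Continuous fun z : JetSpace => z - ρ (θ z) := by fun_prop
    simpa using this.tendsto 0
  filter_upwards [hpt.eventually hlip, hball, hP.eventually hball] with z hz hzb hPb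
  have hiff : ψ z ∈ S.locus ↔ θ z = 0 := by
    rw [mem_locus_iff, (h z hzb).2]
    exact and_iff_right (h z hzb).1
  refine ⟨⟨fun hzl => (compat_and_mem_modelSet_of_chart hnd ho hψ h0 h hzb (hiff.1 hzl)).2,
    fun hzm => hiff.2 ?_⟩, fun hzl =>
    (compat_and_mem_modelSet_of_chart hnd ho hψ h0 h hzb (hiff.1 hzl)).1⟩
  have hPm := (compat_and_mem_modelSet_of_chart hnd ho hψ h0 h hPb
    (by rw [map_sub, hθρ, sub_self])).2.2
  -- The point `z` and its projection `z - ρ (θ z)` to the straightened locus both satisfy the model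
  -- equations. Strict differentiability therefore bounds `θ z` by half of itself.
  simp only [hPm, hzm.2, sub_sub_cancel, hθρ, sub_zero, zero_sub, norm_neg] at hz
  by_contra hne
  have hpos : 0 < ‖θ z‖ := norm_pos_iff.2 hne
  have h3 : 1 / 2 / (‖ρ‖ + 1) * ‖ρ (θ z)‖ ≤ 1 / 2 * ‖θ z‖ := by
    rw [div_mul_eq_mul_div, div_le_iff₀ (by positivity)]
    have := ρ.le_opNorm (θ z)
    nlinarith
  linarith

/-- The flattenings at the two points differ by the affine map `R ↦ (1 - W₂ C₁)(R - R₂) d`.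
Compatibility says that its linear part matches the two sets of equations, and `R₂` itself solves
the first one. -/
theorem ModelCompat.modelSet_eq (hnd : S.Nondegenerate) {U₁ U₂ : JetSpace} (h₁ : U₁ ∈ S.locus)
    (h₂ : U₂ ∈ S.locus) (h : S.ModelCompat U₁ U₂) (hm : U₂ ∈ S.modelSet U₁) :
    S.modelSet U₁ = S.modelSet U₂ := by
  ext U
  set d := S.modelDen U₁ U₂ with hd
  have hden : d * S.modelDen U₂ U = S.modelDen U₁ U := by
    have e : Matrix.of (U - U₁) = Matrix.of (U - U₂) + Matrix.of (U₂ - U₁) := by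
      rw [Matrix.of_add_of]; simp
    rw [modelDen, Matrix.mul_sub, ← Matrix.mul_assoc, h.den_mul, Matrix.mul_one, modelDen, hd,
      modelDen, e, Matrix.mul_add]
    abel
  have hu : IsUnit (S.modelDen U₁ U).det ↔ IsUnit (S.modelDen U₂ U).det := by
    rw [← hden, Matrix.det_mul, IsUnit.mul_iff]
    exact and_iff_right h.isUnit_den
  refine and_congr_right_iff.2 ?_ |>.trans (and_congr_left fun _ => hu)
  intro hU₁
  have hU₂ := hu.1 hU₁
  have key : (1 - Matrix.of (U₂ - U₁) * S.osc U₁) * (S.modelMap U₁ U - S.modelMap U₁ U₂) * d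
      = S.modelMap U₂ U := by
    have c1 : S.modelMap U₁ U * S.modelDen U₁ U = Matrix.of (U - U₁) := by
      rw [modelMap, Matrix.nonsing_inv_mul_cancel_right _ _ hU₁]
    have c2 : S.modelMap U₁ U₂ * d = Matrix.of (U₂ - U₁) := by
      rw [modelMap, Matrix.nonsing_inv_mul_cancel_right _ _ h.isUnit_den]
    have c3 : S.modelMap U₂ U * S.modelDen U₂ U = Matrix.of (U - U₂) := by
      rw [modelMap, Matrix.nonsing_inv_mul_cancel_right _ _ hU₂]
    set W := Matrix.of (U - U₁) with hW
    set W₂ := Matrix.of (U₂ - U₁) with hW₂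
    have e : Matrix.of (U - U₂) = W - W₂ := by
      rw [hW, hW₂, Matrix.of_sub_of]; simp
    have ha : (1 - W₂ * S.osc U₁) * W₂ = W₂ * d := by
      rw [hd, modelDen, Matrix.sub_mul, Matrix.mul_sub, Matrix.mul_one, Matrix.one_mul,
        Matrix.mul_assoc]
    have k : (1 - W₂ * S.osc U₁) * (S.modelMap U₁ U - S.modelMap U₁ U₂) * d * S.modelDen U₂ U
        = S.modelMap U₂ U * S.modelDen U₂ U := by
      have l : (1 - W₂ * S.osc U₁) * (S.modelMap U₁ U - S.modelMap U₁ U₂) * d * S.modelDen U₂ U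
          = (1 - W₂ * S.osc U₁) * (S.modelMap U₁ U * (d * S.modelDen U₂ U))
            - (1 - W₂ * S.osc U₁) * (S.modelMap U₁ U₂ * d) * S.modelDen U₂ U := by
        simp only [Matrix.mul_sub, Matrix.sub_mul, Matrix.mul_assoc]
      rw [l, hden, c1, c2, c3, ha, Matrix.mul_assoc, hden, e, modelDen, ← hW]
      simp only [Matrix.mul_sub, Matrix.sub_mul, Matrix.mul_assoc, Matrix.mul_one, Matrix.one_mul]
      abel
    have := congrArg (· * (S.modelDen U₂ U)⁻¹) k
    simpa only [Matrix.mul_nonsing_inv_cancel_right _ _ hU₂] using this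
  rw [← key]
  have hsub : contr ((S.modelMap U₁ U - S.modelMap U₁ U₂) * S.frame U₁)
      = contr (S.modelMap U₁ U * S.frame U₁) := by
    rw [Matrix.sub_mul, map_sub, hm.2, sub_zero]
  rw [← hsub]
  exact ⟨fun hs => h.tangent _ hs, fun hs => h.contr_of_mul hnd h₁ h₂ hs⟩

/-- The osculating system is locally constant on the locus, hence constant by connectedness. -/
theorem modelSet_eq_of_mem (hconn : IsConnected S.locus) (hnd : S.Nondegenerate)
    (ho : S.Osculating) {U₁ U₂ : JetSpace} (h₁ : U₁ ∈ S.locus) (h₂ : U₂ ∈ S.locus) :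
    S.modelSet U₁ = S.modelSet U₂ := by
  refine hconn.isPreconnected.induction₂ (fun U₁ U₂ => S.modelSet U₁ = S.modelSet U₂) ?_
    (fun _ _ _ _ _ _ h h' => h.trans h') (fun _ _ _ _ h => h.symm) h₁ h₂
  intro U hU
  rw [eventually_nhdsWithin_iff]
  filter_upwards [eventually_mem_locus_iff hnd ho hU] with V h hV
  exact (h.2 hV).modelSet_eq hnd hU hV (h.1.1 hV)

/-- The element of `SL(6)` that flattens the osculating system at `U`. -/
def flattening (S : FirstOrderSystem) (U : JetSpace) : SL6 :=
  ⟨Matrix.fromBlocks 1 (-Matrix.of U) (-S.osc U) (1 + S.osc U * Matrix.of U), by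
    rw [Matrix.det_fromBlocks_one₁₁, Matrix.neg_mul, Matrix.mul_neg, neg_neg, add_sub_cancel_right,
      Matrix.det_one]⟩

theorem denom_flattening (U U' : JetSpace) : denom (S.flattening U) U' = S.modelDen U U' := by
  rw [denom, flattening, modelDen, Matrix.toBlocks_fromBlocks₂₁, Matrix.toBlocks_fromBlocks₂₂,
    ← Matrix.of_sub_of, Matrix.mul_sub, Matrix.neg_mul]
  abel

theorem act_flattening (U U' : JetSpace) :
    act (S.flattening U) U' = Matrix.of.symm (S.modelMap U U') := by
  rw [act, denom_flattening, flattening, modelMap, Matrix.toBlocks_fromBlocks₁₁,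
    Matrix.toBlocks_fromBlocks₁₂, ← Matrix.of_sub_of, Matrix.one_mul, ← sub_eq_add_neg]

/-- The coefficients of the linear equations with a given frame. -/
def ofColumns (E : Matrix (Fin 4) (Fin 4) ℝ) : Fin 2 → JetSpace :=
  ![![fun i => E i 0, fun i => E i 1], ![fun i => E i 2, fun i => E i 3]]

theorem sum_ofColumns (E : Matrix (Fin 4) (Fin 4) ℝ) (t : JetSpace) (k : Fin 2) :
    ∑ a, ∑ i, ofColumns E k a i * t a i = contr (Matrix.of t * E) k := by
  fin_cases k
  · simp [ofColumns, Matrix.mul_apply, mul_comm]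
  · simp [ofColumns, Matrix.mul_apply, mul_comm]

theorem linearIndependent_ofColumns {E : Matrix (Fin 4) (Fin 4) ℝ} (hE : IsUnit E.det) :
    LinearIndependent ℝ (ofColumns E) := by
  rw [Fintype.linearIndependent_iff]
  intro c hc k
  have h := sum_ofColumns E (Matrix.of.symm (contrSection (Pi.single k 1) * E⁻¹))
  simp only [Equiv.apply_symm_apply, Matrix.nonsing_inv_mul_cancel_right _ _ hE,
    contr_contrSection] at h
  have h1 : ∑ l, c l * (Pi.single k 1 : Fin 2 → ℝ) l = 0 := by
    simp only [← h]
    have h2 : ∀ a i, ∑ l, c l * ofColumns E l a i = 0 := fun a i => by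
      have := congrFun (congrFun hc a) i
      simpa only [Finset.sum_apply, Pi.smul_apply, smul_eq_mul, Pi.zero_apply] using this
    simp only [Finset.mul_sum]
    rw [Finset.sum_comm]
    refine Finset.sum_eq_zero fun a _ => ?_
    rw [Finset.sum_comm]
    refine Finset.sum_eq_zero fun i _ => ?_
    simp only [← mul_assoc]
    rw [← Finset.sum_mul, h2, zero_mul]
  simpa [Pi.single_apply] using h1

theorem Osculating.linearisable (hconn : IsConnected S.locus) (hnd : S.Nondegenerate)
    (ho : S.Osculating) : S.Linearisable := by
  obtain ⟨U₁, h₁⟩ := hconn.nonempty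
  refine ⟨S.flattening U₁, ofColumns (S.frame U₁), 0,
    linearIndependent_ofColumns (isUnit_frame hnd h₁), fun U hU => ?_⟩
  -- Every point lies on its own osculating system, hence on that of `U₁`; this also shows that the
  -- flattening at `U₁` is defined on the whole locus.
  have hself : U ∈ S.modelSet U := by simp [modelSet, modelDen, modelMap]
  have heq := modelSet_eq_of_mem hconn hnd ho h₁ hU
  rw [← heq] at hself
  simp only [denom_flattening, act_flattening]
  refine ⟨hself.1, ?_⟩
  have hcont : Continuous fun U' => (S.modelDen U₁ U').det := by
    refine Continuous.matrix_det ?_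
    refine continuous_const.sub (continuous_const.matrix_mul ?_)
    exact (continuous_id.sub continuous_const : Continuous fun U' : JetSpace => U' - U₁)
  filter_upwards [eventually_mem_locus_iff hnd ho hU,
    hcont.continuousAt.eventually_ne hself.1.ne_zero] with U' h h'
  rw [h.1, ← heq]
  have : ∀ k, ∑ a, ∑ i, ofColumns (S.frame U₁) k a i * Matrix.of.symm (S.modelMap U₁ U') a i
      + (0 : Fin 2 → ℝ) k = contr (S.modelMap U₁ U' * S.frame U₁) k := fun k => by
    rw [sum_ofColumns, Equiv.apply_symm_apply, Pi.zero_apply, add_zero]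
  simp only [linearLocus, Set.mem_ofPred_eq, this, modelSet]
  rw [and_iff_right (isUnit_iff_ne_zero.2 h'), funext_iff]
  rfl

end FirstOrderSystem

/-- Only existence matters: in `symmetry_expansion` this third-order term is applied to a vector
field at one of its zeros. -/
theorem exists_hasDerivAt_fderiv_fderiv {V W : Type*} [NormedAddCommGroup V] [NormedSpace ℝ V]
    [NormedAddCommGroup W] [NormedSpace ℝ W] {f : V → W} {c c' : ℝ → V} {τ : ℝ} {v w : V}
    (hf : ContDiffAt ℝ ∞ f (c τ)) (hc : HasDerivAt c v τ) (hc' : HasDerivAt c' w τ) :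
    ∃ X : V →L[ℝ] W, HasDerivAt (fun τ => fderiv ℝ (fderiv ℝ f) (c τ) (c' τ)) X τ := by
  have h1 : ContDiffAt ℝ ∞ (fderiv ℝ (fderiv ℝ f)) (c τ) :=
    (hf.fderiv_right (m := ∞) (by simp)).fderiv_right (m := ∞) (by simp)
  exact ⟨_, ((h1.differentiableAt (by simp)).hasFDerivAt.comp_hasDerivAt τ hc).clm_apply hc'⟩

/-! ### Derivatives of the exponential, the inverse and the determinant -/

section MatrixExp

variable {n : Type*} [Fintype n] [DecidableEq n]

section

attribute [local instance] Matrix.linftyOpNormedRing Matrix.linftyOpNormedAlgebra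

/-- The exponential is differentiated in a Banach algebra norm. Passing to scalar entries makes the
result independent of the norm, so that the entrywise norm can be used afterwards. -/
theorem Matrix.hasDerivAt_exp_smul_apply (Y : Matrix n n ℝ) (t : ℝ) (i j : n) :
    HasDerivAt (fun s : ℝ => NormedSpace.exp (s • Y) i j)
      ((Y * NormedSpace.exp (t • Y)) i j) t := by
  have h := hasDerivAt_exp_smul_const' (𝕂 := ℝ) Y t
  let e : Matrix n n ℝ →ₗ[ℝ] ℝ := Matrix.entryLinearMap ℝ ℝ i j
  exact (LinearMap.toContinuousLinearMap e).hasFDerivAt.comp_hasDerivAt t h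

end

attribute [local instance] Matrix.normedAddCommGroup Matrix.normedSpace

theorem Matrix.hasDerivAt_exp_smul (Y : Matrix n n ℝ) (t : ℝ) :
    HasDerivAt (fun s : ℝ => NormedSpace.exp (s • Y)) (Y * NormedSpace.exp (t • Y)) t :=
  hasDerivAt_pi.2 fun i => hasDerivAt_pi.2 fun j => hasDerivAt_exp_smul_apply Y t i j

theorem HasDerivAt.matrix_inv {M : ℝ → Matrix n n ℝ} {M' : Matrix n n ℝ} {t : ℝ}
    (hM : HasDerivAt M M' t) (hd : (M t).det ≠ 0) :
    HasDerivAt (fun s => (M s)⁻¹) (-((M t)⁻¹ * M' * (M t)⁻¹)) t := by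
  have hent : ∀ i j, ContDiffAt ℝ 1 (fun N : Matrix n n ℝ => N i j) (M t) := fun i j =>
    (contDiff_apply_apply ℝ ℝ i j).contDiffAt
  have hdet : ContinuousAt (fun N : Matrix n n ℝ => N.det) (M t) :=
    (ContDiffAt.matrix_det hent).continuousAt
  have hex : HasDerivAt (fun s => (M s)⁻¹)
      (Matrix.of fun i j => fderiv ℝ (fun N : Matrix n n ℝ => N⁻¹ i j) (M t) M') t := by
    refine hasDerivAt_pi.2 fun i => hasDerivAt_pi.2 fun j => ?_
    exact (((ContDiffAt.matrix_inv hent hd i j).differentiableAt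
      (by simp)).hasFDerivAt).comp_hasDerivAt t hM
  refine hex.congr_deriv ?_
  have h1 := hM.matrix_mul hex
  have h2 : HasDerivAt (fun s => M s * (M s)⁻¹) 0 t := by
    refine (hasDerivAt_const t (1 : Matrix n n ℝ)).congr_of_eventuallyEq ?_
    have : ∀ᶠ s in 𝓝 t, (M s).det ≠ 0 :=
      (hdet.comp hM.continuousAt).eventually_ne hd
    filter_upwards [this] with s hs
    exact Matrix.mul_nonsing_inv _ (isUnit_iff_ne_zero.2 hs)
  have h3 := h1.unique h2
  have h4 := congrArg ((M t)⁻¹ * ·) h3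
  simp only [Matrix.mul_add, Matrix.mul_zero,
    Matrix.nonsing_inv_mul_cancel_left _ _ (isUnit_iff_ne_zero.2 hd)] at h4
  rw [← Matrix.mul_assoc] at h4
  exact eq_neg_of_add_eq_zero_right h4

theorem Matrix.hasDerivAt_det_of_eq_one {M : ℝ → Matrix n n ℝ} {M' : Matrix n n ℝ} {t : ℝ}
    (hM : HasDerivAt M M' t) (h1 : M t = 1) : HasDerivAt (fun s => (M s).det) M'.trace t := by
  have hent : ∀ i j, ContDiffAt ℝ 1 (fun N : Matrix n n ℝ => N i j) (M t) := fun i j =>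
    (contDiff_apply_apply ℝ ℝ i j).contDiffAt
  have hd := ((ContDiffAt.matrix_det hent).differentiableAt (by simp)).hasFDerivAt
  have hc := hd.comp_hasDerivAt t hM
  refine hc.congr_deriv ?_
  have hline : HasDerivAt (fun s : ℝ => 1 + s • M') M' 0 :=
    (((hasDerivAt_id (0 : ℝ)).smul_const M').const_add 1).congr_deriv (one_smul ℝ M')
  have k1 := hd.comp_hasDerivAt_of_eq (0 : ℝ) hline (by simp [h1])
  refine k1.unique ?_
  -- Both derivatives come from the derivative of the determinant at `1`, so the curve can be
  -- replaced by a line, where the determinant is `1 + s tr M' + O(s²)`.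
  have : ((fun N : Matrix n n ℝ => N.det) ∘ fun s : ℝ => 1 + s • M') = fun s : ℝ =>
      1 + M'.trace * s + (Matrix.det (1 + (Polynomial.X : Polynomial ℝ) •
        M'.map Polynomial.C)).divX.divX.eval s * s ^ 2 := by
    funext s
    exact Matrix.det_one_add_smul s M'
  rw [this]
  have hp := (((Matrix.det (1 + (Polynomial.X : Polynomial ℝ) •
        M'.map Polynomial.C)).divX.divX).hasDerivAt (0 : ℝ)).mul ((hasDerivAt_id (0 : ℝ)).pow 2)
  have := (((hasDerivAt_id (0 : ℝ)).const_mul M'.trace).const_add 1).add hp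
  refine this.congr_deriv ?_
  simp

theorem Matrix.trace_eq_zero_of_det_exp {Y : Matrix n n ℝ}
    (h : ∀ t : ℝ, (NormedSpace.exp (t • Y)).det = 1) : Y.trace = 0 := by
  have h1 := Matrix.hasDerivAt_det_of_eq_one (Matrix.hasDerivAt_exp_smul Y 0)
    (by rw [zero_smul, NormedSpace.exp_zero])
  rw [zero_smul, NormedSpace.exp_zero, Matrix.mul_one] at h1
  simp only [h] at h1
  exact h1.unique (hasDerivAt_const 0 1)

end MatrixExp

/-! ### Infinitesimal symmetries and their Taylor expansion at a zero -/

namespace FirstOrderSystem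

variable {S : FirstOrderSystem}

/-- The algebra `𝔤𝔩(6)` in blocks. -/
abbrev Mat6 : Type := Matrix (Fin 2 ⊕ Fin 4) (Fin 2 ⊕ Fin 4) ℝ

/-- The vector field generated by `Y` on the chart of the Grassmannian. -/
def vectorField (Y : Mat6) (U : JetSpace) : Matrix (Fin 2) (Fin 4) ℝ :=
  Y.toBlocks₁₁ * Matrix.of U + Y.toBlocks₁₂ - Matrix.of U * (Y.toBlocks₂₁ * Matrix.of U
    + Y.toBlocks₂₂)

theorem vectorField_add (Y Z : Mat6) (U : JetSpace) :
    vectorField (Y + Z) U = vectorField Y U + vectorField Z U := by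
  have h11 : (Y + Z).toBlocks₁₁ = Y.toBlocks₁₁ + Z.toBlocks₁₁ := rfl
  have h12 : (Y + Z).toBlocks₁₂ = Y.toBlocks₁₂ + Z.toBlocks₁₂ := rfl
  have h21 : (Y + Z).toBlocks₂₁ = Y.toBlocks₂₁ + Z.toBlocks₂₁ := rfl
  have h22 : (Y + Z).toBlocks₂₂ = Y.toBlocks₂₂ + Z.toBlocks₂₂ := rfl
  simp only [vectorField, h11, h12, h21, h22, Matrix.add_mul, Matrix.mul_add]
  abel

theorem vectorField_smul (r : ℝ) (Y : Mat6) (U : JetSpace) :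
    vectorField (r • Y) U = r • vectorField Y U := by
  have h11 : (r • Y).toBlocks₁₁ = r • Y.toBlocks₁₁ := rfl
  have h12 : (r • Y).toBlocks₁₂ = r • Y.toBlocks₁₂ := rfl
  have h21 : (r • Y).toBlocks₂₁ = r • Y.toBlocks₂₁ := rfl
  have h22 : (r • Y).toBlocks₂₂ = r • Y.toBlocks₂₂ := rfl
  simp only [vectorField, h11, h12, h21, h22, Matrix.smul_mul, Matrix.mul_add, Matrix.mul_smul,
    smul_sub, smul_add]

/-- The trace-free matrices that generate vector fields tangent to the locus. -/
def symmetryAlgebra (S : FirstOrderSystem) : Submodule ℝ Mat6 where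
  carrier := {Y | Y.trace = 0 ∧ ∀ U ∈ S.locus, contr (vectorField Y U * S.frame U) = 0}
  zero_mem' := ⟨Matrix.trace_zero _ _, fun U _ => by
    have := vectorField_smul 0 0 U
    rw [zero_smul, zero_smul] at this
    rw [this, Matrix.zero_mul, map_zero]⟩
  add_mem' := fun {Y Z} hY hZ => ⟨by rw [Matrix.trace_add, hY.1, hZ.1, add_zero], fun U hU => by
    rw [vectorField_add, Matrix.add_mul, map_add, hY.2 U hU, hZ.2 U hU, add_zero]⟩
  smul_mem' := fun r Y hY => ⟨by rw [Matrix.trace_smul, hY.1, smul_zero], fun U hU => by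
    rw [vectorField_smul, Matrix.smul_mul, map_smul, hY.2 U hU, smul_zero]⟩

section

attribute [local instance] Matrix.normedAddCommGroup Matrix.normedSpace

variable {Y : Mat6} {g : ℝ → SL6}

theorem hasDerivAt_denom_exp (hg : ∀ t, (g t).1 = NormedSpace.exp (t • Y)) (U : JetSpace) :
    HasDerivAt (fun s => denom (g s) U) (Y.toBlocks₂₁ * Matrix.of U + Y.toBlocks₂₂) 0 := by
  have hE := Matrix.hasDerivAt_exp_smul Y 0
  rw [zero_smul, NormedSpace.exp_zero, Matrix.mul_one] at hE
  simp only [← hg] at hE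
  have d : ∀ i j, HasDerivAt (fun s => (g s).1 i j) (Y i j) 0 := fun i j =>
    hasDerivAt_pi.1 (hasDerivAt_pi.1 hE i) j
  have d21 : HasDerivAt (fun s => (g s).1.toBlocks₂₁) Y.toBlocks₂₁ 0 :=
    hasDerivAt_pi.2 fun i => hasDerivAt_pi.2 fun j => d _ _
  have d22 : HasDerivAt (fun s => (g s).1.toBlocks₂₂) Y.toBlocks₂₂ 0 :=
    hasDerivAt_pi.2 fun i => hasDerivAt_pi.2 fun j => d _ _
  refine ((d21.matrix_mul (hasDerivAt_const (0 : ℝ) (Matrix.of U))).add d22).congr_deriv ?_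
  rw [Matrix.mul_zero, add_zero]

theorem denom_exp_zero (hg : ∀ t, (g t).1 = NormedSpace.exp (t • Y)) (U : JetSpace) :
    denom (g 0) U = 1 := by
  have hg0 : (g 0).1 = 1 := by rw [hg, zero_smul, NormedSpace.exp_zero]
  rw [denom, hg0, ← Matrix.fromBlocks_one, Matrix.toBlocks_fromBlocks₂₁,
    Matrix.toBlocks_fromBlocks₂₂, Matrix.zero_mul, zero_add]

theorem act_exp_zero (hg : ∀ t, (g t).1 = NormedSpace.exp (t • Y)) (U : JetSpace) :
    act (g 0) U = U := by
  have hg0 : (g 0).1 = 1 := by rw [hg, zero_smul, NormedSpace.exp_zero]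
  rw [act, denom_exp_zero hg, hg0, ← Matrix.fromBlocks_one, Matrix.toBlocks_fromBlocks₁₁,
    Matrix.toBlocks_fromBlocks₁₂, inv_one, Matrix.mul_one, Matrix.one_mul, add_zero]
  rfl

theorem continuousAt_det_denom_exp (hg : ∀ t, (g t).1 = NormedSpace.exp (t • Y)) (U : JetSpace) :
    ContinuousAt (fun s => (denom (g s) U).det) 0 :=
  (Continuous.matrix_det continuous_id).continuousAt.comp (hasDerivAt_denom_exp hg U).continuousAt

theorem hasDerivAt_act_exp (hg : ∀ t, (g t).1 = NormedSpace.exp (t • Y)) (U : JetSpace) :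
    HasDerivAt (fun s => act (g s) U) (Matrix.of.symm (vectorField Y U)) 0 := by
  have hE := Matrix.hasDerivAt_exp_smul Y 0
  rw [zero_smul, NormedSpace.exp_zero, Matrix.mul_one] at hE
  simp only [← hg] at hE
  have hg0 : (g 0).1 = 1 := by rw [hg, zero_smul, NormedSpace.exp_zero]
  have d : ∀ i j, HasDerivAt (fun s => (g s).1 i j) (Y i j) 0 := fun i j =>
    hasDerivAt_pi.1 (hasDerivAt_pi.1 hE i) j
  have d11 : HasDerivAt (fun s => (g s).1.toBlocks₁₁) Y.toBlocks₁₁ 0 :=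
    hasDerivAt_pi.2 fun i => hasDerivAt_pi.2 fun j => d _ _
  have d12 : HasDerivAt (fun s => (g s).1.toBlocks₁₂) Y.toBlocks₁₂ 0 :=
    hasDerivAt_pi.2 fun i => hasDerivAt_pi.2 fun j => d _ _
  have z11 : (g 0).1.toBlocks₁₁ = 1 := by
    rw [hg0, ← Matrix.fromBlocks_one, Matrix.toBlocks_fromBlocks₁₁]
  have z12 : (g 0).1.toBlocks₁₂ = 0 := by
    rw [hg0, ← Matrix.fromBlocks_one, Matrix.toBlocks_fromBlocks₁₂]
  have z0 := denom_exp_zero hg U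
  have hinv := (hasDerivAt_denom_exp hg U).matrix_inv
    (by rw [z0, Matrix.det_one]; exact one_ne_zero)
  have h1 := ((d11.matrix_mul (hasDerivAt_const (0 : ℝ) (Matrix.of U))).add d12).matrix_mul hinv
  refine HasDerivAt.congr_deriv (f := fun s => act (g s) U) h1 ?_
  simp only [z0, z11, z12, inv_one, Matrix.mul_one, Matrix.one_mul, Matrix.mul_zero, add_zero,
    Pi.add_apply]
  rw [vectorField, sub_eq_add_neg, Matrix.mul_neg]
  rfl

/-- Differentiating the orbit of a point of the locus at `t = 0` gives tangency, and differentiating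
the determinant gives trace zero. Both conditions are linear, so they pass to the span. -/
theorem span_lieAlgebraSet_le {G : Subgroup SL6} (hG : S.InvariantUnder G) :
    Submodule.span ℝ (lieAlgebraSet G) ≤ S.symmetryAlgebra := by
  refine Submodule.span_le.2 fun Y hY => ⟨Matrix.trace_eq_zero_of_det_exp fun t => ?_,
    fun U hU => ?_⟩
  · obtain ⟨g, -, hg⟩ := hY t
    rw [← hg]
    exact g.2
  choose g hgG hg using hY
  have hev := (hG Y (fun t => ⟨g t, hgG t, hg t⟩) U hU)
  have k1 : HasDerivAt (fun s => S.eqs (act (g s) U)) _ 0 :=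
    (hasFDerivAt_eqs hU.1).comp_hasDerivAt_of_eq (0 : ℝ) (hasDerivAt_act_exp hg U)
      (act_exp_zero hg U).symm
  have k2 : HasDerivAt (fun s => S.eqs (act (g s) U)) 0 0 := by
    refine (hasDerivAt_const (0 : ℝ) (0 : Fin 2 → ℝ)).congr_of_eventuallyEq ?_
    filter_upwards [hev] with s hs
    exact (S.mem_locus_iff.1 (hs (g s) (hg s)).2).2
  have k3 := k1.unique k2
  rwa [fderiv_eqs_apply hU.1, Equiv.apply_symm_apply] at k3

theorem vectorField_eq (Y : Mat6) (o U : JetSpace) :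
    vectorField Y U = vectorField Y o + (Y.toBlocks₁₁ - Matrix.of o * Y.toBlocks₂₁)
      * Matrix.of (U - o) - Matrix.of (U - o) * (Y.toBlocks₂₁ * Matrix.of o + Y.toBlocks₂₂)
      - Matrix.of (U - o) * Y.toBlocks₂₁ * Matrix.of (U - o) := by
  simp only [vectorField, ← Matrix.of_sub_of, Matrix.mul_sub, Matrix.sub_mul, Matrix.mul_add,
    Matrix.mul_assoc]
  abel

set_option maxHeartbeats 1000000 in
/-- The linear and the quadratic part of tangency at a zero of the vector field. -/
theorem symmetry_expansion (hnd : S.Nondegenerate) {o : JetSpace} (ho : o ∈ S.locus) {Y : Mat6}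
    (hY : Y ∈ S.symmetryAlgebra) (h0 : vectorField Y o = 0) {A : Matrix (Fin 2) (Fin 2) ℝ}
    (hA : A = Y.toBlocks₁₁ - Matrix.of o * Y.toBlocks₂₁) {D : Matrix (Fin 4) (Fin 4) ℝ}
    (hD : D = Y.toBlocks₂₁ * Matrix.of o + Y.toBlocks₂₂) {t : JetSpace}
    (ht : fderiv ℝ S.eqs o t = 0) :
    fderiv ℝ S.eqs o (Matrix.of.symm (A * Matrix.of t - Matrix.of t * D)) = 0 ∧
    ∃ w : JetSpace, fderiv ℝ S.eqs o w = -fderiv ℝ (fderiv ℝ S.eqs) o t t ∧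
      (2 : ℝ) • fderiv ℝ (fderiv ℝ S.eqs) o t (Matrix.of.symm (A * Matrix.of t - Matrix.of t * D))
        + fderiv ℝ S.eqs o (Matrix.of.symm (A * Matrix.of w - Matrix.of w * D
          - (2 : ℝ) • (Matrix.of t * Y.toBlocks₂₁ * Matrix.of t))) = 0 := by
  obtain ⟨ψ, r, hr, hψ, hψ0, hd, h⟩ := exists_chart hnd ho
  set C := Y.toBlocks₂₁ with hC
  have hray : ∀ τ : ℝ, HasDerivAt (fun s : ℝ => s • t) t τ := fun τ => by
    simpa using (hasDerivAt_id τ).smul_const t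
  have hb : ∀ᶠ τ : ℝ in 𝓝 0, τ • t ∈ Metric.ball (0 : JetSpace) r :=
    (hray 0).continuousAt.eventually (Metric.isOpen_ball.mem_nhds (by simpa using hr))
  set c : ℝ → JetSpace := fun τ => ψ (τ • t) with hc
  set c' : ℝ → JetSpace := fun τ => fderiv ℝ ψ (τ • t) t with hc'
  have hc0 : c 0 = o := by simp [hc, hψ0]
  have hc'0 : c' 0 = t := by simp [hc', hd.hasFDerivAt.fderiv]
  have hcd : ∀ᶠ τ : ℝ in 𝓝 0, HasDerivAt c (c' τ) τ := by
    filter_upwards [hb] with τ hτ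
    exact (((hψ.contDiffAt (Metric.isOpen_ball.mem_nhds hτ)).differentiableAt
      (by simp)).hasFDerivAt).comp_hasDerivAt τ (hray τ)
  have hcl : ∀ᶠ τ : ℝ in 𝓝 0, c τ ∈ S.locus := by
    filter_upwards [hb] with τ hτ
    exact S.mem_locus_iff.2 ⟨(h _ hτ).1, by rw [(h _ hτ).2, map_smul, ht, smul_zero]⟩
  have hψ2 : HasFDerivAt (fderiv ℝ ψ) (fderiv ℝ (fderiv ℝ ψ) 0) 0 :=
    (((hψ.contDiffAt (Metric.ball_mem_nhds 0 hr)).fderiv_right (m := ∞)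
      (by simp)).differentiableAt (by simp)).hasFDerivAt
  set w : JetSpace := fderiv ℝ (fderiv ℝ ψ) 0 t t with hw
  have hc'd : HasDerivAt c' w 0 := by
    have := (hψ2.comp_hasDerivAt_of_eq (0 : ℝ) (hray 0) (by simp)).clm_apply
      (hasDerivAt_const (0 : ℝ) t)
    refine this.congr_deriv ?_
    simp [hw]
  have hθ : ∀ {τ : ℝ}, c τ ∈ S.locus → HasDerivAt c (c' τ) τ →
      HasDerivAt (fun τ => fderiv ℝ S.eqs (c τ)) (fderiv ℝ (fderiv ℝ S.eqs) (c τ) (c' τ)) τ :=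
    fun hm hd => (hasFDerivAt_fderiv_eqs hm.1).comp_hasDerivAt _ hd
  have hzero : ∀ {f f' : ℝ → Fin 2 → ℝ}, (∀ᶠ τ in 𝓝 (0 : ℝ), f τ = 0) →
      (∀ᶠ τ in 𝓝 (0 : ℝ), HasDerivAt f (f' τ) τ) → ∀ᶠ τ in 𝓝 (0 : ℝ), f' τ = 0 := by
    intro f f' h1 h2
    filter_upwards [h1.eventually_nhds, h2] with τ k1 k2
    exact k2.unique ((hasDerivAt_const τ (0 : Fin 2 → ℝ)).congr_of_eventuallyEq k1)
  have hdl : ∀ᶠ τ : ℝ in 𝓝 0, fderiv ℝ S.eqs (c τ) (c' τ) = 0 := by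
    refine hzero (f := fun τ => S.eqs (c τ)) ?_ ?_
    · filter_upwards [hcl] with τ hτ using (S.mem_locus_iff.1 hτ).2
    · filter_upwards [hcl, hcd] with τ h1 h2 using (hasFDerivAt_eqs h1.1).comp_hasDerivAt τ h2
  have hw2 : fderiv ℝ S.eqs o w = -fderiv ℝ (fderiv ℝ S.eqs) o t t := by
    have h1 := (hθ hcl.self_of_nhds hcd.self_of_nhds).clm_apply hc'd
    have h2 := h1.unique ((hasDerivAt_const (0 : ℝ) (0 : Fin 2 → ℝ)).congr_of_eventuallyEq hdl)
    rw [hc0, hc'0, add_comm] at h2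
    exact eq_neg_of_add_eq_zero_left h2
  -- The vector field along a curve in the locus. Since it vanishes at `o`, it is the sum of its
  -- linear and quadratic parts there.
  set k : ℝ → JetSpace := fun τ => Matrix.of.symm (A * Matrix.of (c τ - o)
    - Matrix.of (c τ - o) * D - Matrix.of (c τ - o) * C * Matrix.of (c τ - o)) with hk
  set k' : ℝ → JetSpace := fun τ => Matrix.of.symm (A * Matrix.of (c' τ) - Matrix.of (c' τ) * D
    - (Matrix.of (c' τ) * C * Matrix.of (c τ - o) + Matrix.of (c τ - o) * C * Matrix.of (c' τ)))
    with hk'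
  have dW : ∀ {τ : ℝ}, HasDerivAt c (c' τ) τ →
      HasDerivAt (fun τ => Matrix.of (c τ - o)) (Matrix.of (c' τ)) τ := fun hd => hd.sub_const o
  have hkd : ∀ {τ : ℝ}, HasDerivAt c (c' τ) τ → HasDerivAt k (k' τ) τ := by
    intro τ hd
    have h1 := (((hasDerivAt_const τ A).matrix_mul (dW hd)).sub
      ((dW hd).matrix_mul (hasDerivAt_const τ D))).sub
      (((dW hd).matrix_mul (hasDerivAt_const τ C)).matrix_mul (dW hd))
    refine HasDerivAt.congr_deriv (f := k) h1 ?_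
    simp only [hk', Matrix.zero_mul, Matrix.mul_zero, zero_add, add_zero]
    rfl
  have hk'd : HasDerivAt k' (Matrix.of.symm (A * Matrix.of w - Matrix.of w * D
      - (2 : ℝ) • (Matrix.of t * C * Matrix.of t))) 0 := by
    have dc' : HasDerivAt (fun τ => Matrix.of (c' τ)) (Matrix.of w) 0 := hc'd
    have dw := dW hcd.self_of_nhds
    have h1 := (((hasDerivAt_const (0 : ℝ) A).matrix_mul dc').sub
      (dc'.matrix_mul (hasDerivAt_const (0 : ℝ) D))).sub
      (((dc'.matrix_mul (hasDerivAt_const (0 : ℝ) C)).matrix_mul dw).add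
      ((dw.matrix_mul (hasDerivAt_const (0 : ℝ) C)).matrix_mul dc'))
    refine HasDerivAt.congr_deriv (f := k') h1 ?_
    simp only [hc0, hc'0, sub_self, Matrix.of_zero, Matrix.zero_mul, Matrix.mul_zero, zero_add,
      add_zero, two_smul]
    rfl
  have hkt : ∀ᶠ τ : ℝ in 𝓝 0, fderiv ℝ S.eqs (c τ) (k τ) = 0 := by
    filter_upwards [hcl] with τ hτ
    have := hY.2 _ hτ
    rw [vectorField_eq Y o, h0, zero_add, ← hA, ← hD] at this
    rw [fderiv_eqs_apply hτ.1, hk]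
    exact this
  have hkt' : ∀ᶠ τ : ℝ in 𝓝 0, fderiv ℝ (fderiv ℝ S.eqs) (c τ) (c' τ) (k τ)
      + fderiv ℝ S.eqs (c τ) (k' τ) = 0 := by
    refine hzero hkt ?_
    filter_upwards [hcl, hcd] with τ h1 h2 using (hθ h1 h2).clm_apply (hkd h2)
  have hk0 : k 0 = 0 := by
    simp only [hk, hc0, sub_self, Matrix.of_zero, Matrix.zero_mul, Matrix.mul_zero]
    rfl
  have hk'0 : k' 0 = Matrix.of.symm (A * Matrix.of t - Matrix.of t * D) := by
    simp only [hk', hc0, hc'0, sub_self, Matrix.of_zero, Matrix.zero_mul, Matrix.mul_zero,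
      add_zero, sub_zero]
  refine ⟨?_, w, hw2, ?_⟩
  · have := hkt'.self_of_nhds
    rwa [hk0, map_zero, zero_add, hc0, hk'0] at this
  -- The second derivative of the tangency condition: `X` acts on `k 0 = 0` and disappears, and the
  -- mixed term occurs twice.
  · obtain ⟨X, hD2⟩ := exists_hasDerivAt_fderiv_fderiv (f := S.eqs)
      (by rw [hc0]; exact contDiffAt_eqs ho.1) hcd.self_of_nhds hc'd
    have h1 := (hD2.clm_apply (hkd hcd.self_of_nhds)).add
      ((hθ hcl.self_of_nhds hcd.self_of_nhds).clm_apply hk'd)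
    have h2 := h1.unique ((hasDerivAt_const (0 : ℝ) (0 : Fin 2 → ℝ)).congr_of_eventuallyEq hkt')
    rw [hk0, map_zero, zero_add, hc0, hc'0, hk'0, ← add_assoc, ← two_smul ℝ] at h2
    exact h2

end

end FirstOrderSystem

/-! ### The bound 13 and what equality implies -/

namespace FirstOrderSystem

variable {S : FirstOrderSystem}

/-- The value of the vector field at `o`, in the frame of the system. -/
def valueAt (S : FirstOrderSystem) (o : JetSpace) : Mat6 →ₗ[ℝ] Matrix (Fin 2) (Fin 4) ℝ where
  toFun Y := vectorField Y o * S.frame o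
  map_add' Y Z := by rw [vectorField_add, Matrix.add_mul]
  map_smul' r Y := by rw [vectorField_smul, Matrix.smul_mul]; rfl

/-- The left linear part of the vector field at `o`. -/
def leftPart (o : JetSpace) : Mat6 →ₗ[ℝ] Matrix (Fin 2) (Fin 2) ℝ where
  toFun Y := Y.toBlocks₁₁ - Matrix.of o * Y.toBlocks₂₁
  map_add' Y Z := by
    have h11 : (Y + Z).toBlocks₁₁ = Y.toBlocks₁₁ + Z.toBlocks₁₁ := rfl
    have h21 : (Y + Z).toBlocks₂₁ = Y.toBlocks₂₁ + Z.toBlocks₂₁ := rfl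
    rw [h11, h21, Matrix.mul_add]
    abel
  map_smul' r Y := by
    have h11 : (r • Y).toBlocks₁₁ = r • Y.toBlocks₁₁ := rfl
    have h21 : (r • Y).toBlocks₂₁ = r • Y.toBlocks₂₁ := rfl
    rw [h11, h21, Matrix.mul_smul, smul_sub]
    rfl

/-- The right linear part of the vector field at `o`, in the frame of the system. -/
def rightPart (S : FirstOrderSystem) (o : JetSpace) : Mat6 →ₗ[ℝ] Matrix (Fin 4) (Fin 4) ℝ where
  toFun Y := (S.frame o)⁻¹ * (Y.toBlocks₂₁ * Matrix.of o + Y.toBlocks₂₂) * S.frame o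
  map_add' Y Z := by
    have h21 : (Y + Z).toBlocks₂₁ = Y.toBlocks₂₁ + Z.toBlocks₂₁ := rfl
    have h22 : (Y + Z).toBlocks₂₂ = Y.toBlocks₂₂ + Z.toBlocks₂₂ := rfl
    simp only [h21, h22, Matrix.add_mul, Matrix.mul_add]
    abel
  map_smul' r Y := by
    have h21 : (r • Y).toBlocks₂₁ = r • Y.toBlocks₂₁ := rfl
    have h22 : (r • Y).toBlocks₂₂ = r • Y.toBlocks₂₂ := rfl
    simp only [h21, h22, Matrix.smul_mul, Matrix.mul_smul, ← smul_add, RingHom.id_apply]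

/-- Thirteen coordinates on the symmetry algebra. -/
def symmetryCoords (S : FirstOrderSystem) (o : JetSpace) : S.symmetryAlgebra →ₗ[ℝ] (Fin 13 → ℝ) :=
  LinearMap.comp (LinearMap.pi
    ![Matrix.entryLinearMap ℝ ℝ 0 0 ∘ₗ S.valueAt o, Matrix.entryLinearMap ℝ ℝ 0 1 ∘ₗ S.valueAt o,
      Matrix.entryLinearMap ℝ ℝ 1 0 ∘ₗ S.valueAt o, Matrix.entryLinearMap ℝ ℝ 0 2 ∘ₗ S.valueAt o,
      Matrix.entryLinearMap ℝ ℝ 0 3 ∘ₗ S.valueAt o, Matrix.entryLinearMap ℝ ℝ 1 2 ∘ₗ S.valueAt o,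
      Matrix.entryLinearMap ℝ ℝ 0 0 ∘ₗ leftPart o, Matrix.entryLinearMap ℝ ℝ 0 1 ∘ₗ leftPart o,
      Matrix.entryLinearMap ℝ ℝ 1 0 ∘ₗ leftPart o, Matrix.entryLinearMap ℝ ℝ 1 1 ∘ₗ leftPart o,
      Matrix.entryLinearMap ℝ ℝ 0 0 ∘ₗ S.rightPart o,
      Matrix.entryLinearMap ℝ ℝ 0 2 ∘ₗ S.rightPart o,
      Matrix.entryLinearMap ℝ ℝ 2 0 ∘ₗ S.rightPart o]) S.symmetryAlgebra.subtype

theorem vectorField_eq_zero_of_coords (hnd : S.Nondegenerate) {o : JetSpace} (ho : o ∈ S.locus)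
    {Y : Mat6} (hY : Y ∈ S.symmetryAlgebra) (h00 : S.valueAt o Y 0 0 = 0)
    (h01 : S.valueAt o Y 0 1 = 0) (h10 : S.valueAt o Y 1 0 = 0) (h02 : S.valueAt o Y 0 2 = 0)
    (h03 : S.valueAt o Y 0 3 = 0) (h12 : S.valueAt o Y 1 2 = 0) : vectorField Y o = 0 := by
  have hz : S.valueAt o Y = 0 := by
    have h := hY.2 o ho
    have e0 := congrFun h 0
    have e1 := congrFun h 1
    rw [contr_apply_zero] at e0
    rw [contr_apply_one] at e1
    change S.valueAt o Y 0 0 + S.valueAt o Y 1 1 = 0 at e0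
    change S.valueAt o Y 0 2 + S.valueAt o Y 1 3 = 0 at e1
    rw [h00, zero_add] at e0
    rw [h02, zero_add] at e1
    ext i j
    fin_cases i <;> fin_cases j <;> assumption
  have := congrArg (· * (S.frame o)⁻¹) hz
  simpa only [valueAt, LinearMap.coe_mk, AddHom.coe_mk, Matrix.zero_mul,
    Matrix.mul_nonsing_inv_cancel_right _ _ (isUnit_frame hnd ho)] using this

/-- Preservation of the tangent space leaves four free entries in the right part once the left part
is given (`eq_of_contr_mul_sub_mul`); trace zero removes one more. -/
theorem rightPart_eq (hnd : S.Nondegenerate) {o : JetSpace} (ho : o ∈ S.locus)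
    {Y : Mat6} (hY : Y ∈ S.symmetryAlgebra) (h0 : vectorField Y o = 0) {P : Matrix (Fin 2) (Fin 2) ℝ}
    (hA : leftPart o Y = P) {d b c : ℝ} (h00 : S.rightPart o Y 0 0 = d)
    (h02 : S.rightPart o Y 0 2 = b) (h20 : S.rightPart o Y 2 0 = c) :
    S.rightPart o Y = !![d, P 0 1, b, 0; P 1 0, d - P 0 0 + P 1 1, 0, b;
      c, 0, -d + P 0 0 / 2 - 3 * P 1 1 / 2, P 0 1;
      0, c, P 1 0, -d - P 0 0 / 2 - P 1 1 / 2] := by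
  have hE := isUnit_frame hnd ho
  have key := eq_of_contr_mul_sub_mul (A := leftPart o Y) (D := S.rightPart o Y) (by
    intro t ht
    have h := (symmetry_expansion hnd ho hY h0 rfl rfl (t := Matrix.of.symm (t * (S.frame o)⁻¹))
      (by rw [fderiv_eqs_apply ho.1, Equiv.apply_symm_apply,
        Matrix.nonsing_inv_mul_cancel_right _ _ hE, ht])).1
    rw [fderiv_eqs_apply ho.1, Equiv.apply_symm_apply, Equiv.apply_symm_apply] at h
    rw [← h]
    congr 1
    simp only [leftPart, rightPart, LinearMap.coe_mk, AddHom.coe_mk, Matrix.sub_mul,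
      Matrix.mul_assoc, Matrix.nonsing_inv_mul _ hE, Matrix.mul_one])
  have htr : (leftPart o Y).trace + (S.rightPart o Y).trace = 0 := by
    have e1 : (S.rightPart o Y).trace
        = (Y.toBlocks₂₁ * Matrix.of o + Y.toBlocks₂₂).trace := by
      rw [rightPart, LinearMap.coe_mk, AddHom.coe_mk, Matrix.trace_mul_comm, ← Matrix.mul_assoc,
        Matrix.mul_nonsing_inv _ hE, Matrix.one_mul]
    have e2 : Y.trace = Y.toBlocks₁₁.trace + Y.toBlocks₂₂.trace := by
      simp [Matrix.trace, Matrix.toBlocks₁₁, Matrix.toBlocks₂₂]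
    have e3 := hY.1
    rw [e2] at e3
    rw [e1, leftPart, LinearMap.coe_mk, AddHom.coe_mk, Matrix.trace_sub, Matrix.trace_add,
      Matrix.trace_mul_comm (Matrix.of o), ← e3]
    ring
  rw [hA, h00, h02, h20] at key
  rw [hA] at htr
  have h22 : S.rightPart o Y 2 2 = -d + P 0 0 / 2 - 3 * P 1 1 / 2 := by
    rw [key] at htr
    simp only [Matrix.trace, Matrix.diag, Fin.sum_univ_two, Fin.sum_univ_four, Matrix.of_apply,
      Matrix.cons_val] at htr
    linarith
  rw [h22] at key
  rw [key]
  ext i j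
  fin_cases i <;> fin_cases j <;> simp
  ring

theorem eq_of_rightPart_eq_smul (hnd : S.Nondegenerate) {o : JetSpace} (ho : o ∈ S.locus)
    {Y : Mat6} {r : ℝ} (h : S.rightPart o Y = r • 1) :
    Y.toBlocks₂₁ * Matrix.of o + Y.toBlocks₂₂ = r • 1 := by
  have hE := isUnit_frame hnd ho
  have h1 := congrArg (fun M => S.frame o * M * (S.frame o)⁻¹) h
  simp only [rightPart, LinearMap.coe_mk, AddHom.coe_mk, Matrix.mul_assoc,
    Matrix.mul_nonsing_inv _ hE, Matrix.mul_one, Matrix.mul_nonsing_inv_cancel_left _ _ hE,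
    Matrix.smul_mul, Matrix.mul_smul] at h1
  exact h1

/-- If all coordinates vanish, so do the value and both linear parts. The second-order expansion
then reduces to `contr (t C t) = 0` on tangent vectors, which forces the quadratic part to vanish.
-/
theorem symmetryCoords_injective (hnd : S.Nondegenerate) {o : JetSpace} (ho : o ∈ S.locus) :
    Function.Injective (S.symmetryCoords o) := by
  rw [injective_iff_map_eq_zero]
  rintro ⟨Y, hY⟩ h
  have hk : ∀ k, S.symmetryCoords o ⟨Y, hY⟩ k = 0 := fun k => congrFun h k
  have h0 := vectorField_eq_zero_of_coords hnd ho hY (hk 0) (hk 1) (hk 2) (hk 3) (hk 4) (hk 5)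
  have hA : leftPart o Y = 0 := by
    have k6 := hk 6
    have k7 := hk 7
    have k8 := hk 8
    have k9 := hk 9
    ext i j
    fin_cases i <;> fin_cases j <;> assumption
  have hD : S.rightPart o Y = (0 : ℝ) • 1 := by
    rw [rightPart_eq hnd ho hY h0 hA (hk 10) (hk 11) (hk 12)]
    ext i j
    fin_cases i <;> fin_cases j <;> simp
  have hD' := eq_of_rightPart_eq_smul hnd ho hD
  rw [zero_smul] at hD'
  have hE := isUnit_frame hnd ho
  have hC : Y.toBlocks₂₁ = 0 := by
    have : (S.frame o)⁻¹ * Y.toBlocks₂₁ = 0 := by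
      refine eq_zero_of_contr_mul_mul_self fun t ht => ?_
      obtain ⟨-, w, -, hw⟩ := symmetry_expansion hnd ho hY h0 rfl rfl
        (t := Matrix.of.symm (t * (S.frame o)⁻¹))
        (by rw [fderiv_eqs_apply ho.1, Equiv.apply_symm_apply,
          Matrix.nonsing_inv_mul_cancel_right _ _ hE, ht])
      have hA' : Y.toBlocks₁₁ - Matrix.of o * Y.toBlocks₂₁ = 0 := hA
      rw [hA', hD'] at hw
      simp only [Matrix.zero_mul, Matrix.mul_zero, sub_zero, zero_sub,
        Equiv.apply_symm_apply] at hw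
      have e : (Matrix.of.symm (0 : Matrix (Fin 2) (Fin 4) ℝ) : JetSpace) = 0 := rfl
      rw [e, map_zero, smul_zero, zero_add, fderiv_eqs_apply ho.1, Equiv.apply_symm_apply,
        Matrix.neg_mul, Matrix.smul_mul, map_neg, map_smul, neg_eq_zero] at hw
      have hw' := (smul_eq_zero.1 hw).resolve_left two_ne_zero
      simpa only [Matrix.mul_assoc, Matrix.nonsing_inv_mul _ hE, Matrix.mul_one] using hw'
    have h2 := congrArg (S.frame o * ·) this
    simpa only [Matrix.mul_nonsing_inv_cancel_left _ _ hE, Matrix.mul_zero] using h2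
  have hD2 : Y.toBlocks₂₂ = 0 := by rwa [hC, Matrix.zero_mul, zero_add] at hD'
  have hA2 : Y.toBlocks₁₁ = 0 := by
    have hA' : Y.toBlocks₁₁ - Matrix.of o * Y.toBlocks₂₁ = 0 := hA
    rwa [hC, Matrix.mul_zero, sub_zero] at hA'
  have hB : Y.toBlocks₁₂ = 0 := by
    rw [vectorField, hC, hD2, hA2] at h0
    simpa using h0
  refine Subtype.ext ?_
  change Y = 0
  rw [← Matrix.fromBlocks_toBlocks Y, hC, hD2, hA2, hB, Matrix.fromBlocks_zero]

/-- In dimension 13 the coordinates can be prescribed, so there is a symmetry vanishing at `o` whose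
linear part is the identity. In its second-order expansion the lower left block of `Y` is the
required `C`. -/
theorem osculating_of_finrank_symmetryAlgebra (hnd : S.Nondegenerate)
    (h : 13 ≤ Module.finrank ℝ S.symmetryAlgebra) : S.Osculating := by
  intro o ho
  have hinj := symmetryCoords_injective hnd ho
  have hle := LinearMap.finrank_le_finrank_of_injective hinj
  rw [Module.finrank_fin_fun] at hle
  have hsurj := (LinearMap.injective_iff_surjective_of_finrank_eq_finrank
    (by rw [Module.finrank_fin_fun]; exact le_antisymm hle h)).1 hinj
  -- The left part is `2/3` and the right part `-1/3`: the scalars with difference `1` for which `2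
  -- · 2/3 - 4 · 1/3 = 0`.
  obtain ⟨⟨Y, hY⟩, hYc⟩ := hsurj ![0, 0, 0, 0, 0, 0, 2 / 3, 0, 0, 2 / 3, -1 / 3, 0, 0]
  have hk : ∀ k, S.symmetryCoords o ⟨Y, hY⟩ k
      = ![0, 0, 0, 0, 0, 0, 2 / 3, 0, 0, 2 / 3, -1 / 3, 0, 0] k := fun k => congrFun hYc k
  have h0 := vectorField_eq_zero_of_coords hnd ho hY (hk 0) (hk 1) (hk 2) (hk 3) (hk 4) (hk 5)
  have hA : leftPart o Y = (2 / 3 : ℝ) • 1 := by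
    have k6 : leftPart o Y 0 0 = 2 / 3 := hk 6
    have k7 : leftPart o Y 0 1 = 0 := hk 7
    have k8 : leftPart o Y 1 0 = 0 := hk 8
    have k9 : leftPart o Y 1 1 = 2 / 3 := hk 9
    ext i j
    fin_cases i <;> fin_cases j <;> simp [k6, k7, k8, k9]
  have hD : S.rightPart o Y = (-1 / 3 : ℝ) • 1 := by
    rw [rightPart_eq hnd ho hY h0 hA (hk 10) (hk 11) (hk 12)]
    ext i j
    fin_cases i <;> fin_cases j <;> simp <;> norm_num
  have hD' := eq_of_rightPart_eq_smul hnd ho hD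
  have hA' : Y.toBlocks₁₁ - Matrix.of o * Y.toBlocks₂₁ = (2 / 3 : ℝ) • 1 := hA
  refine ⟨Y.toBlocks₂₁, fun t ht => ?_⟩
  obtain ⟨-, w, hw, hw'⟩ := symmetry_expansion hnd ho hY h0 hA'.symm hD'.symm ht
  have e : ∀ t : JetSpace, ((2 / 3 : ℝ) • (1 : Matrix (Fin 2) (Fin 2) ℝ)) * Matrix.of t
      - Matrix.of t * ((-1 / 3 : ℝ) • (1 : Matrix (Fin 4) (Fin 4) ℝ)) = Matrix.of t := fun t => by
    rw [Matrix.smul_mul, Matrix.mul_smul, Matrix.one_mul, Matrix.mul_one, ← sub_smul]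
    norm_num
  rw [e, e, Equiv.symm_apply_apply] at hw'
  have e2 : (Matrix.of.symm (Matrix.of w - (2 : ℝ) • (Matrix.of t * Y.toBlocks₂₁ * Matrix.of t))
      : JetSpace) = w - (2 : ℝ) • Matrix.of.symm (Matrix.of t * Y.toBlocks₂₁ * Matrix.of t) := rfl
  rw [e2, map_sub, map_smul, hw, two_smul] at hw'
  have h3 := sub_eq_zero.1 (Eq.trans (by abel) hw' :
    fderiv ℝ (fderiv ℝ S.eqs) o t t - (2 : ℝ) • fderiv ℝ S.eqs o
      (Matrix.of.symm (Matrix.of t * Y.toBlocks₂₁ * Matrix.of t)) = 0)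
  exact h3

theorem InvariantUnder.osculating (hnd : S.Nondegenerate) {G : Subgroup SL6}
    (hdim : lieDim G = 13) (hG : S.InvariantUnder G) : S.Osculating :=
  osculating_of_finrank_symmetryAlgebra hnd
    (hdim ▸ Submodule.finrank_mono (span_lieAlgebraSet_le hG))

end FirstOrderSystem

/-! ### The differential of the action and the cometric of a linearisable system -/

namespace FirstOrderSystem

variable {S : FirstOrderSystem}

section

attribute [local instance] Matrix.normedAddCommGroup Matrix.normedSpace

/-- The numerator `A U + B`. -/
def numer (g : SL6) (U : JetSpace) : Matrix (Fin 2) (Fin 4) ℝ :=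
  g.1.toBlocks₁₁ * Matrix.of U + g.1.toBlocks₁₂

theorem of_act_mul_denom {g : SL6} {U : JetSpace} (h : IsUnit (denom g U).det) :
    Matrix.of (act g U) * denom g U = numer g U := by
  rw [act, Equiv.apply_symm_apply, Matrix.nonsing_inv_mul_cancel_right _ _ h, numer]

theorem of_act_eq_of_mul_denom {g : SL6} {U : JetSpace} (h : IsUnit (denom g U).det)
    {n : Matrix (Fin 2) (Fin 4) ℝ} (hn : n * denom g U = numer g U) : Matrix.of (act g U) = n := by
  rw [act, Equiv.apply_symm_apply, ← numer, ← hn, Matrix.mul_nonsing_inv_cancel_right _ _ h]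

theorem continuous_denom (g : SL6) : Continuous fun U => denom g U := by
  have h : Continuous fun U : JetSpace => Matrix.of U :=
    (continuous_id : Continuous fun U : JetSpace => U)
  exact (Continuous.matrix_mul continuous_const h).add continuous_const

/-- The left factor of the derivative of the action. -/
def leftFactor (g : SL6) (U : JetSpace) : Matrix (Fin 2) (Fin 2) ℝ :=
  g.1.toBlocks₁₁ - Matrix.of (act g U) * g.1.toBlocks₂₁

/-- Multiplying `g` by unipotent blocks on both sides makes it block triangular with diagonal blocks
`leftFactor` and `denom`, so their determinants have product `1`. -/
theorem isUnit_leftFactor {g : SL6} {U : JetSpace} (h : IsUnit (denom g U).det) :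
    IsUnit (leftFactor g U).det := by
  have key : Matrix.fromBlocks (leftFactor g U) 0 g.1.toBlocks₂₁ (denom g U)
      = Matrix.fromBlocks 1 (-Matrix.of (act g U)) 0 1 * g.1
        * Matrix.fromBlocks 1 (Matrix.of U) 0 1 := by
    conv_rhs => rw [← Matrix.fromBlocks_toBlocks g.1]
    rw [Matrix.fromBlocks_multiply, Matrix.fromBlocks_multiply]
    congr 1
    · simp only [leftFactor, Matrix.one_mul, Matrix.mul_one, Matrix.mul_zero, add_zero,
        Matrix.neg_mul, sub_eq_add_neg]
    · have := of_act_mul_denom h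
      rw [numer] at this
      simp only [Matrix.one_mul, Matrix.mul_one, Matrix.neg_mul, Matrix.add_mul]
      have e : g.1.toBlocks₁₁ * Matrix.of U + -(Matrix.of (act g U) * g.1.toBlocks₂₁ * Matrix.of U)
          + (g.1.toBlocks₁₂ + -(Matrix.of (act g U) * g.1.toBlocks₂₂))
          = (g.1.toBlocks₁₁ * Matrix.of U + g.1.toBlocks₁₂)
            - Matrix.of (act g U) * denom g U := by
        rw [denom, Matrix.mul_add, Matrix.mul_assoc]
        abel
      rw [e, this, sub_self]
    · simp
    · simp [denom]
  have hdet := congrArg Matrix.det key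
  rw [Matrix.det_fromBlocks_zero₁₂, Matrix.det_mul, Matrix.det_mul, g.2,
    Matrix.det_fromBlocks_zero₂₁, Matrix.det_fromBlocks_zero₂₁] at hdet
  simp only [Matrix.det_one, mul_one] at hdet
  exact IsUnit.of_mul_eq_one _ hdet

/-- Directions of the linear system are tangent to the locus. -/
theorem contr_eq_zero_of_linear {g : SL6} {L : Fin 2 → JetSpace} {m : Fin 2 → ℝ} {U : JetSpace}
    (hU : U ∈ S.locus) (hden : IsUnit (denom g U).det)
    (hev : ∀ᶠ U' in 𝓝 U, U' ∈ S.locus ↔ act g U' ∈ linearLocus L m)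
    {b : Matrix (Fin 2) (Fin 4) ℝ} (hb : ∀ k, ∑ a, ∑ i, L k a i * b a i = 0) :
    contr ((leftFactor g U)⁻¹ * b * denom g U * S.frame U) = 0 := by
  set n := Matrix.of (act g U) with hn
  set a := leftFactor g U with ha
  set C := g.1.toBlocks₂₁ with hC
  have hau : IsUnit a.det := isUnit_leftFactor hden
  -- `w = s α⁻¹ b (denom g U)` solves `a w - s b C w = s b (denom g U)`. This equation says that the
  -- action maps `U + w` exactly onto the line `n + s b`.
  set α : ℝ → Matrix (Fin 2) (Fin 2) ℝ := fun s => a - s • (b * C) with hα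
  have hαd : HasDerivAt α (-(b * C)) 0 := by
    have := ((hasDerivAt_id (0 : ℝ)).smul_const (b * C)).const_sub a
    exact this.congr_deriv (by rw [one_smul])
  have hα0 : α 0 = a := by simp [hα]
  have hαi := hαd.matrix_inv (by rw [hα0]; exact hau.ne_zero)
  set w : ℝ → Matrix (Fin 2) (Fin 4) ℝ := fun s => s • ((α s)⁻¹ * b * denom g U) with hw
  have hwd : HasDerivAt w (a⁻¹ * b * denom g U) 0 := by
    have h1 := (hαi.matrix_mul (hasDerivAt_const (0 : ℝ) b)).matrix_mul
      (hasDerivAt_const (0 : ℝ) (denom g U))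
    have h2 := (hasDerivAt_id (0 : ℝ)).smul h1
    refine HasDerivAt.congr_deriv (f := w) h2 ?_
    simp [hα0]
  set c : ℝ → JetSpace := fun s => U + Matrix.of.symm (w s) with hc
  have hw0 : w 0 = 0 := by simp [hw]
  have hc0 : c 0 = U := by
    simp only [hc, hw0]
    exact add_zero U
  have hcd : HasDerivAt c (Matrix.of.symm (a⁻¹ * b * denom g U)) 0 :=
    HasDerivAt.const_add (f := fun s => (Matrix.of.symm (w s) : JetSpace)) U hwd
  have hdetα : ∀ᶠ s in 𝓝 (0 : ℝ), (α s).det ≠ 0 := by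
    have : Continuous fun s => (α s).det := by
      refine Continuous.matrix_det (continuous_const.sub ?_)
      exact continuous_id.smul continuous_const
    refine this.continuousAt.eventually_ne ?_
    rw [hα0]
    exact hau.ne_zero
  have hcc : Filter.Tendsto c (𝓝 0) (𝓝 U) := by
    have := hcd.continuousAt.tendsto
    rwa [hc0] at this
  have hdetc : ∀ᶠ s in 𝓝 (0 : ℝ), (denom g (c s)).det ≠ 0 :=
    hcc.eventually ((continuous_denom g).matrix_det.continuousAt.eventually_ne hden.ne_zero)
  have hact : ∀ᶠ s in 𝓝 (0 : ℝ), Matrix.of (act g (c s)) = n + s • b := by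
    filter_upwards [hdetα, hdetc] with s h1 h2
    refine of_act_eq_of_mul_denom (isUnit_iff_ne_zero.2 h2) ?_
    have hcs : Matrix.of (c s) = Matrix.of U + w s := rfl
    have e1 : denom g (c s) = denom g U + C * w s := by
      rw [denom, denom, hcs, Matrix.mul_add]
      abel
    have e2 : numer g (c s) = n * denom g U + g.1.toBlocks₁₁ * w s := by
      rw [hn, of_act_mul_denom hden, numer, numer, hcs, Matrix.mul_add]
      abel
    have e3 : a * w s - s • (b * C * w s) = s • (b * denom g U) := by
      have : α s * w s = s • (b * denom g U) := by
        simp only [hw]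
        rw [Matrix.mul_smul, Matrix.mul_assoc (α s)⁻¹,
          Matrix.mul_nonsing_inv_cancel_left _ _ (isUnit_iff_ne_zero.2 h1)]
      rw [← this, hα, Matrix.sub_mul, Matrix.smul_mul]
    have e4 : a * w s = g.1.toBlocks₁₁ * w s - n * (C * w s) := by
      rw [ha, leftFactor, Matrix.sub_mul, Matrix.mul_assoc]
    rw [e1, e2, Matrix.add_mul, Matrix.mul_add, Matrix.mul_add, Matrix.smul_mul, Matrix.smul_mul,
      ← e3, ← Matrix.mul_assoc b, e4]
    abel
  have hn0 : act g U ∈ linearLocus L m := hev.self_of_nhds.1 hU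
  have hmem : ∀ᶠ s in 𝓝 (0 : ℝ), c s ∈ S.locus := by
    filter_upwards [hact, hcc.eventually hev] with s h1 h2
    refine h2.2 fun k => ?_
    have h3 : ∀ a i, act g (c s) a i = act g U a i + s * b a i := fun a i =>
      congrFun (congrFun h1 a) i
    have h4 := hn0 k
    have h5 := hb k
    simp only [h3, mul_add, Finset.sum_add_distrib, mul_left_comm _ s]
    simp only [← Finset.mul_sum]
    rw [h5, mul_zero, add_zero, h4]
  have k1 := (hasFDerivAt_eqs hU.1).comp_hasDerivAt_of_eq (0 : ℝ) hcd hc0.symm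
  have k2 : HasDerivAt (S.eqs ∘ c) 0 0 := by
    refine (hasDerivAt_const (0 : ℝ) (0 : Fin 2 → ℝ)).congr_of_eventuallyEq ?_
    filter_upwards [hmem] with s hs using (S.mem_locus_iff.1 hs).2
  have k3 := k1.unique k2
  rwa [fderiv_eqs_apply hU.1, Equiv.apply_symm_apply] at k3

end

/-- The frame of a pair of linear forms. -/
def linearFrame (L : Fin 2 → JetSpace) : Matrix (Fin 4) (Fin 4) ℝ :=
  Matrix.of fun i => ![L 0 0 i, L 0 1 i, L 1 0 i, L 1 1 i]

theorem sum_eq_contr_linearFrame (L : Fin 2 → JetSpace) (t : Matrix (Fin 2) (Fin 4) ℝ) (k : Fin 2) :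
    ∑ a, ∑ i, L k a i * t a i = contr (t * linearFrame L) k := by
  fin_cases k
  · simp only [linearFrame, Fin.zero_eta, contr_apply_zero, Matrix.mul_apply, Fin.sum_univ_two,
      Matrix.of_apply, Matrix.cons_val]
    congr 1 <;> exact Finset.sum_congr rfl fun _ _ => mul_comm _ _
  · simp only [linearFrame, Fin.mk_one, contr_apply_one, Matrix.mul_apply, Fin.sum_univ_two,
      Matrix.of_apply, Matrix.cons_val]
    congr 1 <;> exact Finset.sum_congr rfl fun _ _ => mul_comm _ _

/-- `1 ⊗ a` on `ℝ² ⊗ ℝ²`. -/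
def innerBlock (a : Matrix (Fin 2) (Fin 2) ℝ) : Matrix (Fin 4) (Fin 4) ℝ :=
  !![a 0 0, a 0 1, 0, 0; a 1 0, a 1 1, 0, 0; 0, 0, a 0 0, a 0 1; 0, 0, a 1 0, a 1 1]

/-- `a ⊗ 1` on `ℝ² ⊗ ℝ²`. -/
def outerBlock (a : Matrix (Fin 2) (Fin 2) ℝ) : Matrix (Fin 4) (Fin 4) ℝ :=
  !![a 0 0, 0, a 0 1, 0; 0, a 0 0, 0, a 0 1; a 1 0, 0, a 1 1, 0; 0, a 1 0, 0, a 1 1]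

/-- The quadric is the determinant of a `2 × 2` matrix, which multiplication on either side
rescales. Inner blocks come from the left factor of the action, outer blocks from recombining the
two equations. -/
theorem innerBlock_mul_modelCometric (a : Matrix (Fin 2) (Fin 2) ℝ) :
    innerBlock a * modelCometric * (innerBlock a)ᵀ = a.det • modelCometric := by
  ext i j
  fin_cases i <;> fin_cases j <;>
    simp [innerBlock, modelCometric, Matrix.mul_apply, Fin.sum_univ_four, Matrix.det_fin_two] <;>
    ring

theorem outerBlock_mul_modelCometric (a : Matrix (Fin 2) (Fin 2) ℝ) :
    outerBlock a * modelCometric * (outerBlock a)ᵀ = a.det • modelCometric := by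
  ext i j
  fin_cases i <;> fin_cases j <;>
    simp [outerBlock, modelCometric, Matrix.mul_apply, Fin.sum_univ_four, Matrix.det_fin_two] <;>
    ring

theorem innerBlock_mul (a b : Matrix (Fin 2) (Fin 2) ℝ) :
    innerBlock a * innerBlock b = innerBlock (a * b) := by
  ext i j
  fin_cases i <;> fin_cases j <;>
    simp [innerBlock, Matrix.mul_apply, Fin.sum_univ_four]

theorem innerBlock_one : innerBlock 1 = 1 := by
  ext i j
  fin_cases i <;> fin_cases j <;> simp [innerBlock]

theorem contr_mul_eq (a : Matrix (Fin 2) (Fin 2) ℝ) (b : Matrix (Fin 2) (Fin 4) ℝ)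
    (E : Matrix (Fin 4) (Fin 4) ℝ) : contr (a * b * E) = contr (b * (E * innerBlock a)) := by
  ext k
  fin_cases k
  · simp [innerBlock, Matrix.mul_apply, Fin.sum_univ_four]
    ring
  · simp [innerBlock, Matrix.mul_apply, Fin.sum_univ_four]
    ring

/-- A linear form vanishing on the common kernel of two forms is a combination of them; the
coefficients form `N`. -/
theorem exists_eq_mul_outerBlock {E F : Matrix (Fin 4) (Fin 4) ℝ}
    (h : ∀ b : Matrix (Fin 2) (Fin 4) ℝ, contr (b * F) = 0 → contr (b * E) = 0) :
    ∃ N : Matrix (Fin 2) (Fin 2) ℝ, E = F * outerBlock N := by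
  let φ : Matrix (Fin 4) (Fin 4) ℝ → Fin 2 → (Matrix (Fin 2) (Fin 4) ℝ →ₗ[ℝ] ℝ) := fun E k =>
    { toFun := fun b => contr (b * E) k
      map_add' := fun b c => by rw [Matrix.add_mul, map_add]; rfl
      map_smul' := fun r b => by rw [Matrix.smul_mul, map_smul]; rfl }
  have hmem : ∀ k, φ E k ∈ Submodule.span ℝ (Set.range (φ F)) := fun k => by
    refine mem_span_of_iInf_ker_le_ker fun b hb => ?_
    rw [Submodule.mem_iInf] at hb
    have : contr (b * F) = 0 := funext fun k => hb k
    exact congrFun (h b this) k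
  choose c hc using fun k => (Submodule.mem_span_range_iff_exists_fun ℝ).1 (hmem k)
  refine ⟨Matrix.of fun l k => c k l, ?_⟩
  have key : ∀ k (b : Matrix (Fin 2) (Fin 4) ℝ),
      c k 0 * contr (b * F) 0 + c k 1 * contr (b * F) 1 = contr (b * E) k := fun k b => by
    have := congrArg (fun f : Matrix (Fin 2) (Fin 4) ℝ →ₗ[ℝ] ℝ => f b) (hc k)
    simpa [Fin.sum_univ_two, φ] using this
  have k00 := fun i => key 0 (Matrix.single 0 i 1)
  have k01 := fun i => key 0 (Matrix.single 1 i 1)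
  have k10 := fun i => key 1 (Matrix.single 0 i 1)
  have k11 := fun i => key 1 (Matrix.single 1 i 1)
  simp [Matrix.mul_apply, Matrix.single_apply] at k00 k01 k10 k11
  ext i j
  have := k00 i
  have := k01 i
  have := k10 i
  have := k11 i
  fin_cases j <;> simp [outerBlock, Matrix.mul_apply, Fin.sum_univ_four] <;> linarith

/-- The linear system has an invertible frame, and the cometric is the constant one up to a
factor and the Jacobian. -/
theorem Linearisable.exists_frame (hne : S.locus.Nonempty) (hnd : S.Nondegenerate)
    (h : S.Linearisable) : ∃ (g : SL6) (E : Matrix (Fin 4) (Fin 4) ℝ) (m : Fin 2 → ℝ),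
      IsUnit E.det ∧ ∀ U ∈ S.locus, IsUnit (denom g U).det ∧
        (∀ᶠ U' in 𝓝 U, U' ∈ S.locus ↔ contr (Matrix.of (act g U') * E) + m = 0) ∧
        ∃ κ : ℝ, κ ≠ 0 ∧ denom g U * S.cometric U * (denom g U)ᵀ
          = κ • (E * modelCometric * Eᵀ) := by
  obtain ⟨g, L, m, -, h⟩ := h
  have key : ∀ U ∈ S.locus, IsUnit (linearFrame L).det ∧ ∃ κ : ℝ, κ ≠ 0 ∧
      denom g U * S.cometric U * (denom g U)ᵀ
          = κ • (linearFrame L * modelCometric * (linearFrame L)ᵀ) := by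
    intro U hU
    have hau := isUnit_leftFactor (h U hU).1
    obtain ⟨N, hN⟩ := exists_eq_mul_outerBlock
      (E := denom g U * S.frame U * innerBlock (leftFactor g U)⁻¹) (F := linearFrame L) (by
        intro b hb
        have := contr_eq_zero_of_linear hU (h U hU).1 (h U hU).2 (b := b) fun k => by
          rw [sum_eq_contr_linearFrame, hb, Pi.zero_apply]
        rwa [Matrix.mul_assoc _ (denom g U), contr_mul_eq] at this)
    have hEa : denom g U * S.frame U
        = linearFrame L * outerBlock N * innerBlock (leftFactor g U) := by
      rw [← hN, Matrix.mul_assoc, innerBlock_mul, Matrix.nonsing_inv_mul _ hau, innerBlock_one,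
        Matrix.mul_one]
    have hcom : denom g U * S.cometric U * (denom g U)ᵀ = ((leftFactor g U).det * N.det)
        • (linearFrame L * modelCometric * (linearFrame L)ᵀ) := by
      have e1 : denom g U * S.cometric U * (denom g U)ᵀ
          = (denom g U * S.frame U) * modelCometric * (denom g U * S.frame U)ᵀ := by
        rw [cometric_eq, Matrix.transpose_mul]
        simp only [Matrix.mul_assoc]
      have e2 : linearFrame L * outerBlock N * innerBlock (leftFactor g U) * modelCometric
          * (linearFrame L * outerBlock N * innerBlock (leftFactor g U))ᵀ
          = linearFrame L * (outerBlock N * (innerBlock (leftFactor g U) * modelCometric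
            * (innerBlock (leftFactor g U))ᵀ) * (outerBlock N)ᵀ) * (linearFrame L)ᵀ := by
        simp only [Matrix.transpose_mul, Matrix.mul_assoc]
      rw [e1, hEa, e2, innerBlock_mul_modelCometric, Matrix.mul_smul, Matrix.smul_mul,
        outerBlock_mul_modelCometric]
      simp only [Matrix.mul_smul, Matrix.smul_mul, smul_smul]
    -- Non-degeneracy at one point gives both the invertibility of the constant frame and the
    -- non-vanishing of the conformal factor.
    have hdet : (denom g U * S.cometric U * (denom g U)ᵀ).det ≠ 0 := by
      rw [Matrix.det_mul, Matrix.det_mul, Matrix.det_transpose]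
      exact mul_ne_zero (mul_ne_zero (h U hU).1.ne_zero (hnd U hU)) (h U hU).1.ne_zero
    refine ⟨?_, _, ?_, hcom⟩
    · rw [isUnit_iff_ne_zero]
      intro h0
      apply hdet
      rw [hcom, Matrix.det_smul, Matrix.det_mul, Matrix.det_mul, h0]
      simp
    · intro h0
      apply hdet
      rw [hcom, h0, zero_smul]
      exact Matrix.det_zero
  obtain ⟨U₀, hU₀⟩ := hne
  refine ⟨g, linearFrame L, m, (key U₀ hU₀).1, fun U hU => ⟨(h U hU).1, ?_, (key U hU).2⟩⟩
  filter_upwards [(h U hU).2] with U' h'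
  rw [h']
  simp only [linearLocus, Set.mem_ofPred_eq, funext_iff]
  refine forall_congr' fun k => ?_
  rw [Pi.add_apply, ← sum_eq_contr_linearFrame]
  rfl

end FirstOrderSystem

/-! ### Linear flows and conjugation by exponentials -/

theorem exists_linear_flow {V : Type*} [NormedAddCommGroup V] [NormedSpace ℝ V]
    [CompleteSpace V] (T : V →L[ℝ] V) (q : V) :
    ∃ y : ℝ → V, y 0 = q ∧ ∀ s, HasDerivAt y (T (y s)) s := by
  refine ⟨fun s => NormedSpace.exp (s • T) q, by simp, fun s => ?_⟩
  have h := (hasDerivAt_exp_smul_const' (𝕂 := ℝ) T s).clm_apply (hasDerivAt_const s q)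
  rwa [map_zero, add_zero] at h

/-- The flow of a linear vector field preserves invariant subspaces. -/
theorem exists_linear_flow_mem {V : Type*} [NormedAddCommGroup V] [NormedSpace ℝ V]
    [FiniteDimensional ℝ V] (T : V →ₗ[ℝ] V) {W : Submodule ℝ V} (hW : ∀ q ∈ W, T q ∈ W) {q : V}
    (hq : q ∈ W) :
    ∃ y : ℝ → V, (∀ s, y s ∈ W) ∧ y 0 = q ∧ ∀ s, HasDerivAt y (T (y s)) s := by
  have : CompleteSpace W := FiniteDimensional.complete ℝ W
  obtain ⟨y, hy0, hy⟩ := exists_linear_flow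
    (LinearMap.toContinuousLinearMap (T.restrict hW)) ⟨q, hq⟩
  exact ⟨fun s => y s, fun s => (y s).2, congrArg Subtype.val hy0, fun s =>
    W.subtypeL.hasFDerivAt.comp_hasDerivAt s (hy s)⟩

section MatrixExp

variable {n : Type*} [Fintype n] [DecidableEq n]

section

attribute [local instance] Matrix.linftyOpNormedRing Matrix.linftyOpNormedAlgebra

theorem Matrix.hasDerivAt_exp_smul_apply' (Y : Matrix n n ℝ) (t : ℝ) (i j : n) :
    HasDerivAt (fun s : ℝ => NormedSpace.exp (s • Y) i j)
      ((NormedSpace.exp (t • Y) * Y) i j) t := by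
  have h := hasDerivAt_exp_smul_const (𝕂 := ℝ) Y t
  let e : Matrix n n ℝ →ₗ[ℝ] ℝ := Matrix.entryLinearMap ℝ ℝ i j
  exact (LinearMap.toContinuousLinearMap e).hasFDerivAt.comp_hasDerivAt t h

end

attribute [local instance] Matrix.normedAddCommGroup Matrix.normedSpace

theorem Matrix.hasDerivAt_exp_smul' (Y : Matrix n n ℝ) (t : ℝ) :
    HasDerivAt (fun s : ℝ => NormedSpace.exp (s • Y)) (NormedSpace.exp (t • Y) * Y) t :=
  hasDerivAt_pi.2 fun i => hasDerivAt_pi.2 fun j => hasDerivAt_exp_smul_apply' Y t i j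

theorem Matrix.exp_smul_mul_exp_neg_smul (Y : Matrix n n ℝ) (t : ℝ) :
    NormedSpace.exp (t • Y) * NormedSpace.exp (t • -Y) = 1 := by
  rw [← Matrix.exp_add_of_commute _ _ ((Commute.refl Y).neg_right.smul_left t |>.smul_right t),
    smul_neg, add_neg_cancel, NormedSpace.exp_zero]

/-- The one-parameter group law moves the derivative of the determinant at any `t` to the identity,
where it is the trace. -/
theorem Matrix.det_exp_smul_of_trace_eq_zero {Y : Matrix n n ℝ} (hY : Y.trace = 0) (t : ℝ) :
    (NormedSpace.exp (t • Y)).det = 1 := by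
  have hd : ∀ t : ℝ, HasDerivAt (fun s : ℝ => (NormedSpace.exp (s • Y)).det) 0 t := by
    intro t
    have h1 : HasDerivAt (fun s : ℝ => NormedSpace.exp ((s - t) • Y)) Y t := by
      have h2 := Matrix.hasDerivAt_exp_smul Y (t - t)
      have h3 := HasDerivAt.scomp (h := fun s : ℝ => s - t) t h2 ((hasDerivAt_id t).sub_const t)
      refine h3.congr_deriv ?_
      simp
    have h2 := (Matrix.hasDerivAt_det_of_eq_one h1 (by simp)).const_mul
      (NormedSpace.exp (t • Y)).det
    rw [hY, mul_zero] at h2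
    refine h2.congr_of_eventuallyEq (Filter.Eventually.of_forall fun s => ?_)
    change (NormedSpace.exp (s • Y)).det
      = (NormedSpace.exp (t • Y)).det * (NormedSpace.exp ((s - t) • Y)).det
    rw [← Matrix.det_mul, ← Matrix.exp_add_of_commute _ _
      ((Commute.refl Y).smul_left t |>.smul_right (s - t)), ← add_smul, add_sub_cancel]
  have := is_const_of_deriv_eq_zero (fun t => (hd t).differentiableAt) (fun t => (hd t).deriv) t 0
  rw [this, zero_smul, NormedSpace.exp_zero, Matrix.det_one]

/-- A subspace invariant under the commutator with `Y` is invariant under the conjugation with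
`exp (t Y)`. -/
theorem Matrix.exp_conj_mem {W : Submodule ℝ (Matrix n n ℝ)} {Y : Matrix n n ℝ}
    (hW : ∀ q ∈ W, Y * q - q * Y ∈ W) (t : ℝ) {q : Matrix n n ℝ} (hq : q ∈ W) :
    NormedSpace.exp (t • Y) * q * NormedSpace.exp (t • -Y) ∈ W := by
  let T : Matrix n n ℝ →ₗ[ℝ] Matrix n n ℝ :=
    LinearMap.mulLeft ℝ Y - LinearMap.mulRight ℝ Y
  obtain ⟨y, hy, hy0, hyd⟩ := exists_linear_flow_mem T (W := W) hW hq
  -- Conjugating the flow of `[Y, ·]` back by the exponential gives a constant curve, which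
  -- identifies that flow with conjugation.
  set k : ℝ → Matrix n n ℝ := fun s =>
    NormedSpace.exp (s • -Y) * y s * NormedSpace.exp (s • Y) with hk
  have hkd : ∀ s, HasDerivAt k 0 s := fun s => by
    have h := ((Matrix.hasDerivAt_exp_smul' (-Y) s).matrix_mul (hyd s)).matrix_mul
      (Matrix.hasDerivAt_exp_smul Y s)
    refine h.congr_deriv ?_
    have e : T (y s) = Y * y s - y s * Y := rfl
    simp only [e, Matrix.mul_sub, Matrix.mul_neg, Matrix.neg_mul, Matrix.add_mul, Matrix.sub_mul,
      Matrix.mul_assoc]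
    abel
  have hk0 : k t = q := by
    have := is_const_of_deriv_eq_zero (fun s => (hkd s).differentiableAt) (fun s => (hkd s).deriv)
      t 0
    rw [this]
    simp [hk, hy0]
  have e1 := Matrix.exp_smul_mul_exp_neg_smul Y t
  have : NormedSpace.exp (t • Y) * q * NormedSpace.exp (t • -Y) = y t := by
    rw [← hk0]
    simp only [hk]
    rw [Matrix.mul_assoc, Matrix.mul_assoc, e1, Matrix.mul_one, ← Matrix.mul_assoc, e1,
      Matrix.one_mul]
  rw [this]
  exact hy t

end MatrixExp

/-! ### The thirteen-dimensional group of a linearisable system -/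

namespace FirstOrderSystem

variable {S : FirstOrderSystem}

/-- The subgroup of `SL(6)` that normalizes a subspace of matrices. -/
def matrixNormalizer (W : Submodule ℝ Mat6) : Subgroup SL6 where
  carrier := {h | ∀ q, q ∈ W ↔ h.1 * q * (h⁻¹).1 ∈ W}
  one_mem' := fun q => by simp
  mul_mem' := fun {h k} hh hk q => by
    rw [hk q, hh, mul_inv_rev]
    simp only [Matrix.SpecialLinearGroup.coe_mul, Matrix.mul_assoc]
  inv_mem' := fun {h} hh q => by
    have e1 : h.1 * (h⁻¹).1 = 1 := congrArg Subtype.val (mul_inv_cancel h)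
    rw [hh (_ * _ * _), inv_inv]
    have : h.1 * ((h⁻¹).1 * q * h.1) * (h⁻¹).1 = (h.1 * (h⁻¹).1) * q * (h.1 * (h⁻¹).1) := by
      simp only [Matrix.mul_assoc]
    rw [this, e1, Matrix.one_mul, Matrix.mul_one]

theorem mem_lieAlgebraSet_matrixNormalizer {W : Submodule ℝ Mat6} {Y : Mat6} (h0 : Y.trace = 0)
    (hW : ∀ q ∈ W, Y * q - q * Y ∈ W) : Y ∈ lieAlgebraSet (matrixNormalizer W) := by
  intro t
  have e1 := Matrix.exp_smul_mul_exp_neg_smul Y t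
  have e2 := mul_eq_one_comm.1 e1
  let h : SL6 := ⟨NormedSpace.exp (t • Y), Matrix.det_exp_smul_of_trace_eq_zero h0 t⟩
  let k : SL6 := ⟨NormedSpace.exp (t • -Y), Matrix.det_exp_smul_of_trace_eq_zero
    (by rw [Matrix.trace_neg, h0, neg_zero]) t⟩
  have hk : h⁻¹ = k := inv_eq_of_mul_eq_one_right (Subtype.ext e1)
  refine ⟨h, fun q => ?_, rfl⟩
  rw [hk]
  refine ⟨fun hq => Matrix.exp_conj_mem hW t hq, fun hq => ?_⟩
  have h2 := Matrix.exp_conj_mem (Y := -Y) (fun q hq => by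
    have := W.neg_mem (hW q hq)
    rwa [neg_sub', ← Matrix.neg_mul, ← Matrix.mul_neg] at this) t hq
  rw [neg_neg] at h2
  have : NormedSpace.exp (t • -Y) * (NormedSpace.exp (t • Y) * q * NormedSpace.exp (t • -Y))
      * NormedSpace.exp (t • Y) = q := by
    have : NormedSpace.exp (t • -Y) * (NormedSpace.exp (t • Y) * q * NormedSpace.exp (t • -Y))
      * NormedSpace.exp (t • Y) = (NormedSpace.exp (t • -Y) * NormedSpace.exp (t • Y)) * q
        * (NormedSpace.exp (t • -Y) * NormedSpace.exp (t • Y)) := by simp only [Matrix.mul_assoc]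
    rw [this, e2, Matrix.one_mul, Matrix.mul_one]
  rwa [← this]

/-- The translations of the model linear system, extended by the dilation. -/
def modelTranslations : Submodule ℝ Mat6 where
  carrier := {q | ∃ (r : ℝ) (b : Matrix (Fin 2) (Fin 4) ℝ), contr b = 0 ∧
    q = Matrix.fromBlocks (r • 1) b 0 0}
  zero_mem' := ⟨0, 0, map_zero _, by rw [zero_smul, Matrix.fromBlocks_zero]⟩
  add_mem' := by
    rintro _ _ ⟨r, b, hb, rfl⟩ ⟨r', b', hb', rfl⟩
    refine ⟨r + r', b + b', by rw [map_add, hb, hb', add_zero], ?_⟩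
    rw [Matrix.fromBlocks_add, add_smul, add_zero, add_zero]
  smul_mem' := by
    rintro c _ ⟨r, b, hb, rfl⟩
    refine ⟨c * r, c • b, by rw [map_smul, hb, smul_zero], ?_⟩
    rw [Matrix.fromBlocks_smul, smul_smul, smul_zero, smul_zero]

theorem fromBlocks_mem_modelTranslations {A : Matrix (Fin 2) (Fin 2) ℝ}
    {B : Matrix (Fin 2) (Fin 4) ℝ} {C : Matrix (Fin 4) (Fin 2) ℝ} {D : Matrix (Fin 4) (Fin 4) ℝ}
    (hA : A = 0) (hC : C = 0) (hD : D = 0) (hB : contr B = 0) :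
    Matrix.fromBlocks A B C D ∈ modelTranslations :=
  ⟨0, B, hB, by rw [hA, hC, hD, zero_smul]⟩

/-- The dilation is what makes the normaliser small enough: normalising it forces the lower left
block to vanish and the translation part to be a translation of the model. Normalising the
translations takes care of the linear part. -/
theorem blocks_of_normalizes {h : Mat6} (hu : h.det ≠ 0)
    (hq : ∀ q ∈ modelTranslations, ∃ q' ∈ modelTranslations, h * q = q' * h) :
    h.toBlocks₂₁ = 0 ∧ h.toBlocks₂₂.det ≠ 0 ∧
      ∀ R, contr R = 0 → ∃ R', contr R' = 0 ∧
        h.toBlocks₁₁ * R + h.toBlocks₁₂ = R' * h.toBlocks₂₂ := by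
  obtain ⟨A, B, C, D, rfl⟩ : ∃ A B C D, h = Matrix.fromBlocks A B C D :=
    ⟨_, _, _, _, (Matrix.fromBlocks_toBlocks h).symm⟩
  simp only [Matrix.toBlocks_fromBlocks₁₁, Matrix.toBlocks_fromBlocks₁₂,
    Matrix.toBlocks_fromBlocks₂₁, Matrix.toBlocks_fromBlocks₂₂]
  have key : ∀ (r : ℝ) b, contr b = 0 → ∃ (r' : ℝ) (b' : Matrix (Fin 2) (Fin 4) ℝ), contr b' = 0 ∧
      r • A = r' • A + b' * C ∧ A * b = r' • B + b' * D ∧ r • C = 0 := by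
    intro r b hb
    obtain ⟨_, ⟨r', b', hb', rfl⟩, h⟩ := hq _ ⟨r, b, hb, rfl⟩
    rw [Matrix.fromBlocks_multiply, Matrix.fromBlocks_multiply, Matrix.fromBlocks_inj] at h
    simp only [Matrix.mul_smul, Matrix.smul_mul, Matrix.mul_one, Matrix.one_mul, Matrix.mul_zero,
      Matrix.zero_mul, add_zero] at h
    exact ⟨r', b', hb', h.1, h.2.1, h.2.2.1⟩
  have hC : C = 0 := by
    obtain ⟨-, -, -, -, -, h⟩ := key 1 0 (map_zero _)
    rwa [one_smul] at h
  subst hC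
  rw [Matrix.det_fromBlocks_zero₂₁] at hu
  have hA : A ≠ 0 := by
    rintro rfl
    simp at hu
  refine ⟨rfl, right_ne_zero_of_mul hu, fun R hR => ?_⟩
  obtain ⟨r, b, hb, h1, h2, -⟩ := key 0 R hR
  obtain ⟨r', b', hb', h1', h2', -⟩ := key 1 0 (map_zero _)
  rw [Matrix.mul_zero, add_zero] at h1 h1'
  rw [zero_smul, eq_comm, smul_eq_zero_iff_left hA] at h1
  rw [one_smul, eq_comm] at h1'
  have hr' : r' = 1 := by
    have : (r' - 1) • A = 0 := by rw [sub_smul, h1', one_smul, sub_self]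
    exact sub_eq_zero.1 ((smul_eq_zero_iff_left hA).1 this)
  rw [h1, zero_smul, zero_add] at h2
  rw [hr', one_smul, Matrix.mul_zero] at h2'
  refine ⟨b - b', by rw [map_sub, hb, hb', sub_zero], ?_⟩
  rw [h2, eq_neg_of_add_eq_zero_left h2'.symm, Matrix.sub_mul, sub_eq_add_neg]

/-- The trace-free infinitesimal symmetries of the model linear system. -/
def modelSymmetry : (Fin 13 → ℝ) →ₗ[ℝ] Mat6 where
  toFun x := Matrix.fromBlocks !![x 0, x 1; x 2, x 3]
    (modelJet (x 7) (x 8) (x 9) (x 10) (x 11) (x 12)) 0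
    !![x 4, x 1, x 5, 0; x 2, x 4 - x 0 + x 3, 0, x 5;
      x 6, 0, -x 4 + x 0 / 2 - 3 * x 3 / 2, x 1; 0, x 6, x 2, -x 4 - x 0 / 2 - x 3 / 2]
  map_add' x y := by
    rw [Matrix.fromBlocks_add]
    congr 1
    · ext i j
      fin_cases i <;> fin_cases j <;> simp
    · ext i j
      fin_cases i <;> fin_cases j <;> simp [modelJet] <;> ring
    · simp
    · ext i j
      fin_cases i <;> fin_cases j <;> simp <;> ring
  map_smul' r x := by
    rw [Matrix.fromBlocks_smul]
    congr 1
    · ext i j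
      fin_cases i <;> fin_cases j <;> simp
    · ext i j
      fin_cases i <;> fin_cases j <;> simp [modelJet]
    · simp
    · ext i j
      fin_cases i <;> fin_cases j <;> simp <;> ring

theorem modelSymmetry_injective : Function.Injective modelSymmetry := by
  rw [injective_iff_map_eq_zero]
  intro x hx
  have h1 := fun i j => congrFun (congrFun hx (Sum.inl i)) (Sum.inl j)
  have h2 := fun i j => congrFun (congrFun hx (Sum.inl i)) (Sum.inr j)
  have h3 := fun i j => congrFun (congrFun hx (Sum.inr i)) (Sum.inr j)
  have a0 := h1 0 0
  have a1 := h1 0 1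
  have a2 := h1 1 0
  have a3 := h1 1 1
  have a4 := h3 0 0
  have a5 := h3 0 2
  have a6 := h3 2 0
  have a7 := h2 0 0
  have a8 := h2 0 1
  have a9 := h2 1 0
  have a10 := h2 0 2
  have a11 := h2 0 3
  have a12 := h2 1 2
  simp only [modelSymmetry, LinearMap.coe_mk, AddHom.coe_mk, Matrix.fromBlocks_apply₁₁,
    Matrix.fromBlocks_apply₁₂, Matrix.fromBlocks_apply₂₂, Matrix.of_apply, Matrix.cons_val,
    modelJet_00, modelJet_01, modelJet_10, modelJet_02, modelJet_03, modelJet_12,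
    Matrix.zero_apply] at a0 a1 a2 a3 a4 a5 a6 a7 a8 a9 a10 a11 a12
  ext k
  fin_cases k <;> assumption

theorem trace_modelSymmetry (x : Fin 13 → ℝ) : (modelSymmetry x).trace = 0 := by
  simp [modelSymmetry, Matrix.trace, Fin.sum_univ_four]
  ring

theorem modelSymmetry_commutator (x : Fin 13 → ℝ) {q : Mat6} (hq : q ∈ modelTranslations) :
    modelSymmetry x * q - q * modelSymmetry x ∈ modelTranslations := by
  obtain ⟨r, b, hb, rfl⟩ := hq
  rw [eq_modelJet hb, modelSymmetry, LinearMap.coe_mk, AddHom.coe_mk, Matrix.fromBlocks_multiply,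
    Matrix.fromBlocks_multiply, sub_eq_add_neg, Matrix.fromBlocks_neg, Matrix.fromBlocks_add]
  refine fromBlocks_mem_modelTranslations (by simp only [Matrix.mul_smul, Matrix.smul_mul,
    Matrix.mul_one, Matrix.one_mul, Matrix.mul_zero, add_zero, add_neg_cancel]) (by simp) (by simp) ?_
  · ext k
    fin_cases k
    · simp only [Fin.zero_eta, contr_apply_zero, Matrix.neg_apply, Matrix.add_apply,
        Matrix.mul_apply, Fin.sum_univ_two, Fin.sum_univ_four, Matrix.of_apply, Matrix.cons_val,
        modelJet_00, modelJet_01, modelJet_02, modelJet_03, modelJet_10, modelJet_11, modelJet_12,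
        modelJet_13, Matrix.smul_apply, Matrix.one_apply, Matrix.zero_apply, Pi.zero_apply,
        smul_eq_mul]
      norm_num
      ring
    · simp only [Fin.mk_one, contr_apply_one, Matrix.neg_apply, Matrix.add_apply,
        Matrix.mul_apply, Fin.sum_univ_two, Fin.sum_univ_four, Matrix.of_apply, Matrix.cons_val,
        modelJet_00, modelJet_01, modelJet_02, modelJet_03, modelJet_10, modelJet_11, modelJet_12,
        modelJet_13, Matrix.smul_apply, Matrix.one_apply, Matrix.zero_apply, Pi.zero_apply,
        smul_eq_mul]
      norm_num
      ring

/-- The numerator for an arbitrary matrix. -/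
def numMat (X : Mat6) (U : JetSpace) : Matrix (Fin 2) (Fin 4) ℝ :=
  X.toBlocks₁₁ * Matrix.of U + X.toBlocks₁₂

/-- The denominator for an arbitrary matrix. -/
def denMat (X : Mat6) (U : JetSpace) : Matrix (Fin 4) (Fin 4) ℝ :=
  X.toBlocks₂₁ * Matrix.of U + X.toBlocks₂₂

theorem numMat_mul (X Y : Mat6) (U : JetSpace) :
    numMat (X * Y) U = X.toBlocks₁₁ * numMat Y U + X.toBlocks₁₂ * denMat Y U := by
  rw [← Matrix.fromBlocks_toBlocks X, ← Matrix.fromBlocks_toBlocks Y, Matrix.fromBlocks_multiply]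
  simp only [numMat, denMat, Matrix.toBlocks_fromBlocks₁₁, Matrix.toBlocks_fromBlocks₁₂,
    Matrix.toBlocks_fromBlocks₂₁, Matrix.toBlocks_fromBlocks₂₂, Matrix.mul_add, Matrix.add_mul,
    Matrix.mul_assoc]
  abel

theorem denMat_mul (X Y : Mat6) (U : JetSpace) :
    denMat (X * Y) U = X.toBlocks₂₁ * numMat Y U + X.toBlocks₂₂ * denMat Y U := by
  rw [← Matrix.fromBlocks_toBlocks X, ← Matrix.fromBlocks_toBlocks Y, Matrix.fromBlocks_multiply]
  simp only [numMat, denMat, Matrix.toBlocks_fromBlocks₁₁, Matrix.toBlocks_fromBlocks₁₂,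
    Matrix.toBlocks_fromBlocks₂₁, Matrix.toBlocks_fromBlocks₂₂, Matrix.mul_add, Matrix.add_mul,
    Matrix.mul_assoc]
  abel

theorem numMat_act (X : Mat6) {h : SL6} {U : JetSpace} (hu : IsUnit (denom h U).det) :
    numMat (X * h.1) U = numMat X (act h U) * denom h U := by
  have h1 : numMat h.1 U = Matrix.of (act h U) * denom h U := (of_act_mul_denom hu).symm
  have h2 : denMat h.1 U = denom h U := rfl
  rw [numMat_mul, h1, h2, numMat, Matrix.add_mul, Matrix.mul_assoc]

theorem denMat_act (X : Mat6) {h : SL6} {U : JetSpace} (hu : IsUnit (denom h U).det) :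
    denMat (X * h.1) U = denMat X (act h U) * denom h U := by
  have h1 : numMat h.1 U = Matrix.of (act h U) * denom h U := (of_act_mul_denom hu).symm
  have h2 : denMat h.1 U = denom h U := rfl
  rw [denMat_mul, h1, h2, denMat, Matrix.add_mul, Matrix.mul_assoc]

/-- The transformation to the model linear system. -/
def toModel (g : SL6) (E : Matrix (Fin 4) (Fin 4) ℝ) (m : Fin 2 → ℝ) : Mat6 :=
  Matrix.fromBlocks 1 (contrSection m * E⁻¹) 0 E⁻¹ * g.1

section ToModel

variable {g : SL6} {E : Matrix (Fin 4) (Fin 4) ℝ} {m : Fin 2 → ℝ}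

theorem det_toModel (hE : IsUnit E.det) : (toModel g E m).det ≠ 0 := by
  rw [toModel, Matrix.det_mul, g.2, Matrix.det_fromBlocks_zero₂₁, Matrix.det_one, one_mul, mul_one]
  exact (Matrix.isUnit_nonsing_inv_det _ hE).ne_zero

theorem denMat_toModel (U : JetSpace) : denMat (toModel g E m) U = E⁻¹ * denom g U := by
  rw [toModel, denMat_mul, Matrix.toBlocks_fromBlocks₂₁, Matrix.toBlocks_fromBlocks₂₂,
    Matrix.zero_mul, zero_add]
  rfl

theorem numMat_toModel (hE : IsUnit E.det) {U : JetSpace} (hu : IsUnit (denom g U).det) :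
    numMat (toModel g E m) U
      = (Matrix.of (act g U) * E + contrSection m) * denMat (toModel g E m) U := by
  have h1 : numMat g.1 U = Matrix.of (act g U) * denom g U := (of_act_mul_denom hu).symm
  have h2 : denMat g.1 U = denom g U := rfl
  rw [denMat_toModel, toModel, numMat_mul, Matrix.toBlocks_fromBlocks₁₁,
    Matrix.toBlocks_fromBlocks₁₂, h1, h2, Matrix.add_mul, ← Matrix.mul_assoc (_ * E),
    Matrix.mul_nonsing_inv_cancel_right _ _ hE, Matrix.one_mul, ← Matrix.mul_assoc]

theorem isUnit_denMat_toModel (hE : IsUnit E.det) {U : JetSpace} (hu : IsUnit (denom g U).det) :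
    IsUnit (denMat (toModel g E m) U).det := by
  rw [denMat_toModel, Matrix.det_mul]
  exact (Matrix.isUnit_nonsing_inv_det _ hE).mul hu

/-- The translations of the linear system in the original coordinates. -/
def pulledTranslations (M : Mat6) : Submodule ℝ Mat6 :=
  modelTranslations.comap (LinearMap.mulRight ℝ M⁻¹ ∘ₗ LinearMap.mulLeft ℝ M)

theorem mem_pulledTranslations {M q : Mat6} :
    q ∈ pulledTranslations M ↔ M * q * M⁻¹ ∈ modelTranslations := Iff.rfl

/-- After conjugation by `toModel` the element normalises the model translations, hence acts
affinely and preserves the solutions of `contr = 0`. -/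
theorem contr_act_of_mem_normalizer (hE : IsUnit E.det) {h : SL6}
    (hh : h ∈ matrixNormalizer (pulledTranslations (toModel g E m))) {U : JetSpace}
    (hgU : IsUnit (denom g U).det) (hU : IsUnit (denom h U).det)
    (hgU' : IsUnit (denom g (act h U)).det)
    (hlin : contr (Matrix.of (act g U) * E) + m = 0) :
    contr (Matrix.of (act g (act h U)) * E) + m = 0 := by
  set M := toModel g E m with hM
  have hMu : IsUnit M.det := isUnit_iff_ne_zero.2 (det_toModel hE)
  have hinv : h.1 * (h⁻¹).1 = 1 := congrArg Subtype.val (mul_inv_cancel h)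
  have hinv' : (h⁻¹).1 * h.1 = 1 := congrArg Subtype.val (inv_mul_cancel h)
  have hconj : M * h.1 * M⁻¹ * M = M * h.1 := Matrix.nonsing_inv_mul_cancel_right _ _ hMu
  obtain ⟨hC, -, hR⟩ := blocks_of_normalizes (h := M * h.1 * M⁻¹)
    (by
      rw [Matrix.det_mul, Matrix.det_mul, h.2, mul_one]
      exact mul_ne_zero hMu.ne_zero (Matrix.isUnit_nonsing_inv_det _ hMu).ne_zero)
    (by
      intro q hq
      have h1 : M⁻¹ * q * M ∈ pulledTranslations M := by
        rw [mem_pulledTranslations]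
        have : M * (M⁻¹ * q * M) * M⁻¹ = (M * M⁻¹) * q * (M * M⁻¹) := by
          simp only [Matrix.mul_assoc]
        rwa [this, Matrix.mul_nonsing_inv _ hMu, Matrix.one_mul, Matrix.mul_one]
      refine ⟨_, (hh _).1 h1, ?_⟩
      have : M * (h.1 * (M⁻¹ * q * M) * (h⁻¹).1) * M⁻¹ * (M * h.1 * M⁻¹)
          = M * h.1 * M⁻¹ * q * M * (h⁻¹).1 * (M⁻¹ * M) * h.1 * M⁻¹ := by
        simp only [Matrix.mul_assoc]
      change _ = M * (h.1 * (M⁻¹ * q * M) * (h⁻¹).1) * M⁻¹ * (M * h.1 * M⁻¹)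
      rw [this, Matrix.nonsing_inv_mul _ hMu, Matrix.mul_one, Matrix.mul_assoc _ (h⁻¹).1, hinv',
        Matrix.mul_one, Matrix.mul_nonsing_inv_cancel_right _ _ hMu])
  obtain ⟨R', hR', hRD⟩ := hR (Matrix.of (act g U) * E + contrSection m)
    (by rw [map_add, contr_contrSection, hlin])
  set A := (M * h.1 * M⁻¹).toBlocks₁₁
  set B := (M * h.1 * M⁻¹).toBlocks₁₂
  set D := (M * h.1 * M⁻¹).toBlocks₂₂
  have n1 := numMat_act M hU
  have d1 := denMat_act M hU
  rw [← hconj, numMat_mul] at n1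
  rw [← hconj, denMat_mul, hC, Matrix.zero_mul, zero_add] at d1
  rw [numMat_toModel hE hgU, numMat_toModel hE hgU', ← hM, ← Matrix.mul_assoc, ← Matrix.add_mul,
    hRD, Matrix.mul_assoc, d1, Matrix.mul_assoc] at n1
  have hu : IsUnit (denMat M (act h U) * denom h U).det := by
    rw [Matrix.det_mul]
    exact (isUnit_denMat_toModel hE hgU').mul hU
  have n2 := congrArg (· * (denMat M (act h U) * denom h U)⁻¹) n1
  simp only [Matrix.mul_nonsing_inv_cancel_right _ _ hu] at n2
  rw [← contr_contrSection m, ← map_add, ← n2, hR']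

end ToModel

/-- The normaliser is automatically a subgroup, and the bracket decides which generators lie in it.
Its dimension is bounded above by `symmetryCoords_injective` and below by the conjugates of
`modelSymmetry`. -/
theorem Linearisable.exists_invariantUnder (hne : S.locus.Nonempty) (hnd : S.Nondegenerate)
    (hlin : S.Linearisable) : ∃ G : Subgroup SL6, lieDim G = 13 ∧ S.InvariantUnder G := by
  obtain ⟨g, E, m, hE, h⟩ := hlin.exists_frame hne hnd
  set M := toModel g E m with hM
  have hMu : IsUnit M.det := isUnit_iff_ne_zero.2 (det_toModel hE)
  have hinv : S.InvariantUnder (matrixNormalizer (pulledTranslations M)) := by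
    intro Y hY U hU
    choose k hkG hk using hY
    obtain ⟨hgU, hev, -⟩ := h U hU
    have hden : ∀ᶠ t in 𝓝 (0 : ℝ), (denom (k t) U).det ≠ 0 := by
      refine (continuousAt_det_denom_exp hk U).eventually_ne ?_
      rw [denom_exp_zero hk, Matrix.det_one]
      exact one_ne_zero
    have hact : Filter.Tendsto (fun t => act (k t) U) (𝓝 0) (𝓝 U) := by
      have h1 := (hasDerivAt_act_exp hk U).continuousAt.tendsto
      rwa [act_exp_zero hk] at h1
    have hgden : ∀ᶠ U' in 𝓝 U, (denom g U').det ≠ 0 :=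
      (continuous_denom g).matrix_det.continuousAt.eventually_ne hgU.ne_zero
    filter_upwards [hden, hact.eventually hev, hact.eventually hgden] with t h1 h2 h3 h' hh'
    have : h' = k t := Subtype.ext (hh'.trans (hk t).symm)
    rw [this]
    refine ⟨isUnit_iff_ne_zero.2 h1, h2.2 ?_⟩
    exact contr_act_of_mem_normalizer hE (hkG t) hgU (isUnit_iff_ne_zero.2 h1)
      (isUnit_iff_ne_zero.2 h3) (hev.self_of_nhds.1 hU)
  refine ⟨_, le_antisymm ?_ ?_, hinv⟩
  · obtain ⟨o, ho⟩ := hne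
    have h1 := LinearMap.finrank_le_finrank_of_injective (symmetryCoords_injective hnd ho)
    rw [Module.finrank_fin_fun] at h1
    exact (Submodule.finrank_mono (span_lieAlgebraSet_le hinv)).trans h1
  · let φ : (Fin 13 → ℝ) →ₗ[ℝ] Mat6 :=
      (LinearMap.mulRight ℝ M ∘ₗ LinearMap.mulLeft ℝ M⁻¹) ∘ₗ modelSymmetry
    have hφ : ∀ x, φ x = M⁻¹ * modelSymmetry x * M := fun x => rfl
    have hMφ : ∀ x, M * φ x = modelSymmetry x * M := fun x => by
      rw [hφ, Matrix.mul_assoc, Matrix.mul_nonsing_inv_cancel_left _ _ hMu]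
    have hφM : ∀ x, φ x * M⁻¹ = M⁻¹ * modelSymmetry x := fun x => by
      rw [hφ, Matrix.mul_nonsing_inv_cancel_right _ _ hMu]
    have hinj : Function.Injective φ := fun x y hxy => modelSymmetry_injective (by
      have := congrArg (fun Z => M * Z * M⁻¹) hxy
      simpa only [hMφ, Matrix.mul_nonsing_inv_cancel_right _ _ hMu] using this)
    have hle : LinearMap.range φ ≤
        Submodule.span ℝ (lieAlgebraSet (matrixNormalizer (pulledTranslations M))) := by
      rintro _ ⟨x, rfl⟩
      refine Submodule.subset_span (mem_lieAlgebraSet_matrixNormalizer ?_ ?_)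
      · rw [hφ, Matrix.trace_mul_comm, ← Matrix.mul_assoc, Matrix.mul_nonsing_inv _ hMu,
          Matrix.one_mul, trace_modelSymmetry]
      · intro q hq
        rw [mem_pulledTranslations] at hq ⊢
        have := modelSymmetry_commutator x hq
        have e : M * (φ x * q - q * φ x) * M⁻¹
            = modelSymmetry x * (M * q * M⁻¹) - M * q * M⁻¹ * modelSymmetry x := by
          rw [Matrix.mul_sub, Matrix.sub_mul, ← Matrix.mul_assoc, hMφ, ← Matrix.mul_assoc M q,
            Matrix.mul_assoc (M * q), hφM]
          simp only [Matrix.mul_assoc]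
        rwa [e]
    have := Submodule.finrank_mono hle
    rwa [LinearMap.finrank_range_of_inj hinj, Module.finrank_fin_fun] at this

end FirstOrderSystem

/-! ### Partial derivatives of functions and matrices -/

namespace FirstOrderSystem

section PartialDeriv

variable {φ χ : Base → ℝ} {x : Base} {D : Set Base}

theorem partialDeriv_add (hφ : DifferentiableAt ℝ φ x) (hχ : DifferentiableAt ℝ χ x) (k : Fin 4) :
    partialDeriv k (fun y => φ y + χ y) x = partialDeriv k φ x + partialDeriv k χ x := by
  rw [partialDeriv, fderiv_fun_add hφ hχ]
  rfl

theorem partialDeriv_sub (hφ : DifferentiableAt ℝ φ x) (hχ : DifferentiableAt ℝ χ x) (k : Fin 4) :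
    partialDeriv k (fun y => φ y - χ y) x = partialDeriv k φ x - partialDeriv k χ x := by
  rw [partialDeriv, fderiv_fun_sub hφ hχ]
  rfl

theorem partialDeriv_mul (hφ : DifferentiableAt ℝ φ x) (hχ : DifferentiableAt ℝ χ x) (k : Fin 4) :
    partialDeriv k (fun y => φ y * χ y) x
      = partialDeriv k φ x * χ x + φ x * partialDeriv k χ x := by
  rw [partialDeriv, fderiv_fun_mul hφ hχ]
  simp only [_root_.add_apply, _root_.smul_apply, smul_eq_mul, partialDeriv]
  ring

theorem partialDeriv_sum {ι : Type*} {s : Finset ι} {φ : ι → Base → ℝ}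
    (hφ : ∀ i ∈ s, DifferentiableAt ℝ (φ i) x) (k : Fin 4) :
    partialDeriv k (fun y => ∑ i ∈ s, φ i y) x = ∑ i ∈ s, partialDeriv k (φ i) x := by
  rw [partialDeriv, fderiv_fun_sum hφ, _root_.sum_apply]
  rfl

theorem partialDeriv_const (c : ℝ) (k : Fin 4) : partialDeriv k (fun _ => c) x = 0 := by
  rw [partialDeriv, fderiv_fun_const]
  rfl

theorem partialDeriv_const_mul (hφ : DifferentiableAt ℝ φ x) (c : ℝ) (k : Fin 4) :
    partialDeriv k (fun y => c * φ y) x = c * partialDeriv k φ x := by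
  rw [partialDeriv_mul (differentiableAt_const c) hφ, partialDeriv_const, zero_mul, zero_add]

theorem partialDeriv_congr (h : φ =ᶠ[𝓝 x] χ) (k : Fin 4) :
    partialDeriv k φ x = partialDeriv k χ x := by
  rw [partialDeriv, partialDeriv, h.fderiv_eq]

theorem partialDeriv_congr_of_isOpen (hD : IsOpen D) (h : ∀ y ∈ D, φ y = χ y) (hx : x ∈ D)
    (k : Fin 4) : partialDeriv k φ x = partialDeriv k χ x :=
  partialDeriv_congr (Filter.eventually_of_mem (hD.mem_nhds hx) h) k

theorem contDiffOn_partialDeriv (hD : IsOpen D) (hφ : ContDiffOn ℝ ∞ φ D) (k : Fin 4) :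
    ContDiffOn ℝ ∞ (partialDeriv k φ) D := fun y hy =>
  (((hφ.contDiffAt (hD.mem_nhds hy)).fderiv_right (m := ∞) (by simp)).clm_apply
    contDiffAt_const).contDiffWithinAt

theorem partialDeriv_comm (hD : IsOpen D) (hφ : ContDiffOn ℝ ∞ φ D) (hx : x ∈ D) (k l : Fin 4) :
    partialDeriv k (partialDeriv l φ) x = partialDeriv l (partialDeriv k φ) x := by
  have hc := hφ.contDiffAt (hD.mem_nhds hx)
  have hd := ((hc.fderiv_right (m := ∞) (by simp)).differentiableAt (by simp)).hasFDerivAt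
  have h : ∀ k l, partialDeriv k (partialDeriv l φ) x
      = fderiv ℝ (fderiv ℝ φ) x (Pi.single k 1) (Pi.single l 1) := fun k l => by
    have := hd.clm_apply (hasFDerivAt_const (Pi.single l 1 : Base) x)
    change fderiv ℝ (fun y => fderiv ℝ φ y (Pi.single l 1)) x (Pi.single k 1) = _
    rw [this.fderiv]
    simp
  rw [h, h]
  exact hc.isSymmSndFDerivAt
    (by rw [minSmoothness_of_isRCLikeNormedField]; exact ENat.LEInfty.out) _ _

theorem _root_.ContDiffOn.differentiableAt_of_isOpen (hφ : ContDiffOn ℝ ∞ φ D) (hD : IsOpen D)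
    (hx : x ∈ D) : DifferentiableAt ℝ φ x :=
  (hφ.contDiffAt (hD.mem_nhds hx)).differentiableAt (by simp)

/-- A matrix of functions smooth on a set. -/
def SmoothMat {m n : Type*} (A : Base → Matrix m n ℝ) (D : Set Base) : Prop :=
  ∀ i j, ContDiffOn ℝ ∞ (fun y => A y i j) D

/-- The entrywise partial derivative of a matrix function. -/
def matDeriv {m n : Type*} (k : Fin 4) (A : Base → Matrix m n ℝ) (x : Base) : Matrix m n ℝ :=
  Matrix.of fun i j => partialDeriv k (fun y => A y i j) x

variable {l m n : Type*} {A A' : Base → Matrix l m ℝ} {B : Base → Matrix m n ℝ}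

theorem SmoothMat.mul [Fintype m] (hA : SmoothMat A D) (hB : SmoothMat B D) :
    SmoothMat (fun y => A y * B y) D := fun i j => by
  simp only [Matrix.mul_apply]
  exact ContDiffOn.sum fun k _ => (hA i k).mul (hB k j)

theorem SmoothMat.add (hA : SmoothMat A D) (hA' : SmoothMat A' D) :
    SmoothMat (fun y => A y + A' y) D := fun i j => (hA i j).add (hA' i j)

theorem SmoothMat.matDeriv (hD : IsOpen D) (hA : SmoothMat A D) (k : Fin 4) :
    SmoothMat (matDeriv k A) D := fun i j => contDiffOn_partialDeriv hD (hA i j) k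

theorem SmoothMat.inv [Fintype m] [DecidableEq m] {A : Base → Matrix m m ℝ} (hD : IsOpen D)
    (hA : SmoothMat A D) (hdet : ∀ y ∈ D, (A y).det ≠ 0) : SmoothMat (fun y => (A y)⁻¹) D :=
  fun i j y hy => (ContDiffAt.matrix_inv (fun i j => (hA i j).contDiffAt (hD.mem_nhds hy))
    (hdet y hy) i j).contDiffWithinAt

theorem matDeriv_mul [Fintype m] (hD : IsOpen D) (hA : SmoothMat A D) (hB : SmoothMat B D) (hx : x ∈ D)
    (k : Fin 4) :
    matDeriv k (fun y => A y * B y) x = matDeriv k A x * B x + A x * matDeriv k B x := by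
  ext i j
  simp only [matDeriv, Matrix.of_apply, Matrix.mul_apply, Matrix.add_apply]
  rw [partialDeriv_sum (fun c _ => ((hA i c).differentiableAt_of_isOpen hD hx).fun_mul
    ((hB c j).differentiableAt_of_isOpen hD hx)), ← Finset.sum_add_distrib]
  exact Finset.sum_congr rfl fun c _ => partialDeriv_mul
    ((hA i c).differentiableAt_of_isOpen hD hx) ((hB c j).differentiableAt_of_isOpen hD hx) k

theorem matDeriv_add (hD : IsOpen D) (hA : SmoothMat A D) (hA' : SmoothMat A' D) (hx : x ∈ D)
    (k : Fin 4) : matDeriv k (fun y => A y + A' y) x = matDeriv k A x + matDeriv k A' x := by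
  ext i j
  exact partialDeriv_add ((hA i j).differentiableAt_of_isOpen hD hx)
    ((hA' i j).differentiableAt_of_isOpen hD hx) k

theorem matDeriv_congr (hD : IsOpen D) (h : ∀ y ∈ D, A y = A' y) (hx : x ∈ D) (k : Fin 4) :
    matDeriv k A x = matDeriv k A' x := by
  ext i j
  exact partialDeriv_congr_of_isOpen hD (fun y hy => by rw [h y hy]) hx k

theorem matDeriv_comm (hD : IsOpen D) (hA : SmoothMat A D) (hx : x ∈ D) (k l : Fin 4) :
    matDeriv k (matDeriv l A) x = matDeriv l (matDeriv k A) x := by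
  ext i j
  exact partialDeriv_comm hD (hA i j) hx k l

end PartialDeriv

end FirstOrderSystem

/-! ### An algebraic criterion for a vanishing Weyl tensor -/

namespace Curvature

open FirstOrderSystem

variable {g : Base → Matrix (Fin 4) (Fin 4) ℝ} {x : Base} {D : Set Base}

/-- A curvature tensor that is the Kulkarni–Nomizu product of the metric with some tensor has no
Weyl part. -/
theorem weyl_eq_zero_of_riemann (hs : (g x)ᵀ = g x) (hdet : IsUnit (g x).det)
    {P : Matrix (Fin 4) (Fin 4) ℝ} (hR : ∀ i j k l, riemann g i j k l x
      = g x i l * P k j - g x i k * P l j - P k i * g x j l + P l i * g x j k)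
    (i j k l : Fin 4) : weyl g i j k l x = 0 := by
  have hsym : ∀ i j, g x i j = g x j i := fun i j => congrFun (congrFun hs j) i
  have hinv : ∀ i j, ∑ s, (g x)⁻¹ i s * g x s j = if i = j then 1 else 0 := fun i j => by
    rw [← Matrix.mul_apply, Matrix.nonsing_inv_mul _ hdet, Matrix.one_apply]
  have hup : ∀ i j k l, riemannUp g i j k l x = ∑ s, (g x)⁻¹ i s * riemann g s j k l x := by
    intro i j k l
    have h1 : (fun s => riemann g s j k l x) = g x *ᵥ fun s => riemannUp g s j k l x := by
      funext s
      rfl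
    have h2 : (g x)⁻¹ *ᵥ (fun s => riemann g s j k l x) = fun s => riemannUp g s j k l x := by
      rw [h1, Matrix.mulVec_mulVec, Matrix.nonsing_inv_mul _ hdet, Matrix.one_mulVec]
    exact (congrFun h2 i).symm
  set p : ℝ := ∑ i, ∑ s, (g x)⁻¹ i s * P i s with hp
  have htr : ∑ i, ∑ s, (g x)⁻¹ i s * g x s i = 4 := by
    simp [hinv]
  -- With the scalar curvature `-6p` this makes the Schouten tensor the negative of `P`, with
  -- transposed indices, so the Weyl tensor cancels.
  have hric : ∀ j l, ricci g j l x = -p * g x j l - 2 * P l j := by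
    intro j l
    have h1 : ricci g j l x = ∑ i, ∑ s, ((g x)⁻¹ i s * g x s l * P i j
        - (g x)⁻¹ i s * g x s i * P l j - (g x)⁻¹ i s * P i s * g x j l
        + P l s * ((g x)⁻¹ i s * g x j i)) := by
      simp only [ricci, hup, hR]
      exact Finset.sum_congr rfl fun i _ => Finset.sum_congr rfl fun s _ => by ring
    have h2 : ∑ i, ∑ s, P l s * ((g x)⁻¹ i s * g x j i) = P l j := by
      rw [Finset.sum_comm]
      have : ∀ s, ∑ i, (g x)⁻¹ i s * g x j i = if j = s then 1 else 0 := fun s => by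
        have h3 : ∑ i, g x j i * (g x)⁻¹ i s = if j = s then 1 else 0 := by
          rw [← Matrix.mul_apply, Matrix.mul_nonsing_inv _ hdet, Matrix.one_apply]
        rw [← h3]
        exact Finset.sum_congr rfl fun i _ => mul_comm _ _
      simp only [← Finset.mul_sum, this]
      simp
    rw [h1]
    simp only [Finset.sum_add_distrib, Finset.sum_sub_distrib, ← Finset.sum_mul, hinv, h2, ← hp]
    simp
    ring
  have hsc : scalar g x = -6 * p := by
    have h1 : scalar g x = ∑ j, ∑ l, (-p * ((g x)⁻¹ j l * g x l j) - 2 * ((g x)⁻¹ j l * P l j)) := by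
      simp only [scalar, hric]
      exact Finset.sum_congr rfl fun j _ => Finset.sum_congr rfl fun l _ => by
        rw [hsym l j]; ring
    have hinvs : ((g x)⁻¹)ᵀ = (g x)⁻¹ := by rw [Matrix.transpose_nonsing_inv, hs]
    have h2 : ∑ j, ∑ l, (g x)⁻¹ j l * P l j = p := by
      rw [Finset.sum_comm]
      exact Finset.sum_congr rfl fun l _ => Finset.sum_congr rfl fun j _ => by
        rw [show (g x)⁻¹ j l = (g x)⁻¹ l j from congrFun (congrFun hinvs l) j]
    rw [h1]
    simp only [Finset.sum_sub_distrib, ← Finset.mul_sum, htr, h2]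
    ring
  simp only [weyl, schouten, hric, hsc, hR]
  rw [hsym j k, hsym j l]
  ring

end Curvature

/-! ### Conformally flat metrics have no Weyl tensor -/

namespace Curvature

open FirstOrderSystem

/-- The metric `g` is `f` times the pullback of the constant metric `η` by a map with Jacobian `J`. -/
structure ConformallyFlatOn (g J : Base → Matrix (Fin 4) (Fin 4) ℝ) (f : Base → ℝ)
    (η : Matrix (Fin 4) (Fin 4) ℝ) (D : Set Base) : Prop where
  isOpen : IsOpen D
  smooth_J : SmoothMat J D
  smooth_f : ContDiffOn ℝ ∞ f D
  f_ne : ∀ y ∈ D, f y ≠ 0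
  det_J : ∀ y ∈ D, (J y).det ≠ 0
  closed : ∀ y ∈ D, ∀ k a j,
    partialDeriv k (fun y => J y a j) y = partialDeriv j (fun y => J y a k) y
  symm : ηᵀ = η
  det_η : η.det ≠ 0
  eq : ∀ y ∈ D, g y = f y • ((J y)ᵀ * η * J y)

namespace ConformallyFlatOn

/-- The differential of `log f / 2`. -/
def factorForm (f : Base → ℝ) (y : Base) (k : Fin 4) : ℝ :=
  partialDeriv k (fun y => Real.log (f y) / 2) y

/-- The gradient of `log f / 2` in the flat coordinates. -/
def flatGradient (J : Base → Matrix (Fin 4) (Fin 4) ℝ) (f : Base → ℝ)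
    (η : Matrix (Fin 4) (Fin 4) ℝ) (y : Base) : Fin 4 → ℝ := factorForm f y ᵥ* (η * J y)⁻¹

/-- The connection form in the flat frame. -/
def gaugeForm (J : Base → Matrix (Fin 4) (Fin 4) ℝ) (f : Base → ℝ) (η : Matrix (Fin 4) (Fin 4) ℝ)
    (k : Fin 4) (y : Base) : Matrix (Fin 4) (Fin 4) ℝ :=
  factorForm f y k • 1 + Matrix.vecMulVec (fun a => J y a k) (η *ᵥ flatGradient J f η y)
    - Matrix.vecMulVec (flatGradient J f η y) (fun a => (η * J y) a k)

variable {g J : Base → Matrix (Fin 4) (Fin 4) ℝ} {f : Base → ℝ} {η : Matrix (Fin 4) (Fin 4) ℝ}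
  {D : Set Base} {x : Base}

theorem smooth_log (h : ConformallyFlatOn g J f η D) :
    ContDiffOn ℝ ∞ (fun y => Real.log (f y) / 2) D :=
  (h.smooth_f.log h.f_ne).div_const 2

theorem smooth_factorForm (h : ConformallyFlatOn g J f η D) (k : Fin 4) :
    ContDiffOn ℝ ∞ (fun y => factorForm f y k) D := contDiffOn_partialDeriv h.isOpen h.smooth_log k

/-- The factor may be negative: `Real.log` is the logarithm of the absolute value, and its
derivative is `f'/f` for either sign. -/
theorem partialDeriv_factor (h : ConformallyFlatOn g J f η D) (hx : x ∈ D) (k : Fin 4) :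
    partialDeriv k f x = 2 * f x * factorForm f x k := by
  have hd : DifferentiableAt ℝ f x := h.smooth_f.differentiableAt_of_isOpen h.isOpen hx
  have h1 : HasFDerivAt (fun y => Real.log (f y) / 2) ((2 : ℝ)⁻¹ • ((f x)⁻¹ • fderiv ℝ f x)) x := by
    have := (hd.hasFDerivAt.log (h.f_ne x hx)).const_smul (2 : ℝ)⁻¹
    refine this.congr_of_eventuallyEq (Filter.Eventually.of_forall fun y => ?_)
    simp only [Pi.smul_apply, smul_eq_mul]
    ring
  have h0 := h.f_ne x hx
  rw [factorForm, partialDeriv, partialDeriv, h1.fderiv]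
  simp only [_root_.smul_apply, smul_eq_mul]
  field_simp

theorem smooth_coframe (h : ConformallyFlatOn g J f η D) : SmoothMat (fun y => η * J y) D :=
  SmoothMat.mul (fun _ _ => contDiffOn_const) h.smooth_J

theorem det_coframe (h : ConformallyFlatOn g J f η D) (hx : x ∈ D) : (η * J x).det ≠ 0 := by
  rw [Matrix.det_mul]
  exact mul_ne_zero h.det_η (h.det_J x hx)

theorem matDeriv_coframe (h : ConformallyFlatOn g J f η D) (hx : x ∈ D) (k : Fin 4) :
    matDeriv k (fun y => η * J y) x = η * matDeriv k J x := by
  rw [matDeriv_mul (A := fun _ => η) h.isOpen (fun _ _ => contDiffOn_const) h.smooth_J hx]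
  have : matDeriv k (fun _ => η) x = 0 := by
    ext i j
    exact partialDeriv_const _ _
  rw [this, Matrix.zero_mul, zero_add]

theorem closed_coframe (h : ConformallyFlatOn g J f η D) (hx : x ∈ D) (k a j : Fin 4) :
    partialDeriv k (fun y => (η * J y) a j) x = partialDeriv j (fun y => (η * J y) a k) x := by
  have h1 := congrFun (congrFun (h.matDeriv_coframe hx k) a) j
  have h2 := congrFun (congrFun (h.matDeriv_coframe hx j) a) k
  simp only [matDeriv, Matrix.of_apply] at h1 h2
  rw [h1, h2, Matrix.mul_apply, Matrix.mul_apply]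
  exact Finset.sum_congr rfl fun b _ => by rw [Matrix.of_apply, Matrix.of_apply, h.closed x hx]

theorem smooth_flatGradient (h : ConformallyFlatOn g J f η D) (a : Fin 4) :
    ContDiffOn ℝ ∞ (fun y => flatGradient J f η y a) D := by
  have h1 := h.smooth_coframe.inv h.isOpen fun y hy => h.det_coframe hy
  exact ContDiffOn.sum (s := Finset.univ) fun k _ => (h.smooth_factorForm k).mul (h1 k a)

theorem flatGradient_vecMul (h : ConformallyFlatOn g J f η D) (hx : x ∈ D) :
    flatGradient J f η x ᵥ* (η * J x) = factorForm f x := by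
  rw [flatGradient, Matrix.vecMul_vecMul,
    Matrix.nonsing_inv_mul _ (isUnit_iff_ne_zero.2 (h.det_coframe hx)), Matrix.vecMul_one]

theorem mulVec_flatGradient_vecMul (h : ConformallyFlatOn g J f η D) (hx : x ∈ D) :
    (η *ᵥ flatGradient J f η x) ᵥ* J x = factorForm f x := by
  rw [← h.flatGradient_vecMul hx, ← Matrix.vecMul_vecMul, ← Matrix.mulVec_transpose η, h.symm]

theorem smooth_gaugeForm (h : ConformallyFlatOn g J f η D) (k : Fin 4) :
    SmoothMat (gaugeForm J f η k) D := by
  intro a b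
  have h1 : ContDiffOn ℝ ∞ (fun y => (η *ᵥ flatGradient J f η y) b) D :=
    ContDiffOn.sum (s := Finset.univ) fun c _ =>
      contDiffOn_const.mul (h.smooth_flatGradient c)
  exact (((h.smooth_factorForm k).mul contDiffOn_const).add ((h.smooth_J a k).mul h1)).sub
    ((h.smooth_flatGradient a).mul (h.smooth_coframe b k))

theorem partialDeriv_metric (h : ConformallyFlatOn g J f η D) (hx : x ∈ D) (k s j : Fin 4) :
    partialDeriv k (fun y => g y s j) x = f x * (2 * factorForm f x k * ((η * J x)ᵀ * J x) s j
      + ((η * J x)ᵀ * matDeriv k J x) j s + ((η * J x)ᵀ * matDeriv k J x) s j) := by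
  have hg : ∀ y ∈ D, g y s j = f y * ((η * J y)ᵀ * J y) s j := fun y hy => by
    rw [h.eq y hy, Matrix.transpose_mul, h.symm]
    rfl
  have hKt : SmoothMat (fun y => (η * J y)ᵀ) D := fun a b => h.smooth_coframe b a
  have hm := hKt.mul h.smooth_J
  rw [partialDeriv_congr_of_isOpen h.isOpen hg hx, partialDeriv_mul
    (h.smooth_f.differentiableAt_of_isOpen h.isOpen hx)
    ((hm s j).differentiableAt_of_isOpen h.isOpen hx), h.partialDeriv_factor hx]
  have h1 := congrFun (congrFun (matDeriv_mul h.isOpen hKt h.smooth_J hx k) s) j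
  have h2 : matDeriv k (fun y => (η * J y)ᵀ) x = (η * matDeriv k J x)ᵀ := by
    rw [← h.matDeriv_coframe hx]
    rfl
  have h3 : ((η * matDeriv k J x)ᵀ * J x) s j = ((η * J x)ᵀ * matDeriv k J x) j s := by
    rw [← Matrix.transpose_apply (_ * matDeriv k J x), Matrix.transpose_mul (η * J x)ᵀ,
      Matrix.transpose_transpose, Matrix.transpose_mul, h.symm, Matrix.mul_assoc]
  rw [h2, Matrix.add_apply, h3] at h1
  change partialDeriv k (fun y => ((η * J y)ᵀ * J y) s j) x = _ at h1
  rw [h1]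
  ring

/-- The matrix `Γₖ` of the Christoffel symbols. -/
def christoffelMat (g : Base → Matrix (Fin 4) (Fin 4) ℝ) (k : Fin 4) (x : Base) :
    Matrix (Fin 4) (Fin 4) ℝ := Matrix.of fun i j => christoffel g i k j x

theorem det_metric (h : ConformallyFlatOn g J f η D) (hx : x ∈ D) : (g x).det ≠ 0 := by
  rw [h.eq x hx, Matrix.det_smul, Matrix.det_mul, Matrix.det_mul, Matrix.det_transpose]
  exact mul_ne_zero (pow_ne_zero _ (h.f_ne x hx))
    (mul_ne_zero (mul_ne_zero (h.det_J x hx) h.det_η) (h.det_J x hx))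

/-- The change of gauge of the Levi-Civita connection by the closed coframe `J`; the flat
coordinates themselves are never integrated. After lowering an index, closedness of `J` cancels the
derivatives of `J` that do not belong to `∂ₖ J`. -/
theorem mul_christoffelMat (h : ConformallyFlatOn g J f η D) (hx : x ∈ D) (k : Fin 4) :
    J x * christoffelMat g k x = matDeriv k J x + gaugeForm J f η k x * J x := by
  set K := η * J x with hK
  set φ := factorForm f x with hφ
  set p := flatGradient J f η x with hp
  have hKu : IsUnit Kᵀ.det := by
    rw [Matrix.det_transpose]
    exact isUnit_iff_ne_zero.2 (h.det_coframe hx)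
  set Hm : Matrix (Fin 4) (Fin 4) ℝ := Matrix.of fun s j => (partialDeriv k (fun y => g y s j) x
    + partialDeriv j (fun y => g y s k) x - partialDeriv s (fun y => g y k j) x) / 2 with hH
  have h1 : christoffelMat g k x = (g x)⁻¹ * Hm := by
    ext i j
    simp only [christoffelMat, Matrix.of_apply, Matrix.mul_apply, christoffel, hH, mul_div_assoc]
  have h2 : g x * christoffelMat g k x = Hm := by
    rw [h1, Matrix.mul_nonsing_inv_cancel_left _ _ (isUnit_iff_ne_zero.2 (h.det_metric hx))]
  have hcl : ∀ k s j, (Kᵀ * matDeriv k J x) s j = (Kᵀ * matDeriv j J x) s k := by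
    intro k s j
    simp only [Matrix.mul_apply, matDeriv, Matrix.of_apply]
    exact Finset.sum_congr rfl fun b _ => by rw [h.closed x hx]
  have h3 : Hm = f x • (Kᵀ * (matDeriv k J x + gaugeForm J f η k x * J x)) := by
    have e1 : gaugeForm J f η k x * J x = φ k • J x
        + Matrix.vecMulVec (fun a => J x a k) φ - Matrix.vecMulVec p ((fun a => K a k) ᵥ* J x) := by
      rw [gaugeForm, Matrix.sub_mul, Matrix.add_mul, Matrix.smul_mul, Matrix.one_mul,
        Matrix.vecMulVec_mul, Matrix.vecMulVec_mul, h.mulVec_flatGradient_vecMul hx]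
    have e2 : Kᵀ *ᵥ p = φ := by
      rw [Matrix.mulVec_transpose, hp, hK, h.flatGradient_vecMul hx]
    ext s j
    have e3 : (Kᵀ *ᵥ fun a => J x a k) s = (Kᵀ * J x) s k := rfl
    have e4 : ((fun a => K a k) ᵥ* J x) j = (Kᵀ * J x) k j := rfl
    rw [e1, Matrix.mul_add, Matrix.mul_sub, Matrix.mul_add, Matrix.mul_smul, Matrix.mul_vecMulVec,
      Matrix.mul_vecMulVec, e2]
    simp only [Matrix.smul_apply, Matrix.add_apply, Matrix.sub_apply, Matrix.vecMulVec_apply, e3, e4,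
      smul_eq_mul, hH, Matrix.of_apply, h.partialDeriv_metric hx, ← hK, ← hφ]
    rw [hcl s k j, hcl s j k, hcl j s k]
    ring
  have h4 : g x = f x • (Kᵀ * J x) := by
    rw [h.eq x hx, hK, Matrix.transpose_mul, h.symm]
  rw [h3, h4, Matrix.smul_mul, Matrix.mul_assoc] at h2
  have h5 := smul_right_injective _ (h.f_ne x hx) h2
  have h6 := congrArg (Kᵀ⁻¹ * ·) h5
  simpa only [Matrix.nonsing_inv_mul_cancel_left _ _ hKu] using h6

theorem smooth_christoffelMat (h : ConformallyFlatOn g J f η D) (k : Fin 4) :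
    SmoothMat (christoffelMat g k) D := by
  have h1 := (h.smooth_J.inv h.isOpen h.det_J).mul
    ((h.smooth_J.matDeriv h.isOpen k).add ((h.smooth_gaugeForm k).mul h.smooth_J))
  refine fun i j => (h1 i j).congr fun y hy => ?_
  simp only
  rw [← h.mul_christoffelMat hy, Matrix.nonsing_inv_mul_cancel_left _ _
    (isUnit_iff_ne_zero.2 (h.det_J y hy))]

/-- The curvature form `R_{kl}`. -/
def riemannMat (g : Base → Matrix (Fin 4) (Fin 4) ℝ) (k l : Fin 4) (x : Base) :
    Matrix (Fin 4) (Fin 4) ℝ := Matrix.of fun i j => riemannUp g i j k l x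

theorem riemannMat_eq (k l : Fin 4) : riemannMat g k l x
    = matDeriv k (christoffelMat g l) x - matDeriv l (christoffelMat g k) x
      + (christoffelMat g k x * christoffelMat g l x
        - christoffelMat g l x * christoffelMat g k x) := by
  ext i j
  simp only [riemannMat, Matrix.of_apply, riemannUp, Finset.sum_sub_distrib, Matrix.add_apply,
    Matrix.sub_apply, Matrix.mul_apply, christoffelMat, matDeriv]

/-- Curvature transforms tensorially under the gauge change, since the mixed second derivatives of
`J` cancel. -/
theorem mul_riemannMat (h : ConformallyFlatOn g J f η D) (hx : x ∈ D) (k l : Fin 4) :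
    J x * riemannMat g k l x = (matDeriv k (gaugeForm J f η l) x - matDeriv l (gaugeForm J f η k) x
      + (gaugeForm J f η k x * gaugeForm J f η l x - gaugeForm J f η l x * gaugeForm J f η k x))
      * J x := by
  have hd : ∀ k l, matDeriv k J x * christoffelMat g l x + J x * matDeriv k (christoffelMat g l) x
      = matDeriv k (matDeriv l J) x + (matDeriv k (gaugeForm J f η l) x * J x
        + gaugeForm J f η l x * matDeriv k J x) := by
    intro k l
    rw [← matDeriv_mul h.isOpen h.smooth_J (h.smooth_christoffelMat l) hx,
      matDeriv_congr h.isOpen (fun y hy => h.mul_christoffelMat hy l) hx,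
      matDeriv_add h.isOpen (h.smooth_J.matDeriv h.isOpen l)
        ((h.smooth_gaugeForm l).mul h.smooth_J) hx,
      matDeriv_mul h.isOpen (h.smooth_gaugeForm l) h.smooth_J hx]
  have hm : ∀ k l, J x * (christoffelMat g k x * christoffelMat g l x)
      = matDeriv k J x * christoffelMat g l x + gaugeForm J f η k x * matDeriv l J x
        + gaugeForm J f η k x * gaugeForm J f η l x * J x := by
    intro k l
    rw [← Matrix.mul_assoc, h.mul_christoffelMat hx, Matrix.add_mul, Matrix.mul_assoc _ (J x),
      h.mul_christoffelMat hx, Matrix.mul_add, ← Matrix.mul_assoc, add_assoc]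
  have hd' : ∀ k l, J x * matDeriv k (christoffelMat g l) x
      = matDeriv k (matDeriv l J) x + (matDeriv k (gaugeForm J f η l) x * J x
        + gaugeForm J f η l x * matDeriv k J x) - matDeriv k J x * christoffelMat g l x :=
    fun k l => eq_sub_of_add_eq' (hd k l)
  rw [riemannMat_eq, Matrix.mul_add, Matrix.mul_sub, Matrix.mul_sub, hd', hd', hm, hm,
    matDeriv_comm h.isOpen h.smooth_J hx l k]
  simp only [Matrix.add_mul, Matrix.sub_mul]
  abel

theorem gaugeForm_commutator (h : ConformallyFlatOn g J f η D) (hx : x ∈ D) (k l : Fin 4) :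
    gaugeForm J f η k x * gaugeForm J f η l x - gaugeForm J f η l x * gaugeForm J f η k x
      = Matrix.of fun a b =>
        J x a k * (factorForm f x l * (η *ᵥ flatGradient J f η x) b)
        - J x a l * (factorForm f x k * (η *ᵥ flatGradient J f η x) b)
        - ((η *ᵥ flatGradient J f η x) ⬝ᵥ flatGradient J f η x)
          * (J x a k * (η * J x) b l - J x a l * (η * J x) b k)
        + flatGradient J f η x a * (factorForm f x k * (η * J x) b l
          - factorForm f x l * (η * J x) b k) := by
  have c1 : ∀ k, (η *ᵥ flatGradient J f η x) ⬝ᵥ (fun a => J x a k) = factorForm f x k := fun k =>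
    congrFun (h.mulVec_flatGradient_vecMul hx) k
  have c2 : ∀ k, (fun a => (η * J x) a k) ⬝ᵥ flatGradient J f η x = factorForm f x k := fun k => by
    rw [dotProduct_comm]
    exact congrFun (h.flatGradient_vecMul hx) k
  have c3 : (fun a => (η * J x) a k) ⬝ᵥ (fun a => J x a l)
      = (fun a => (η * J x) a l) ⬝ᵥ (fun a => J x a k) := by
    have e : ∀ k l, (fun a => (η * J x) a k) ⬝ᵥ (fun a => J x a l) = ((J x)ᵀ * η * J x) k l := by
      intro k l
      have : (fun a => (η * J x) a k) ⬝ᵥ (fun a => J x a l) = ((η * J x)ᵀ * J x) k l := rfl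
      rw [this, Matrix.transpose_mul, h.symm]
    rw [e, e, ← Matrix.transpose_apply ((J x)ᵀ * η * J x) k l, Matrix.transpose_mul,
      Matrix.transpose_mul, h.symm, Matrix.transpose_transpose, Matrix.mul_assoc]
  simp only [gaugeForm, Matrix.mul_add, Matrix.add_mul, Matrix.mul_sub, Matrix.sub_mul,
    Matrix.smul_mul, Matrix.mul_smul, Matrix.one_mul, Matrix.mul_one,
    Matrix.vecMulVec_mul_vecMulVec, c1, c2, c3]
  ext a b
  simp only [Matrix.add_apply, Matrix.sub_apply, Matrix.smul_apply, Matrix.vecMulVec_apply,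
    Pi.smul_apply, smul_eq_mul, Matrix.of_apply, Matrix.one_apply]
  ring

theorem matDeriv_gaugeForm (h : ConformallyFlatOn g J f η D) (hx : x ∈ D) (k l : Fin 4) :
    matDeriv k (gaugeForm J f η l) x - matDeriv l (gaugeForm J f η k) x = Matrix.of fun a b =>
      J x a l * partialDeriv k (fun y => (η *ᵥ flatGradient J f η y) b) x
      - J x a k * partialDeriv l (fun y => (η *ᵥ flatGradient J f η y) b) x
      - partialDeriv k (fun y => flatGradient J f η y a) x * (η * J x) b l
      + partialDeriv l (fun y => flatGradient J f η y a) x * (η * J x) b k := by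
  have dψ : ∀ b, DifferentiableAt ℝ (fun y => (η *ᵥ flatGradient J f η y) b) x := fun b =>
    ContDiffOn.differentiableAt_of_isOpen (ContDiffOn.sum (s := Finset.univ) fun c _ =>
      contDiffOn_const.mul (h.smooth_flatGradient c)) h.isOpen hx
  have dp := fun a => (h.smooth_flatGradient a).differentiableAt_of_isOpen h.isOpen hx
  have dJ := fun a k => (h.smooth_J a k).differentiableAt_of_isOpen h.isOpen hx
  have dK := fun a k => (h.smooth_coframe a k).differentiableAt_of_isOpen h.isOpen hx
  have dφ := fun k => (h.smooth_factorForm k).differentiableAt_of_isOpen h.isOpen hx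
  have key : ∀ k l a b, partialDeriv k (fun y => gaugeForm J f η l y a b) x
      = partialDeriv k (fun y => factorForm f y l) x * (1 : Matrix (Fin 4) (Fin 4) ℝ) a b
        + (partialDeriv k (fun y => J y a l) x * (η *ᵥ flatGradient J f η x) b
          + J x a l * partialDeriv k (fun y => (η *ᵥ flatGradient J f η y) b) x)
        - (partialDeriv k (fun y => flatGradient J f η y a) x * (η * J x) b l
          + flatGradient J f η x a * partialDeriv k (fun y => (η * J y) b l) x) := by
    intro k l a b
    have e : (fun y => gaugeForm J f η l y a b) = fun y =>
        factorForm f y l * (1 : Matrix (Fin 4) (Fin 4) ℝ) a b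
        + J y a l * (η *ᵥ flatGradient J f η y) b - flatGradient J f η y a * (η * J y) b l := rfl
    rw [e, partialDeriv_sub (((dφ l).mul_const _).fun_add ((dJ a l).fun_mul (dψ b)))
      ((dp a).fun_mul (dK b l)), partialDeriv_add ((dφ l).mul_const _) ((dJ a l).fun_mul (dψ b)),
      partialDeriv_mul (dφ l) (differentiableAt_const _), partialDeriv_const, mul_zero, add_zero,
      partialDeriv_mul (dJ a l) (dψ b), partialDeriv_mul (dp a) (dK b l)]
  ext a b
  simp only [Matrix.sub_apply, matDeriv, Matrix.of_apply, key]
  have hφ : partialDeriv k (fun y => factorForm f y l) x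
      = partialDeriv l (fun y => factorForm f y k) x :=
    partialDeriv_comm h.isOpen h.smooth_log hx k l
  rw [hφ, h.closed x hx k a l, h.closed_coframe hx k b l]
  ring

theorem weyl_eq_zero (h : ConformallyFlatOn g J f η D) (hx : x ∈ D) (i j k l : Fin 4) :
    weyl g i j k l x = 0 := by
  have hs : (g x)ᵀ = g x := by
    rw [h.eq x hx, Matrix.transpose_smul, Matrix.transpose_mul, Matrix.transpose_mul, h.symm,
      Matrix.transpose_transpose, Matrix.mul_assoc]
  set p := flatGradient J f η x with hp
  set ψ := η *ᵥ p with hψ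
  set φ := factorForm f x with hφ
  set K := η * J x with hK
  -- the two versions of the Schouten-type tensor in the flat frame
  set V : Fin 4 → Fin 4 → ℝ := fun k a => partialDeriv k (fun y => flatGradient J f η y a) x
    - φ k * p a + (ψ ⬝ᵥ p) / 2 * J x a k with hV
  set A : Fin 4 → Fin 4 → ℝ := fun k b =>
    partialDeriv k (fun y => (η *ᵥ flatGradient J f η y) b) x
    - φ k * ψ b + (ψ ⬝ᵥ p) / 2 * K b k with hA
  have hAV : ∀ k, η *ᵥ V k = A k := by
    intro k
    ext b
    have e1 : partialDeriv k (fun y => (η *ᵥ flatGradient J f η y) b) x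
        = ∑ c, η b c * partialDeriv k (fun y => flatGradient J f η y c) x := by
      have dp := fun a => (h.smooth_flatGradient a).differentiableAt_of_isOpen h.isOpen hx
      have e : (fun y => (η *ᵥ flatGradient J f η y) b)
          = fun y => ∑ c, η b c * flatGradient J f η y c := rfl
      rw [e, partialDeriv_sum fun c _ => (dp c).const_mul _]
      exact Finset.sum_congr rfl fun c _ => partialDeriv_const_mul (dp c) _ _
    have e2 : ψ b = ∑ c, η b c * p c := rfl
    have e3 : K b k = ∑ c, η b c * J x c k := rfl
    have e4 : (η *ᵥ V k) b = ∑ c, η b c * V k c := rfl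
    have e5 : A k b = partialDeriv k (fun y => (η *ᵥ flatGradient J f η y) b) x
      - φ k * ψ b + (ψ ⬝ᵥ p) / 2 * K b k := rfl
    rw [e4, e5, e1, e2, e3, Finset.mul_sum, Finset.mul_sum, ← Finset.sum_sub_distrib, ← Finset.sum_add_distrib]
    exact Finset.sum_congr rfl fun c _ => by ring
  -- Half of the term with `ψ ⬝ᵥ p` has been put into each of `A` and `V`, so that `A` is `V`
  -- lowered by `η`. Lowering the first index then gives the product of the metric with one tensor.
  have hΩ : ∀ k l, matDeriv k (gaugeForm J f η l) x - matDeriv l (gaugeForm J f η k) x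
      + (gaugeForm J f η k x * gaugeForm J f η l x - gaugeForm J f η l x * gaugeForm J f η k x)
      = Matrix.vecMulVec (fun a => J x a l) (A k) - Matrix.vecMulVec (fun a => J x a k) (A l)
        - Matrix.vecMulVec (V k) (fun a => K a l) + Matrix.vecMulVec (V l) (fun a => K a k) := by
    intro k l
    rw [h.matDeriv_gaugeForm hx, h.gaugeForm_commutator hx]
    ext a b
    simp only [Matrix.add_apply, Matrix.sub_apply, Matrix.vecMulVec_apply, Matrix.of_apply, hA, hV,
      ← hp, ← hψ, ← hφ, ← hK]
    ring
  have hKt : Kᵀ = (J x)ᵀ * η := by rw [hK, Matrix.transpose_mul, h.symm]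
  have hgm : ∀ i j, g x i j = f x * (Kᵀ * J x) i j := fun i j => by
    rw [h.eq x hx, hKt]
    rfl
  refine weyl_eq_zero_of_riemann (P := Matrix.of fun k j => (A k ᵥ* J x) j) hs
    (isUnit_iff_ne_zero.2 (h.det_metric hx)) ?_ i j k l
  intro i j k l
  have e1 : riemann g i j k l x = (g x * riemannMat g k l x) i j := rfl
  have e2 : g x * riemannMat g k l x = f x • (Kᵀ * (J x * riemannMat g k l x)) := by
    rw [h.eq x hx, hKt, Matrix.smul_mul, Matrix.mul_assoc ((J x)ᵀ * η)]
  have e3 : ∀ l, Kᵀ *ᵥ (fun a => J x a l) = fun i => (Kᵀ * J x) i l := fun l => rfl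
  have e4 : ∀ k, Kᵀ *ᵥ V k = A k ᵥ* J x := fun k => by
    rw [hKt, ← Matrix.mulVec_mulVec, hAV, Matrix.mulVec_transpose]
  have e5 : ∀ l, (fun a => K a l) ᵥ* J x = fun j => (Kᵀ * J x) l j := fun l => rfl
  have hmsym : ∀ i j, (Kᵀ * J x) i j = (Kᵀ * J x) j i := fun i j => by
    rw [← Matrix.transpose_apply (Kᵀ * J x), Matrix.transpose_mul, Matrix.transpose_transpose, hKt,
      hK, Matrix.mul_assoc]
  rw [e1, e2, h.mul_riemannMat hx, hΩ]
  simp only [Matrix.mul_add, Matrix.mul_sub, Matrix.add_mul, Matrix.sub_mul, Matrix.mul_vecMulVec,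
    Matrix.vecMulVec_mul, e3, e4, e5, Matrix.smul_apply, Matrix.add_apply, Matrix.sub_apply,
    Matrix.vecMulVec_apply, smul_eq_mul, hgm, Matrix.of_apply]
  rw [hmsym l j, hmsym k j]
  ring

end ConformallyFlatOn

end Curvature

/-! ### Linearisable systems are flat on solutions -/

namespace FirstOrderSystem

variable {S : FirstOrderSystem} {u v : Base → ℝ} {D : Set Base}

theorem contDiffOn_jet (hD : IsOpen D) (hu : ContDiffOn ℝ ∞ u D) (hv : ContDiffOn ℝ ∞ v D) :
    ContDiffOn ℝ ∞ (jet u v) D := by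
  refine contDiffOn_pi.2 fun a => contDiffOn_pi.2 fun i => ?_
  fin_cases a
  · exact contDiffOn_partialDeriv hD hu i
  · exact contDiffOn_partialDeriv hD hv i

theorem contDiffAt_cometric {U : JetSpace} (hU : U ∈ S.dom) (i j : Fin 4) :
    ContDiffAt ℝ ∞ (fun U => S.cometric U i j) U := by
  simp only [cometric_eq]
  exact ContDiffAt.matrix_mul (ContDiffAt.matrix_mul (contDiffAt_frame hU)
    (B := fun _ => modelCometric) fun _ _ => contDiffAt_const) (B := fun U => (S.frame U)ᵀ)
    (fun i j => contDiffAt_frame hU j i) i j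

theorem IsSolutionOn.smooth_cometric (h : S.IsSolutionOn u v D) :
    SmoothMat (fun y => S.cometric (jet u v y)) D := fun i j y hy =>
  (ContDiffAt.comp y (contDiffAt_cometric (h.mem_locus y hy).1 i j)
    ((contDiffOn_jet h.isOpen h.smooth_u h.smooth_v).contDiffAt
      (h.isOpen.mem_nhds hy))).contDiffWithinAt

theorem modelCometric_transpose : modelCometricᵀ = modelCometric := by
  ext i j
  fin_cases i <;> fin_cases j <;> rfl

theorem denom_jet_apply (g : SL6) (y : Base) (a j : Fin 4) : denom g (jet u v y) a j
    = g.1.toBlocks₂₁ a 0 * partialDeriv j u y + g.1.toBlocks₂₁ a 1 * partialDeriv j v y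
      + g.1.toBlocks₂₂ a j := by
  rw [denom, Matrix.add_apply, Matrix.mul_apply, Fin.sum_univ_two]
  rfl

theorem IsSolutionOn.smooth_denom (h : S.IsSolutionOn u v D) (g : SL6) :
    SmoothMat (fun y => denom g (jet u v y)) D := by
  intro a j
  simp only [denom_jet_apply]
  exact ((contDiffOn_const.mul (contDiffOn_partialDeriv h.isOpen h.smooth_u j)).add
    (contDiffOn_const.mul (contDiffOn_partialDeriv h.isOpen h.smooth_v j))).add contDiffOn_const

/-- The rows of `C U + D` on a solution are the differentials of the new independent variables,
linear combinations of `u`, `v` and `x`. -/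
theorem IsSolutionOn.closed_denom (h : S.IsSolutionOn u v D) (g : SL6) {y : Base} (hy : y ∈ D)
    (k a j : Fin 4) : partialDeriv k (fun y => denom g (jet u v y) a j) y
      = partialDeriv j (fun y => denom g (jet u v y) a k) y := by
  have du := fun j =>
    (contDiffOn_partialDeriv h.isOpen h.smooth_u j).differentiableAt_of_isOpen h.isOpen hy
  have dv := fun j =>
    (contDiffOn_partialDeriv h.isOpen h.smooth_v j).differentiableAt_of_isOpen h.isOpen hy
  have key : ∀ k j, partialDeriv k (fun y => denom g (jet u v y) a j) y
      = g.1.toBlocks₂₁ a 0 * partialDeriv k (partialDeriv j u) y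
        + g.1.toBlocks₂₁ a 1 * partialDeriv k (partialDeriv j v) y := fun k j => by
    simp only [denom_jet_apply]
    rw [partialDeriv_add (((du j).const_mul _).fun_add ((dv j).const_mul _))
      (differentiableAt_const _), partialDeriv_add ((du j).const_mul _) ((dv j).const_mul _),
      partialDeriv_const_mul (du j), partialDeriv_const_mul (dv j), partialDeriv_const, add_zero]
  rw [key, key, partialDeriv_comm h.isOpen h.smooth_u hy, partialDeriv_comm h.isOpen h.smooth_v hy]

theorem Linearisable.flatOnSolutions (hne : S.locus.Nonempty) (hnd : S.Nondegenerate)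
    (hlin : S.Linearisable) : S.FlatOnSolutions := by
  intro D u v hsol x hx i j k l
  obtain ⟨g, E, m, hE, h⟩ := hlin.exists_frame hne hnd
  set H := E * modelCometric * Eᵀ with hH
  set J : Base → Matrix (Fin 4) (Fin 4) ℝ := fun y => denom g (jet u v y) with hJ
  have hJu : ∀ y ∈ D, IsUnit (J y).det := fun y hy => (h _ (hsol.mem_locus y hy)).1
  set Q : Base → Matrix (Fin 4) (Fin 4) ℝ := fun y => J y * S.cometric (jet u v y) * (J y)ᵀ with hQ
  have hκ : ∀ y ∈ D, ∃ κ : ℝ, κ ≠ 0 ∧ Q y = κ • H := fun y hy => (h _ (hsol.mem_locus y hy)).2.2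
  have hHdet : H.det ≠ 0 := by
    obtain ⟨κ, -, hQx⟩ := hκ x hx
    have h1 : (Q x).det ≠ 0 := by
      simp only [hQ, Matrix.det_mul, Matrix.det_transpose]
      exact mul_ne_zero (mul_ne_zero (hJu x hx).ne_zero (hnd _ (hsol.mem_locus x hx)))
        (hJu x hx).ne_zero
    rw [hQx, Matrix.det_smul] at h1
    exact right_ne_zero_of_mul h1
  have hHu := isUnit_iff_ne_zero.2 hHdet
  have hHs : Hᵀ = H := by
    rw [hH, Matrix.transpose_mul, Matrix.transpose_mul, Matrix.transpose_transpose,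
      modelCometric_transpose, Matrix.mul_assoc]
  -- The conformal factor is only known to exist pointwise. Its quotient expression through a
  -- nonzero entry of `H` makes it smooth.
  obtain ⟨a, b, hab⟩ : ∃ a b, H a b ≠ 0 := by
    by_contra! hcon
    apply hHdet
    have : H = 0 := by
      ext a b
      exact hcon a b
    rw [this]
    exact Matrix.det_zero
  have hQs : SmoothMat Q D :=
    ((hsol.smooth_denom g).mul hsol.smooth_cometric).mul fun i j => hsol.smooth_denom g j i
  have hQ0 : ∀ y ∈ D, Q y a b ≠ 0 := by
    intro y hy
    obtain ⟨κ, hκ0, hQy⟩ := hκ y hy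
    rw [hQy]
    exact mul_ne_zero hκ0 hab
  have hflat : Curvature.ConformallyFlatOn (S.metric u v) J (fun y => H a b / Q y a b) H⁻¹ D :=
    { isOpen := hsol.isOpen
      smooth_J := hsol.smooth_denom g
      smooth_f := contDiffOn_const.div (hQs a b) hQ0
      f_ne := fun y hy => div_ne_zero hab (hQ0 y hy)
      det_J := fun y hy => (hJu y hy).ne_zero
      closed := fun y hy k a j => hsol.closed_denom g hy k a j
      symm := by rw [Matrix.transpose_nonsing_inv, hHs]
      det_η := (Matrix.isUnit_nonsing_inv_det _ hHu).ne_zero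
      eq := fun y hy => by
        obtain ⟨κ, hκ0, hQy⟩ := hκ y hy
        have hf : H a b / Q y a b = κ⁻¹ := by
          rw [hQy, Matrix.smul_apply, smul_eq_mul]
          field_simp
        rw [hf]
        refine Matrix.inv_eq_right_inv ?_
        have h1 : S.cometric (jet u v y) * (J y)ᵀ = κ • ((J y)⁻¹ * H) := by
          have := congrArg ((J y)⁻¹ * ·) hQy
          simpa only [hQ, Matrix.mul_assoc, Matrix.nonsing_inv_mul_cancel_left _ _ (hJu y hy),
            Matrix.mul_smul] using this
        rw [Matrix.mul_smul, Matrix.mul_assoc, ← Matrix.mul_assoc, h1, Matrix.smul_mul, smul_smul,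
          inv_mul_cancel₀ hκ0, one_smul, Matrix.mul_assoc, Matrix.mul_nonsing_inv_cancel_left _ _ hHu,
          Matrix.nonsing_inv_mul _ (hJu y hy)] }
  exact hflat.weyl_eq_zero hx i j k l

end FirstOrderSystem

/-! ### The Weyl tensor at a point of first-order flatness -/

namespace Curvature

open FirstOrderSystem

variable {g : Base → Matrix (Fin 4) (Fin 4) ℝ} {x : Base} {D : Set Base}

theorem christoffel_eq_zero (hd : ∀ k i j, partialDeriv k (fun y => g y i j) x = 0)
    (i j k : Fin 4) : christoffel g i j k x = 0 := by
  simp [christoffel, hd]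

theorem partialDeriv_christoffel (hD : IsOpen D) (hx : x ∈ D) (hg : SmoothMat g D)
    (hdet : ∀ y ∈ D, (g y).det ≠ 0) (hd : ∀ k i j, partialDeriv k (fun y => g y i j) x = 0)
    (m i j k : Fin 4) : partialDeriv m (christoffel g i j k) x
      = ∑ s, (g x)⁻¹ i s * ((partialDeriv m (partialDeriv j fun y => g y s k) x
        + partialDeriv m (partialDeriv k fun y => g y s j) x
        - partialDeriv m (partialDeriv s fun y => g y j k) x) / 2) := by
  have h1 : ∀ i j k, DifferentiableAt ℝ (partialDeriv k fun y => g y i j) x := fun i j k =>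
    (contDiffOn_partialDeriv hD (hg i j) k).differentiableAt_of_isOpen hD hx
  have h2 : ∀ i j, DifferentiableAt ℝ (fun y => (g y)⁻¹ i j) x := fun i j =>
    (SmoothMat.inv hD hg hdet i j).differentiableAt_of_isOpen hD hx
  have h3 : ∀ s, DifferentiableAt ℝ (fun y => (1 / 2) * (partialDeriv j (fun y => g y s k) y
      + partialDeriv k (fun y => g y s j) y - partialDeriv s (fun y => g y j k) y)) x := fun s =>
    (((h1 s k j).fun_add (h1 s j k)).fun_sub (h1 j k s)).const_mul _
  have h4 : christoffel g i j k = fun y => ∑ s, (g y)⁻¹ i s * ((1 / 2) *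
      (partialDeriv j (fun y => g y s k) y
      + partialDeriv k (fun y => g y s j) y - partialDeriv s (fun y => g y j k) y)) := by
    funext y
    exact Finset.sum_congr rfl fun s _ => by ring
  rw [h4, partialDeriv_sum fun s _ => (h2 i s).fun_mul (h3 s)]
  refine Finset.sum_congr rfl fun s _ => ?_
  rw [partialDeriv_mul (h2 i s) (h3 s), partialDeriv_const_mul
    (((h1 s k j).fun_add (h1 s j k)).fun_sub (h1 j k s)), partialDeriv_sub
    ((h1 s k j).fun_add (h1 s j k)) (h1 j k s), partialDeriv_add (h1 s k j) (h1 s j k)]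
  simp only [hd]
  ring

theorem riemann_eq_of_second_order (hD : IsOpen D) (hx : x ∈ D) (hg : SmoothMat g D)
    (hdet : ∀ y ∈ D, (g y).det ≠ 0) (hd : ∀ k i j, partialDeriv k (fun y => g y i j) x = 0)
    {h : Matrix (Fin 4) (Fin 4) ℝ} {p : Fin 4 → ℝ}
    (hdd : ∀ k l i j, partialDeriv k (partialDeriv l fun y => g y i j) x = 2 * h i j * p k * p l)
    (i j k l : Fin 4) : riemann g i j k l x
      = p k * p j * h i l - p k * p i * h l j - p l * p j * h i k + p l * p i * h k j := by
  have hinv : ∀ (i : Fin 4) (w : Fin 4 → ℝ), ∑ s, g x i s * ∑ r, (g x)⁻¹ s r * w r = w i := by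
    intro i w
    have := congrFun (Matrix.mulVec_mulVec w (g x) (g x)⁻¹) i
    rw [Matrix.mul_nonsing_inv _ (isUnit_iff_ne_zero.2 (hdet x hx)), Matrix.one_mulVec] at this
    exact this
  simp only [riemann, riemannUp, christoffel_eq_zero hd, partialDeriv_christoffel hD hx hg hdet hd,
    mul_zero, sub_zero, Finset.sum_const_zero, add_zero, mul_sub, Finset.sum_sub_distrib, hinv, hdd]
  ring

/-- The Weyl tensor on a totally null plane of a metric that is flat to first order and is
deformed to second order along a covector. -/
theorem weyl_null_plane (hD : IsOpen D) (hx : x ∈ D) (hg : SmoothMat g D)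
    (hdet : ∀ y ∈ D, (g y).det ≠ 0) (hd : ∀ k i j, partialDeriv k (fun y => g y i j) x = 0)
    {h : Matrix (Fin 4) (Fin 4) ℝ} {p : Fin 4 → ℝ}
    (hdd : ∀ k l i j, partialDeriv k (partialDeriv l fun y => g y i j) x = 2 * h i j * p k * p l)
    {X Y : Fin 4 → ℝ} (hXX : X ⬝ᵥ g x *ᵥ X = 0) (hYY : Y ⬝ᵥ g x *ᵥ Y = 0)
    (hXY : X ⬝ᵥ g x *ᵥ Y = 0) (hYX : Y ⬝ᵥ g x *ᵥ X = 0) (hpX : p ⬝ᵥ X = 0) :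
    ∑ i, ∑ j, ∑ k, ∑ l, weyl g i j k l x * Y i * X j * Y k * X l
      = -((p ⬝ᵥ Y) ^ 2 * (X ⬝ᵥ h *ᵥ X)) := by
  obtain ⟨T, hT⟩ : ∃ T : Matrix (Fin 4) (Fin 4) ℝ, ∀ i j, schouten g i j x = T i j :=
    ⟨Matrix.of fun i j => schouten g i j x, fun _ _ => rfl⟩
  have hbil : ∀ (A : Matrix (Fin 4) (Fin 4) ℝ) (a b : Fin 4 → ℝ),
      ∑ i, ∑ j, A i j * a i * b j = a ⬝ᵥ A *ᵥ b := by
    intro A a b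
    simp only [dotProduct, Matrix.mulVec, Finset.mul_sum]
    exact Finset.sum_congr rfl fun i _ => Finset.sum_congr rfl fun j _ => by ring
  have key : ∀ (A B : Matrix (Fin 4) (Fin 4) ℝ) (a b c d : Fin 4 → ℝ),
      ∑ i, ∑ j, ∑ k, ∑ l, (A i j * a i * b j) * (B k l * c k * d l)
        = (a ⬝ᵥ A *ᵥ b) * (c ⬝ᵥ B *ᵥ d) := by
    intro A B a b c d
    simp only [← Finset.mul_sum, ← Finset.sum_mul, hbil]
  have keyA : ∀ A B : Matrix (Fin 4) (Fin 4) ℝ,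
      ∑ i, ∑ j, ∑ k, ∑ l, A i k * B j l * Y i * X j * Y k * X l
        = (Y ⬝ᵥ A *ᵥ Y) * (X ⬝ᵥ B *ᵥ X) := by
    intro A B
    rw [← key]
    refine Finset.sum_congr rfl fun i _ => ?_
    rw [Finset.sum_comm]
    exact Finset.sum_congr rfl fun k _ => Finset.sum_congr rfl fun j _ =>
      Finset.sum_congr rfl fun l _ => by ring
  have keyB : ∀ A B : Matrix (Fin 4) (Fin 4) ℝ,
      ∑ i, ∑ j, ∑ k, ∑ l, A i l * B j k * Y i * X j * Y k * X l
        = (Y ⬝ᵥ A *ᵥ X) * (X ⬝ᵥ B *ᵥ Y) := by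
    intro A B
    rw [← key]
    refine Finset.sum_congr rfl fun i _ => ?_
    have h1 : ∀ j : Fin 4, ∑ k, ∑ l, A i l * B j k * Y i * X j * Y k * X l
        = ∑ l, ∑ k, A i l * B j k * Y i * X j * Y k * X l := fun j => Finset.sum_comm
    simp only [h1]
    rw [Finset.sum_comm]
    exact Finset.sum_congr rfl fun l _ => Finset.sum_congr rfl fun j _ =>
      Finset.sum_congr rfl fun k _ => by ring
  have hpp : ∀ a b : Fin 4 → ℝ, a ⬝ᵥ Matrix.vecMulVec p p *ᵥ b = (p ⬝ᵥ a) * (p ⬝ᵥ b) := by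
    intro a b
    rw [Matrix.vecMulVec_mulVec, dotProduct_smul, dotProduct_comm a p]
    simp
  have hw : ∀ i j k l, weyl g i j k l x * Y i * X j * Y k * X l
      = h i l * Matrix.vecMulVec p p j k * Y i * X j * Y k * X l
        - Matrix.vecMulVec p p i k * hᵀ j l * Y i * X j * Y k * X l
        - h i k * Matrix.vecMulVec p p j l * Y i * X j * Y k * X l
        + Matrix.vecMulVec p p i l * hᵀ j k * Y i * X j * Y k * X l
        - T i k * g x j l * Y i * X j * Y k * X l - g x i k * T j l * Y i * X j * Y k * X l
        + g x i l * T j k * Y i * X j * Y k * X l + T i l * g x j k * Y i * X j * Y k * X l := by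
    intro i j k l
    rw [weyl, riemann_eq_of_second_order hD hx hg hdet hd hdd]
    simp only [hT, Matrix.vecMulVec_apply, Matrix.transpose_apply]
    ring
  -- Every Schouten term carries a factor `g` on two vectors of the null plane. In the Riemann part
  -- `p ⬝ᵥ X = 0` leaves one term.
  simp only [hw, Finset.sum_add_distrib, Finset.sum_sub_distrib, keyA, keyB, hpp, hXX, hYY, hXY,
    hYX, hpX]
  rw [Matrix.mulVec_transpose, dotProduct_comm X, ← Matrix.dotProduct_mulVec]
  ring

end Curvature

/-! ### Simple waves -/

namespace FirstOrderSystem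

section CompSq

variable {σ : Base → ℝ} {Γ : ℝ → ℝ} {D : Set Base} {I : Set ℝ} {x : Base}

theorem contDiffOn_comp_sq (hΓ : ContDiffOn ℝ ∞ Γ I) (hσ : ContDiffOn ℝ ∞ σ D)
    (h : ∀ y ∈ D, σ y ^ 2 ∈ I) : ContDiffOn ℝ ∞ (fun y => Γ (σ y ^ 2)) D :=
  hΓ.comp (hσ.pow 2) h

theorem partialDeriv_comp_sq (hD : IsOpen D) (hI : IsOpen I) (hΓ : ContDiffOn ℝ ∞ Γ I)
    (hσ : ContDiffOn ℝ ∞ σ D) (h : ∀ y ∈ D, σ y ^ 2 ∈ I) (hx : x ∈ D) (k : Fin 4) :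
    partialDeriv k (fun y => Γ (σ y ^ 2)) x
      = 2 * deriv Γ (σ x ^ 2) * partialDeriv k σ x * σ x := by
  have h1 : HasDerivAt Γ (deriv Γ (σ x ^ 2)) (σ x ^ 2) :=
    ((hΓ.contDiffAt (hI.mem_nhds (h x hx))).differentiableAt (by simp)).hasDerivAt
  have h2 := (hσ.differentiableAt_of_isOpen hD hx).hasFDerivAt.pow 2
  have h3 := h1.comp_hasFDerivAt x h2
  change fderiv ℝ (Γ ∘ fun y => σ y ^ 2) x _ = _
  rw [HasFDerivAt.fderiv h3]
  simp [partialDeriv]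
  ring

theorem partialDeriv_partialDeriv_comp_sq (hD : IsOpen D) (hI : IsOpen I)
    (hΓ : ContDiffOn ℝ ∞ Γ I) (hσ : ContDiffOn ℝ ∞ σ D) (h : ∀ y ∈ D, σ y ^ 2 ∈ I) (hx : x ∈ D)
    (h0 : σ x = 0) (k l : Fin 4) :
    partialDeriv k (partialDeriv l fun y => Γ (σ y ^ 2)) x
      = 2 * deriv Γ 0 * partialDeriv k σ x * partialDeriv l σ x := by
  have hΓ' : ContDiffOn ℝ ∞ (deriv Γ) I := ((contDiffOn_infty_iff_deriv_of_isOpen hI).1 hΓ).2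
  have h1 : DifferentiableAt ℝ (fun y => 2 * deriv Γ (σ y ^ 2) * partialDeriv l σ y) x :=
    ((contDiffOn_const.mul (contDiffOn_comp_sq hΓ' hσ h)).mul
      (contDiffOn_partialDeriv hD hσ l)).differentiableAt_of_isOpen hD hx
  rw [partialDeriv_congr_of_isOpen hD
    (fun y hy => partialDeriv_comp_sq hD hI hΓ hσ h hy l) hx k,
    partialDeriv_mul h1 (hσ.differentiableAt_of_isOpen hD hx), h0]
  ring_nf

end CompSq

/-- The potential of a simple wave: a closed form with values on a given curve `P`, which moves
along the curve with the square of a function `σ`. -/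
theorem exists_wave {P : ℝ → Base} {I : Set ℝ} (hI : IsOpen I) (h0 : (0 : ℝ) ∈ I)
    (hP : ContDiffOn ℝ ∞ P I) {p : Base} (hp : HasDerivAt P p 0) :
    ∃ (D : Set Base) (σ φ : Base → ℝ), IsOpen D ∧ 0 ∈ D ∧ ContDiffOn ℝ ∞ σ D ∧
      ContDiffOn ℝ ∞ φ D ∧ σ 0 = 0 ∧ (∀ k, partialDeriv k σ 0 = p k) ∧
      ∀ x ∈ D, σ x ^ 2 ∈ I ∧ ∀ k, partialDeriv k φ x = P (σ x ^ 2) k := by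
  have hPi : ∀ i, ContDiffOn ℝ ∞ (fun τ => P τ i) I := fun i => contDiffOn_pi.1 hP i
  have hP' : ∀ i, ContDiffOn ℝ ∞ (deriv fun τ => P τ i) I := fun i =>
    ((contDiffOn_infty_iff_deriv_of_isOpen hI).1 (hPi i)).2
  have hp' : ∀ i, deriv (fun τ => P τ i) 0 = p i := fun i => (hasDerivAt_pi.1 hp i).deriv
  set s : Set (ℝ × Base) := (fun z => z.1 ^ 2) ⁻¹' I with hs
  have hso : IsOpen s := hI.preimage (by fun_prop)
  -- The implicit equation of the wave, `σ = ∑ Pᵢ'(σ²) xᵢ`. It gives `σ = p ⬝ᵥ x` to first order,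
  -- and the square keeps the jet stationary to first order at the origin.
  set f : ℝ × Base → ℝ := fun z => z.1 - ∑ i, deriv (fun τ => P τ i) (z.1 ^ 2) * z.2 i with hf
  have hA : ∀ i, ContDiffOn ℝ ∞ (fun z : ℝ × Base => deriv (fun τ => P τ i) (z.1 ^ 2)) s :=
    fun i => (hP' i).comp (contDiff_fst.pow 2).contDiffOn fun z hz => hz
  have hB : ∀ i, ContDiff ℝ ∞ (fun z : ℝ × Base => z.2 i) := fun i => by fun_prop
  have hfs : ContDiffOn ℝ ∞ f s :=
    contDiff_fst.contDiffOn.sub (ContDiffOn.sum fun i _ => (hA i).mul (hB i).contDiffOn)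
  have hs0 : (0 : ℝ × Base) ∈ s := by simpa [hs] using h0
  have hfd : ∀ z, fderiv ℝ f 0 z = z.1 - ∑ i, p i * z.2 i := by
    have h1 : ∀ i, HasFDerivAt (fun z : ℝ × Base => deriv (fun τ => P τ i) (z.1 ^ 2) * z.2 i)
        (p i • (ContinuousLinearMap.proj i).comp (ContinuousLinearMap.snd ℝ ℝ Base)) 0 := by
      intro i
      have hd := (((hA i).contDiffAt (hso.mem_nhds hs0)).differentiableAt (by simp)).hasFDerivAt
      have he : HasFDerivAt (fun z : ℝ × Base => z.2 i)
          ((ContinuousLinearMap.proj i).comp (ContinuousLinearMap.snd ℝ ℝ Base)) 0 :=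
        ((ContinuousLinearMap.proj i).comp (ContinuousLinearMap.snd ℝ ℝ Base)).hasFDerivAt
      refine (hd.mul he).congr_fderiv ?_
      simp [hp']
    have h2 := (hasFDerivAt_fst (𝕜 := ℝ) (p := (0 : ℝ × Base))).sub
      (HasFDerivAt.fun_sum (u := Finset.univ) fun i _ => h1 i)
    intro z
    have h3 : HasFDerivAt f _ 0 := h2
    rw [h3.fderiv]
    simp
  obtain ⟨ψ, O, hO, hO0, hψ, hψ0, hψd, h⟩ := exists_straightening hso hfs hs0 (by simp [hf])
    (ContinuousLinearMap.inl ℝ ℝ Base) (fun c => by rw [hfd]; simp)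
  -- The graph of `p ⬝ᵥ x` is the kernel of the derivative of `f`, so the straightening maps it into
  -- the zero set; since `ρ` is `inl`, it leaves `x` unchanged.
  set ζ : Base →L[ℝ] ℝ × Base :=
    (∑ i, p i • ContinuousLinearMap.proj i : Base →L[ℝ] ℝ).prod (ContinuousLinearMap.id ℝ Base)
    with hζ
  have hζ1 : ∀ x, (ζ x).1 = ∑ i, p i * x i := fun x => by simp [hζ]
  have hζ2 : ∀ x, (ζ x).2 = x := fun x => by simp [hζ]
  set σ : Base → ℝ := fun x => (ψ (ζ x)).1 with hσ
  set D : Set Base := ζ ⁻¹' O with hD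
  have hDo : IsOpen D := hO.preimage ζ.continuous
  have hD0 : (0 : Base) ∈ D := by simpa [hD] using hO0
  have hσs : ContDiffOn ℝ ∞ σ D :=
    contDiff_fst.comp_contDiffOn (hψ.comp ζ.contDiff.contDiffOn fun x hx => hx)
  have hσI : ∀ x ∈ D, σ x ^ 2 ∈ I := fun x hx => (h _ hx).1
  have hσe : ∀ x ∈ D, ∑ i, deriv (fun τ => P τ i) (σ x ^ 2) * x i = σ x := by
    intro x hx
    obtain ⟨-, h1, h2⟩ := h _ hx
    have h3 : (ψ (ζ x)).2 = x := by
      have := congrArg Prod.snd h1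
      simpa [hζ2] using this
    rw [hfd, hζ1, hζ2, sub_self, hf] at h2
    simp only [h3] at h2
    exact (sub_eq_zero.1 h2).symm
  -- The cubic makes the derivative of the potential in `σ` equal to `2σ (∑ Pᵢ'(σ²) xᵢ - σ) = 0`, so
  -- only the derivative in the explicit `x` remains.
  refine ⟨D, σ, fun x => (∑ i, P (σ x ^ 2) i * x i) - 2 / 3 * σ x ^ 3, hDo, hD0, hσs, ?_, ?_, ?_,
    fun x hx => ⟨hσI x hx, fun k => ?_⟩⟩
  · exact (ContDiffOn.sum fun i _ => (contDiffOn_comp_sq (hPi i) hσs hσI).mul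
      (contDiff_apply ℝ ℝ i).contDiffOn).sub (contDiffOn_const.mul (hσs.pow 3))
  · simp [hσ, hψ0]
  · intro k
    have h1 : HasFDerivAt σ ((ContinuousLinearMap.fst ℝ ℝ Base).comp ζ) 0 := by
      have h2 : HasFDerivAt ψ (ContinuousLinearMap.id ℝ (ℝ × Base)) (ζ 0) := by
        rw [map_zero]
        exact hψd.hasFDerivAt
      have h3 := (h2.comp 0 ζ.hasFDerivAt).fst
      exact h3
    rw [partialDeriv, h1.fderiv]
    simp [hζ, Pi.single_apply]
  · have h1 : ∀ i, DifferentiableAt ℝ (fun y => P (σ y ^ 2) i) x := fun i =>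
      (contDiffOn_comp_sq (hPi i) hσs hσI).differentiableAt_of_isOpen hDo hx
    have h2 : ∀ i, DifferentiableAt ℝ (fun y : Base => y i) x := fun i =>
      (differentiableAt_apply i x)
    have h3 : DifferentiableAt ℝ σ x := hσs.differentiableAt_of_isOpen hDo hx
    have h4 : ∀ i, partialDeriv k (fun y : Base => y i) x = if k = i then 1 else 0 := by
      intro i
      have : HasFDerivAt (fun y : Base => y i) (ContinuousLinearMap.proj i : Base →L[ℝ] ℝ) x :=
        (ContinuousLinearMap.proj i : Base →L[ℝ] ℝ).hasFDerivAt
      rw [partialDeriv, this.fderiv]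
      simp [Pi.single_apply, eq_comm]
    have h5 : partialDeriv k (fun y => σ y ^ 3) x = 3 * σ x ^ 2 * partialDeriv k σ x := by
      have h6 : HasFDerivAt (fun y => σ y ^ 3) _ x := h3.hasFDerivAt.pow 3
      rw [partialDeriv, h6.fderiv]
      simp [partialDeriv]
    rw [partialDeriv_sub (DifferentiableAt.fun_sum fun i _ => (h1 i).fun_mul (h2 i))
      ((h3.fun_pow 3).const_mul _), partialDeriv_sum fun i _ => (h1 i).fun_mul (h2 i),
      partialDeriv_const_mul (h3.fun_pow 3), h5]
    have h6 : ∀ i, partialDeriv k (fun y => P (σ y ^ 2) i * y i) x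
        = 2 * partialDeriv k σ x * σ x * (deriv (fun τ => P τ i) (σ x ^ 2) * x i)
          + P (σ x ^ 2) i * if k = i then 1 else 0 := by
      intro i
      rw [partialDeriv_mul (h1 i) (h2 i), h4, partialDeriv_comp_sq hDo hI (hPi i) hσs hσI hx]
      ring
    simp only [h6, Finset.sum_add_distrib, ← Finset.mul_sum, hσe x hx]
    simp
    ring

end FirstOrderSystem

namespace FirstOrderSystem

variable {S : FirstOrderSystem}

/-- The tangent vector `ξ ⊗ p` of rank one. -/
def rankOne (ξ : Fin 2 → ℝ) : Base →L[ℝ] JetSpace :=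
  ContinuousLinearMap.pi fun a => ξ a • ContinuousLinearMap.id ℝ Base

theorem rankOne_apply (ξ : Fin 2 → ℝ) (p : Base) (a : Fin 2) (i : Fin 4) :
    rankOne ξ p a i = ξ a * p i := by
  simp [rankOne]

theorem of_rankOne_mul (ξ : Fin 2 → ℝ) (p : Base) (E : Matrix (Fin 4) (Fin 4) ℝ) :
    Matrix.of (rankOne ξ p) * E = Matrix.of (rankOne ξ (p ᵥ* E)) := by
  ext a i
  simp only [Matrix.mul_apply, Matrix.of_apply, rankOne_apply, Matrix.vecMul, dotProduct,
    Finset.mul_sum, mul_assoc]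

/-- A covector `q` with `ξ ⊗ q` of prescribed contraction. -/
def covectorSection (ξ : Fin 2 → ℝ) : (Fin 2 → ℝ) →ₗ[ℝ] Base where
  toFun c := (ξ 0 ^ 2 + ξ 1 ^ 2)⁻¹ • ![ξ 0 * c 0, ξ 1 * c 0, ξ 0 * c 1, ξ 1 * c 1]
  map_add' c d := by
    ext i
    fin_cases i <;> simp <;> ring
  map_smul' r c := by
    ext i
    fin_cases i <;> simp <;> ring

theorem contr_rankOne_covectorSection {ξ : Fin 2 → ℝ} (hξ : ξ ≠ 0) (c : Fin 2 → ℝ) :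
    contr (Matrix.of (rankOne ξ (covectorSection ξ c))) = c := by
  have h : ξ 0 ^ 2 + ξ 1 ^ 2 ≠ 0 := by
    intro h
    apply hξ
    ext i
    fin_cases i <;> simp only [Fin.zero_eta, Fin.mk_one, Pi.zero_apply] <;> nlinarith
  ext k
  fin_cases k <;> simp [rankOne_apply, covectorSection] <;> field_simp

/-- A curve in the locus through `U` with tangent vectors `ξ ⊗ p`, `ξ` fixed. -/
theorem exists_rankOne_curve (hnd : S.Nondegenerate) {U : JetSpace} (hU : U ∈ S.locus)
    {ξ : Fin 2 → ℝ} (hξ : ξ ≠ 0) {p : Base} (hp : fderiv ℝ S.eqs U (rankOne ξ p) = 0) :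
    ∃ (P : ℝ → Base) (I : Set ℝ), IsOpen I ∧ 0 ∈ I ∧ ContDiffOn ℝ ∞ P I ∧ P 0 = 0 ∧
      HasDerivAt P p 0 ∧ ∀ τ ∈ I, U + rankOne ξ (P τ) ∈ S.locus := by
  set f : Base → Fin 2 → ℝ := fun q => S.eqs (U + rankOne ξ q) with hf
  set s : Set Base := (fun q => U + rankOne ξ q) ⁻¹' S.dom with hs
  have hso : IsOpen s := S.isOpen_dom.preimage (by fun_prop)
  have hs0 : (0 : Base) ∈ s := by simpa [hs] using hU.1
  have hfs : ContDiffOn ℝ ∞ f s := S.contDiffOn_eqs.comp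
    (contDiff_const.add (rankOne ξ).contDiff).contDiffOn fun q hq => hq
  have hfd : ∀ q, fderiv ℝ f 0 q = fderiv ℝ S.eqs U (rankOne ξ q) := by
    intro q
    have h1 : HasFDerivAt S.eqs (fderiv ℝ S.eqs U) (U + rankOne ξ 0) := by
      rw [map_zero, add_zero]
      exact hasFDerivAt_eqs hU.1
    have h2 : HasFDerivAt f ((fderiv ℝ S.eqs U).comp (rankOne ξ)) 0 :=
      HasFDerivAt.comp (g := S.eqs) (f := fun q => U + rankOne ξ q) (0 : Base) h1
        ((rankOne ξ).hasFDerivAt.const_add U)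
    rw [h2.fderiv]
    rfl
  -- For fixed nonzero `ξ` the two equations restricted to `U + ξ ⊗ q` are still independent, so the
  -- implicit function theorem applies to `q` alone.
  set ρ : (Fin 2 → ℝ) →L[ℝ] Base := LinearMap.toContinuousLinearMap
    ((Matrix.vecMulLinear (S.frame U)⁻¹).comp (covectorSection ξ)) with hρ
  have hρf : ∀ c, fderiv ℝ f 0 (ρ c) = c := by
    intro c
    rw [hfd, fderiv_eqs_apply hU.1, of_rankOne_mul]
    have : ρ c ᵥ* S.frame U = covectorSection ξ c := by
      change (covectorSection ξ c ᵥ* (S.frame U)⁻¹) ᵥ* S.frame U = _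
      rw [Matrix.vecMul_vecMul, Matrix.nonsing_inv_mul _ (isUnit_frame hnd hU), Matrix.vecMul_one]
    rw [this, contr_rankOne_covectorSection hξ]
  obtain ⟨ψ, O, hO, hO0, hψ, hψ0, hψd, h⟩ := exists_straightening hso hfs hs0
    (by simpa [hf] using (S.mem_locus_iff.1 hU).2) ρ hρf
  refine ⟨fun τ => ψ (τ • p), (fun τ : ℝ => τ • p) ⁻¹' O, hO.preimage (by fun_prop), by simpa,
    hψ.comp (contDiff_id.smul contDiff_const).contDiffOn fun τ hτ => hτ, by simp [hψ0], ?_, ?_⟩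
  · have h1 : HasDerivAt (fun τ : ℝ => τ • p) p 0 := by
      simpa using (hasDerivAt_id (0 : ℝ)).smul_const p
    have h2 : HasFDerivAt ψ (ContinuousLinearMap.id ℝ Base) ((0 : ℝ) • p) := by
      rw [zero_smul]
      exact hψd.hasFDerivAt
    exact h2.comp_hasDerivAt 0 h1
  · intro τ hτ
    obtain ⟨h1, -, h2⟩ := h _ hτ
    refine S.mem_locus_iff.2 ⟨h1, ?_⟩
    rw [hfd, map_smul, map_smul, hp, smul_zero] at h2
    exact h2

/-- A simple wave: a solution whose derivatives stay on a given curve of rank one. -/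
theorem exists_simpleWave {U : JetSpace} {ξ : Fin 2 → ℝ} {P : ℝ → Base} {I : Set ℝ}
    (hI : IsOpen I) (h0 : (0 : ℝ) ∈ I) (hP : ContDiffOn ℝ ∞ P I) {p : Base}
    (hp : HasDerivAt P p 0) (hloc : ∀ τ ∈ I, U + rankOne ξ (P τ) ∈ S.locus) :
    ∃ (D : Set Base) (u v σ : Base → ℝ), S.IsSolutionOn u v D ∧ 0 ∈ D ∧ ContDiffOn ℝ ∞ σ D ∧
      σ 0 = 0 ∧ (∀ k, partialDeriv k σ 0 = p k) ∧
      ∀ x ∈ D, σ x ^ 2 ∈ I ∧ jet u v x = U + rankOne ξ (P (σ x ^ 2)) := by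
  obtain ⟨D, σ, φ, hD, hD0, hσ, hφ, hσ0, hσd, h⟩ := exists_wave hI h0 hP hp
  set w : Fin 2 → Base → ℝ := fun a x => (∑ i, U a i * x i) + ξ a * φ x with hw
  have hlin : ∀ a, ContDiff ℝ ∞ fun x : Base => ∑ i, U a i * x i := fun a => by fun_prop
  have hws : ∀ a, ContDiffOn ℝ ∞ (w a) D := fun a =>
    (hlin a).contDiffOn.add (contDiffOn_const.mul hφ)
  have hj : ∀ x ∈ D, jet (w 0) (w 1) x = U + rankOne ξ (P (σ x ^ 2)) := by
    intro x hx
    have key : ∀ a k, partialDeriv k (w a) x = U a k + ξ a * P (σ x ^ 2) k := by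
      intro a k
      have hφx := hφ.differentiableAt_of_isOpen hD hx
      rw [hw, partialDeriv_add ((hlin a).differentiable (by simp) x) (hφx.const_mul _),
        partialDeriv_const_mul hφx, (h x hx).2]
      congr 1
      have h1 : HasFDerivAt (fun x : Base => ∑ i, U a i * x i)
          (∑ i, U a i • ContinuousLinearMap.proj i : Base →L[ℝ] ℝ) x := by
        have := (∑ i, U a i • ContinuousLinearMap.proj i : Base →L[ℝ] ℝ).hasFDerivAt (x := x)
        refine this.congr_of_eventuallyEq (.of_forall fun y => ?_)
        simp
      rw [partialDeriv, h1.fderiv]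
      simp [Pi.single_apply]
    ext a k
    rw [Pi.add_apply, Pi.add_apply, rankOne_apply, ← key]
    fin_cases a <;> rfl
  refine ⟨D, w 0, w 1, σ, ⟨hD, hws 0, hws 1, fun x hx => ?_⟩, hD0, hσ, hσ0, hσd, fun x hx =>
    ⟨(h x hx).1, hj x hx⟩⟩
  rw [hj x hx]
  exact hloc _ (h x hx).1

end FirstOrderSystem

/-! ### Flatness on simple waves gives second-order contact -/

namespace FirstOrderSystem

variable {S : FirstOrderSystem}

theorem cometric_transpose (U : JetSpace) : (S.cometric U)ᵀ = S.cometric U := by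
  ext i j
  simp only [Matrix.transpose_apply, cometric, Matrix.of_apply]
  ring

theorem dotProduct_cometric_comm (U : JetSpace) (q r : Fin 4 → ℝ) :
    q ⬝ᵥ S.cometric U *ᵥ r = r ⬝ᵥ S.cometric U *ᵥ q := by
  rw [Matrix.dotProduct_mulVec, ← Matrix.mulVec_transpose, cometric_transpose, dotProduct_comm]

/-- The derivative of the cometric at `U` in the direction `t`. -/
def cometricDeriv (S : FirstOrderSystem) (U t : JetSpace) : Matrix (Fin 4) (Fin 4) ℝ :=
  Matrix.of fun i j => fderiv ℝ (fun V => S.cometric V i j) U t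

section

attribute [local instance] Matrix.normedAddCommGroup Matrix.normedSpace

theorem hasDerivAt_metric_entry {c : ℝ → JetSpace} {c' : JetSpace} (hc : HasDerivAt c c' 0)
    (hU : c 0 ∈ S.dom) (hdet : (S.cometric (c 0)).det ≠ 0) (i j : Fin 4) :
    HasDerivAt (fun τ => (S.cometric (c τ))⁻¹ i j)
      ((-((S.cometric (c 0))⁻¹ * S.cometricDeriv (c 0) c' * (S.cometric (c 0))⁻¹)) i j) 0 := by
  have h1 : HasDerivAt (fun τ => S.cometric (c τ)) (S.cometricDeriv (c 0) c') 0 := by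
    refine hasDerivAt_pi.2 fun i => hasDerivAt_pi.2 fun j => ?_
    exact (((contDiffAt_cometric hU i j).differentiableAt (by simp)).hasFDerivAt).comp_hasDerivAt
      0 hc
  exact hasDerivAt_pi.1 (hasDerivAt_pi.1 (h1.matrix_inv hdet) i) j

end

/-- On a simple wave of a system with flat conformal structure, the characteristic variety
varies tangentially to the null planes. -/
theorem FlatOnSolutions.cometricDeriv_eq_zero (hflat : S.FlatOnSolutions) (hnd : S.Nondegenerate)
    {U : JetSpace} (hU : U ∈ S.locus) {ξ : Fin 2 → ℝ} (hξ : ξ ≠ 0) {p q r : Fin 4 → ℝ}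
    (hp : fderiv ℝ S.eqs U (rankOne ξ p) = 0) (hqq : q ⬝ᵥ S.cometric U *ᵥ q = 0)
    (hrr : r ⬝ᵥ S.cometric U *ᵥ r = 0) (hqr : q ⬝ᵥ S.cometric U *ᵥ r = 0)
    (hpq : p ⬝ᵥ S.cometric U *ᵥ q = 0) (hpr : p ⬝ᵥ S.cometric U *ᵥ r ≠ 0) :
    q ⬝ᵥ S.cometricDeriv U (rankOne ξ p) *ᵥ q = 0 := by
  obtain ⟨P, I, hI, hI0, hP, hP0, hPd, hloc⟩ := exists_rankOne_curve hnd hU hξ hp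
  obtain ⟨D, u, v, σ, hsol, hD0, hσ, hσ0, hσd, h⟩ := exists_simpleWave hI hI0 hP hPd hloc
  have hD := hsol.isOpen
  set c : ℝ → JetSpace := fun τ => U + rankOne ξ (P τ) with hc
  have hc0 : c 0 = U := by simp [hc, hP0]
  have hcs : ContDiffOn ℝ ∞ c I :=
    contDiffOn_const.add ((rankOne ξ).contDiff.comp_contDiffOn hP)
  have hcd : HasDerivAt c (rankOne ξ p) 0 :=
    ((rankOne ξ).hasFDerivAt.comp_hasDerivAt 0 hPd).const_add U
  have hGs : ∀ i j, ContDiffOn ℝ ∞ (fun τ => (S.cometric (c τ))⁻¹ i j) I := fun i j τ hτ =>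
    (ContDiffAt.matrix_inv (M := fun τ => S.cometric (c τ)) (fun i j => ContDiffAt.comp τ
      (contDiffAt_cometric (hloc τ hτ).1 i j) (hcs.contDiffAt (hI.mem_nhds hτ)))
      (hnd _ (hloc τ hτ)) i j).contDiffWithinAt
  set K := S.cometric U with hK
  have hKu : IsUnit K.det := isUnit_iff_ne_zero.2 (hnd U hU)
  set h' := -(K⁻¹ * S.cometricDeriv U (rankOne ξ p) * K⁻¹) with hh'
  have hGd : ∀ i j, deriv (fun τ => (S.cometric (c τ))⁻¹ i j) 0 = h' i j := by
    intro i j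
    have := (hasDerivAt_metric_entry hcd (by rw [hc0]; exact hU.1)
      (by rw [hc0]; exact hnd U hU) i j).deriv
    rw [this, hc0]
  have hσI : ∀ x ∈ D, σ x ^ 2 ∈ I := fun x hx => (h x hx).1
  have hg : ∀ i j, ∀ y ∈ D, S.metric u v y i j = (S.cometric (c (σ y ^ 2)))⁻¹ i j :=
    fun i j y hy => by rw [metric, (h y hy).2]
  have hgs : SmoothMat (S.metric u v) D := SmoothMat.inv hD hsol.smooth_cometric
    fun y hy => hnd _ (hsol.mem_locus y hy)
  have hdet : ∀ y ∈ D, (S.metric u v y).det ≠ 0 := fun y hy =>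
    (Matrix.isUnit_nonsing_inv_det _
      (isUnit_iff_ne_zero.2 (hnd _ (hsol.mem_locus y hy)))).ne_zero
  have hg1 : ∀ k i j, ∀ y ∈ D, partialDeriv k (fun y => S.metric u v y i j) y
      = partialDeriv k (fun y => (S.cometric (c (σ y ^ 2)))⁻¹ i j) y := fun k i j y hy =>
    partialDeriv_congr_of_isOpen hD (hg i j) hy k
  have hd : ∀ k i j, partialDeriv k (fun y => S.metric u v y i j) 0 = 0 := by
    intro k i j
    rw [hg1 k i j 0 hD0, partialDeriv_comp_sq hD hI (hGs i j) hσ hσI hD0, hσ0, mul_zero]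
  have hdd : ∀ k l i j, partialDeriv k (partialDeriv l fun y => S.metric u v y i j) 0
      = 2 * h' i j * p k * p l := by
    intro k l i j
    rw [partialDeriv_congr_of_isOpen hD (hg1 l i j) hD0,
      partialDeriv_partialDeriv_comp_sq hD hI (hGs i j) hσ hσI hD0 hσ0, hσd, hσd, hGd]
  have hg0 : S.metric u v 0 = K⁻¹ := by
    rw [metric, (h 0 hD0).2, hσ0, hK]
    simp [hP0]
  have hinv : ∀ a : Fin 4 → ℝ, K⁻¹ *ᵥ (K *ᵥ a) = a := fun a => by
    rw [Matrix.mulVec_mulVec, Matrix.nonsing_inv_mul _ hKu, Matrix.one_mulVec]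
  have hnull : ∀ a b : Fin 4 → ℝ, (K *ᵥ a) ⬝ᵥ S.metric u v 0 *ᵥ (K *ᵥ b) = b ⬝ᵥ K *ᵥ a :=
    fun a b => by rw [hg0, hinv, dotProduct_comm]
  have hrq : r ⬝ᵥ K *ᵥ q = 0 := by rw [hK, dotProduct_cometric_comm]; exact hqr
  -- Raising the indices of `q` and `r` gives a null plane on which `p` annihilates the first vector
  -- but not the second.
  have hW := Curvature.weyl_null_plane hD hD0 hgs hdet hd hdd (X := K *ᵥ q) (Y := K *ᵥ r)
    (by rw [hnull]; exact hqq) (by rw [hnull]; exact hrr) (by rw [hnull]; exact hrq)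
    (by rw [hnull]; exact hqr) hpq
  simp only [hflat D u v hsol 0 hD0, zero_mul, Finset.sum_const_zero] at hW
  have h1 : (K *ᵥ q) ⬝ᵥ h' *ᵥ (K *ᵥ q) = 0 :=
    (mul_eq_zero.1 (neg_eq_zero.1 hW.symm)).resolve_left (pow_ne_zero 2 hpr)
  have hsymm : K⁻¹ᵀ = K⁻¹ := by rw [Matrix.transpose_nonsing_inv, hK, cometric_transpose]
  rw [hh', Matrix.neg_mulVec, dotProduct_neg, neg_eq_zero, ← Matrix.mulVec_mulVec, hinv,
    ← Matrix.mulVec_mulVec, Matrix.dotProduct_mulVec, ← Matrix.mulVec_transpose, hsymm, hinv] at h1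
  exact h1

end FirstOrderSystem

namespace FirstOrderSystem

variable {S : FirstOrderSystem}

/-- The value of the quadric at `q` is the determinant of the symbol, written through derivatives of
`(F, H)` so that differentiating it brings in the second derivatives. -/
theorem dotProduct_cometric_self {U : JetSpace} (hU : U ∈ S.dom) (q : Fin 4 → ℝ) :
    q ⬝ᵥ S.cometric U *ᵥ q
      = fderiv ℝ S.eqs U (rankOne ![1, 0] q) 0 * fderiv ℝ S.eqs U (rankOne ![0, 1] q) 1
        - fderiv ℝ S.eqs U (rankOne ![0, 1] q) 0 * fderiv ℝ S.eqs U (rankOne ![1, 0] q) 1 := by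
  have h : q ⬝ᵥ S.cometric U *ᵥ q
      = (q ᵥ* S.frame U) ⬝ᵥ modelCometric *ᵥ (q ᵥ* S.frame U) := by
    rw [cometric_eq, ← Matrix.mulVec_mulVec, ← Matrix.mulVec_mulVec, Matrix.dotProduct_mulVec,
      Matrix.mulVec_transpose]
  rw [h]
  simp only [fderiv_eqs_apply hU, of_rankOne_mul]
  generalize q ᵥ* S.frame U = e
  simp [dotProduct, Matrix.mulVec, modelCometric, Fin.sum_univ_four, rankOne_apply]
  ring

theorem dotProduct_cometricDeriv_self {U : JetSpace} (hU : U ∈ S.dom) (t : JetSpace)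
    (q : Fin 4 → ℝ) : q ⬝ᵥ S.cometricDeriv U t *ᵥ q
      = fderiv ℝ (fderiv ℝ S.eqs) U t (rankOne ![1, 0] q) 0
          * fderiv ℝ S.eqs U (rankOne ![0, 1] q) 1
        + fderiv ℝ S.eqs U (rankOne ![1, 0] q) 0
          * fderiv ℝ (fderiv ℝ S.eqs) U t (rankOne ![0, 1] q) 1
        - fderiv ℝ (fderiv ℝ S.eqs) U t (rankOne ![0, 1] q) 0
          * fderiv ℝ S.eqs U (rankOne ![1, 0] q) 1
        - fderiv ℝ S.eqs U (rankOne ![0, 1] q) 0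
          * fderiv ℝ (fderiv ℝ S.eqs) U t (rankOne ![1, 0] q) 1 := by
  have hl : HasDerivAt (fun τ : ℝ => U + τ • t) t 0 := by
    simpa using ((hasDerivAt_id (0 : ℝ)).smul_const t).const_add U
  have hl0 : U + (0 : ℝ) • t = U := by simp
  have h1 : HasDerivAt (fun τ : ℝ => q ⬝ᵥ S.cometric (U + τ • t) *ᵥ q)
      (q ⬝ᵥ S.cometricDeriv U t *ᵥ q) 0 := by
    have he : ∀ i j, HasDerivAt (fun τ : ℝ => S.cometric (U + τ • t) i j)
        (S.cometricDeriv U t i j) 0 := fun i j => by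
      have := ((contDiffAt_cometric hU i j).differentiableAt (by simp)).hasFDerivAt
      rw [← hl0] at this
      have := this.comp_hasDerivAt (0 : ℝ) hl
      rw [hl0] at this
      exact this
    simp only [dotProduct, Matrix.mulVec]
    exact HasDerivAt.fun_sum fun i _ => (HasDerivAt.fun_sum fun j _ =>
      (he i j).mul_const (q j)).const_mul (q i)
  have hA : ∀ (s : JetSpace) (k : Fin 2), HasDerivAt (fun τ : ℝ => fderiv ℝ S.eqs (U + τ • t) s k)
      (fderiv ℝ (fderiv ℝ S.eqs) U t s k) 0 := fun s k => by
    have := hasFDerivAt_fderiv_eqs hU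
    rw [← hl0] at this
    have := this.comp_hasDerivAt (0 : ℝ) hl
    rw [hl0] at this
    have := this.clm_apply (hasDerivAt_const (0 : ℝ) s)
    simp only [map_zero, add_zero] at this
    exact hasDerivAt_pi.1 this k
  have h2 := ((hA (rankOne ![1, 0] q) 0).mul (hA (rankOne ![0, 1] q) 1)).sub
    ((hA (rankOne ![0, 1] q) 0).mul (hA (rankOne ![1, 0] q) 1))
  have hev : ∀ᶠ τ : ℝ in 𝓝 0, U + τ • t ∈ S.dom :=
    hl.continuousAt.eventually_mem (by rw [hl0]; exact S.isOpen_dom.mem_nhds hU)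
  have h3 := h2.congr_of_eventuallyEq
    (hev.mono fun τ hτ => dotProduct_cometric_self hτ q)
  rw [h1.unique h3]
  simp only [hl0]
  ring

theorem rankOne_eq (z w : ℝ) (q : Base) :
    rankOne ![z, w] q = z • rankOne ![1, 0] q + w • rankOne ![0, 1] q := by
  ext a i
  fin_cases a <;> simp [rankOne_apply]

/-- The covector `n ⊗ (-y, x)` of the model. -/
def nullCovector (x y n₀ n₁ : ℝ) : Fin 4 → ℝ := ![-(n₀ * y), n₀ * x, -(n₁ * y), n₁ * x]

theorem simpleJet_eq_rankOne (x y n₀ n₁ : ℝ) :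
    simpleJet x y n₀ n₁ = Matrix.of (rankOne ![x, y] (nullCovector x y n₀ n₁)) := by
  ext a i
  fin_cases a <;> fin_cases i <;>
    simp [simpleJet, modelJet, rankOne_apply, nullCovector] <;> ring

theorem ofFrame_simpleJet (U : JetSpace) (x y n₀ n₁ : ℝ) :
    S.ofFrame U (simpleJet x y n₀ n₁)
      = rankOne ![x, y] (nullCovector x y n₀ n₁ ᵥ* (S.frame U)⁻¹) := by
  rw [ofFrame, simpleJet_eq_rankOne, of_rankOne_mul, Equiv.symm_apply_apply]

theorem dotProduct_cometric_nullCovector (hnd : S.Nondegenerate) {U : JetSpace}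
    (hU : U ∈ S.locus) (x y n₀ n₁ z w m₀ m₁ : ℝ) :
    (nullCovector x y n₀ n₁ ᵥ* (S.frame U)⁻¹) ⬝ᵥ S.cometric U *ᵥ
      (nullCovector z w m₀ m₁ ᵥ* (S.frame U)⁻¹)
      = (n₀ * m₁ - n₁ * m₀) * (x * w - y * z) / 2 := by
  rw [cometric_eq, ← Matrix.mulVec_mulVec, ← Matrix.mulVec_mulVec, Matrix.dotProduct_mulVec,
    Matrix.mulVec_transpose, Matrix.vecMul_vecMul, Matrix.vecMul_vecMul,
    Matrix.nonsing_inv_mul _ (isUnit_frame hnd hU), Matrix.vecMul_one, Matrix.vecMul_one]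
  simp [dotProduct, Matrix.mulVec, modelCometric, Fin.sum_univ_four, nullCovector]
  ring

/-- At the null covector `m ⊗ (-w, z)` the symbol has rank at most one, with entries `mₖ` times `-w`
and `z`. The derivative of its determinant therefore collapses to one pairing of the second
derivative with `(m₁, -m₀)`. -/
theorem FlatOnSolutions.secondForm_eq_zero (hflat : S.FlatOnSolutions) (hnd : S.Nondegenerate)
    {U : JetSpace} (hU : U ∈ S.locus) {x y n₀ n₁ z w m₀ m₁ z' w' l₀ l₁ : ℝ}
    (hξ : x ≠ 0 ∨ y ≠ 0) (hpq : (n₀ * m₁ - n₁ * m₀) * (x * w - y * z) = 0)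
    (hqr : (m₀ * l₁ - m₁ * l₀) * (z * w' - w * z') = 0)
    (hpr : (n₀ * l₁ - n₁ * l₀) * (x * w' - y * z') ≠ 0) :
    m₁ * S.secondForm U (simpleJet x y n₀ n₁) (simpleJet z w m₀ m₁) 0
      - m₀ * S.secondForm U (simpleJet x y n₀ n₁) (simpleJet z w m₀ m₁) 1 = 0 := by
  have hξ' : ![x, y] ≠ (0 : Fin 2 → ℝ) := by
    intro h
    have h0 := congrFun h 0
    have h1 := congrFun h 1
    simp at h0 h1
    tauto
  set q := nullCovector z w m₀ m₁ ᵥ* (S.frame U)⁻¹ with hq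
  set t := rankOne ![x, y] (nullCovector x y n₀ n₁ ᵥ* (S.frame U)⁻¹) with ht
  have htan : fderiv ℝ S.eqs U t = 0 := by
    rw [ht, ← ofFrame_simpleJet, fderiv_ofFrame hnd hU]
    exact contr_modelJet _ _ _ _ _ _
  have key := hflat.cometricDeriv_eq_zero hnd hU hξ' htan
    (q := q) (r := nullCovector z' w' l₀ l₁ ᵥ* (S.frame U)⁻¹)
    (by rw [hq, dotProduct_cometric_nullCovector hnd hU]; ring)
    (by rw [dotProduct_cometric_nullCovector hnd hU]; ring)
    (by rw [hq, dotProduct_cometric_nullCovector hnd hU, hqr, zero_div])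
    (by rw [hq, dotProduct_cometric_nullCovector hnd hU, hpq, zero_div])
    (by
      rw [dotProduct_cometric_nullCovector hnd hU]
      exact div_ne_zero hpr two_ne_zero)
  have he : ∀ η : Fin 2 → ℝ, fderiv ℝ S.eqs U (rankOne η q)
      = contr (Matrix.of (rankOne η (nullCovector z w m₀ m₁))) := fun η => by
    rw [fderiv_eqs_apply hU.1, of_rankOne_mul, hq, Matrix.vecMul_vecMul,
      Matrix.nonsing_inv_mul _ (isUnit_frame hnd hU), Matrix.vecMul_one]
  rw [← ht, dotProduct_cometricDeriv_self hU.1] at key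
  simp only [he, contr_apply_zero, contr_apply_one, Matrix.of_apply, rankOne_apply, nullCovector,
    Matrix.cons_val] at key
  simp only [secondForm, ofFrame_simpleJet, ← hq, ← ht]
  rw [rankOne_eq z w, map_add, map_smul, map_smul]
  simp only [Pi.add_apply, Pi.smul_apply, smul_eq_mul]
  linear_combination key

theorem FlatOnSolutions.osculating (hflat : S.FlatOnSolutions) (hnd : S.Nondegenerate) :
    S.Osculating := by
  intro U hU
  set ι : Matrix (Fin 2) (Fin 4) ℝ →ₗ[ℝ] JetSpace :=
    { toFun := S.ofFrame U
      map_add' := fun s t => by rw [ofFrame, Matrix.add_mul]; rfl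
      map_smul' := fun r s => by rw [ofFrame, Matrix.smul_mul]; rfl } with hι
  set b : JetSpace →ₗ[ℝ] JetSpace →ₗ[ℝ] (Fin 2 → ℝ) := LinearMap.mk₂ ℝ
    (fun s t => fderiv ℝ (fderiv ℝ S.eqs) U s t) (fun s s' t => by rw [map_add]; rfl)
    (fun r s t => by rw [map_smul]; rfl) (fun s t t' => map_add _ _ _)
    (fun r s t => map_smul _ _ _) with hb
  have hbi : ∀ s t, b.compl₁₂ ι ι s t = S.secondForm U s t := fun s t => rfl
  obtain ⟨C, hC⟩ := exists_contr_of_simpleJet (b.compl₁₂ ι ι)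
    (fun s t => by rw [hbi, hbi]; exact fderiv_fderiv_eqs_comm hU.1 _ _)
    (fun x y n₀ n₁ m₀ m₁ hxy hnm => by
      rw [hbi]
      -- Here `q` shares the direction `(x, y)` with `p`, and `r` shares `m` with `q` but has the
      -- orthogonal direction, so `p` and `r` pair to a multiple of `x² + y²`.
      refine hflat.secondForm_eq_zero hnd hU (z' := -y) (w' := x) (l₀ := m₀) (l₁ := m₁) hxy
        (by ring) (by ring) (mul_ne_zero hnm ?_)
      intro h
      have : x ^ 2 + y ^ 2 = 0 := by linear_combination h
      rcases hxy with hx | hy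
      · nlinarith [sq_nonneg y, sq_pos_of_ne_zero hx]
      · nlinarith [sq_nonneg x, sq_pos_of_ne_zero hy])
    (fun x y z w n₀ n₁ hxy hn => by
      rw [hbi]
      -- The other family of null planes: `q` shares `n` with `p`, and `r` shares `(z, w)` with `q`
      -- but has the vector orthogonal to `n`.
      refine hflat.secondForm_eq_zero hnd hU (z' := z) (w' := w) (l₀ := -n₁) (l₁ := n₀) ?_
        (by ring) (by ring) (mul_ne_zero ?_ hxy)
      · by_contra! h
        apply hxy
        rw [h.1, h.2]
        ring
      · intro h
        have : n₀ ^ 2 + n₁ ^ 2 = 0 := by linear_combination h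
        rcases hn with hx | hy
        · nlinarith [sq_nonneg n₁, sq_pos_of_ne_zero hx]
        · nlinarith [sq_nonneg n₀, sq_pos_of_ne_zero hy])
  refine ⟨S.frame U * C, fun t ht => ?_⟩
  rw [fderiv_eqs_apply hU.1] at ht
  have h := hC _ ht
  rw [hbi, secondForm, ofFrame_of_mul_frame hnd hU] at h
  rw [h, fderiv_eqs_apply hU.1, Equiv.apply_symm_apply]
  simp only [Matrix.mul_assoc]

end FirstOrderSystem

end

theorem theorem4 (S : FirstOrderSystem) (hconn : IsConnected S.locus) (hnd : S.Nondegenerate) :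
    List.TFAE [
      S.Linearisable,
      ∃ G : Subgroup FirstOrderSystem.SL6,
        FirstOrderSystem.lieDim G = 13 ∧ S.InvariantUnder G,
      S.FlatOnSolutions] := by
  tfae_have 1 → 2 := fun h => h.exists_invariantUnder hconn.nonempty hnd
  tfae_have 1 → 3 := fun h => h.flatOnSolutions hconn.nonempty hnd
  tfae_have 2 → 1 := by
    rintro ⟨G, hdim, hG⟩
    exact (hG.osculating hnd hdim).linearisable hconn hnd
  tfae_have 3 → 1 := fun h => (h.osculating hnd).linearisable hconn hnd
  tfae_finish
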